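/- **Setting.** Let $E$ be a real vector space and $\sigma:E\times E\to\mathbb R$ a bilinear antisymmetric form. Equip $E$ with the finest locally convex topology $\tau_{\mathrm{il}}$, and let $\mathsf B(E)$ be its Borel $\sigma$-algebra. For a complex measure $\mu$ on $\mathsf B(E)$ let $|\mu|$ be its variation and $\|\mu\|_1=|\mu|(E)$. For a finite dimensional subspace $V\subseteq E$ let $\mathcal M(V)$ be the complex measures concentrated on $V$, $\mathcal M(V)_d$ those concentrated on a countable subset of $V$, $\mathcal M(V)_c$ those without atoms, and $\mathcal M(V)_a$ those absolutely continuous with respect to Haar measure on $V$. Let $\mathcal M(E)$, $\mathcal M(E)_d$, $\mathcal M(E)_c$ be the $\|\cdot\|_1$-closures of $\bigcup_V\mathcal M(V)$, $\bigcup_V\mathcal M(V)_d$, $\bigcup_V\mathcal M(V)_c$ ($V$ ranging over the finite dimensional subspaces), and let $\mathcal M(E)_{df}$ be the finite linear combinations of point measures. For $\hbar\in\mathbb R$ and $\mu,\nu\in\mathcal M(E)$ put, for $\Lambda\in\mathsf B(E)$ with characteristic function also denoted by $\Lambda$, $$(\mu\star_\hbar\nu)(\Lambda)=\int_E d\mu(f)\int_E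 d\nu(g)\,e^{-\frac i2\hbar\sigma(f,g)}\Lambda(f+g),\qquad \mu^*(\Lambda)=\overline{\mu(-\Lambda)} .$$ For a seminorm $\kappa$ on $E$ and $n\in\{0,1,2,\dots\}\cup\{\infty\}$ let $\mathcal M^n_\kappa(E)$ be the set of $\mu\in\mathcal M(E)$ with $\int\kappa^m\,d|\mu|<\infty$ for all finite $0\le m\le n$. For finite $n$ put $\|\mu\|^n_\kappa=\sum_{m=0}^n\int\kappa^m\,d|\mu|$ and give $\mathcal M^n_\kappa(E)$ the topology of this norm; give $\mathcal M^\infty_\kappa(E)$ the topology $\upsilon_\kappa$ of all norms $\|\cdot\|_\kappa^m$, $m<\infty$. Let $c_n=\max_{0\le k\le n}\binom nk$. A *Poisson algebra* is a commutative $*$-algebra over $\mathbb C$, $*$-isomorphic to a norm-dense $*$-subalgebra of a (not necessarily unital) commutative $C^*$-algebra, with a bilinear, anticommutative bracket that is real ($\{A,B\}^*=\{A^*,B^*\}$) and satisfies the Jacobi identity and the Leibniz rule. **Theorem.** Let $\varsigma$ be a seminorm on $E$ and $c>0$ a constant with $|\sigma(f,g)|\le c\,\varsigma(f)\varsigma(g)$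 for all $f,g\in E$. 1. For all $\hbar\in\mathbb R$ and $\mu,\nu\in\mathcal M(E)$ the formula for $\mu\star_\hbar\nu$ defines a measure in $\mathcal M(E)$. For all $\mu,\nu\in\mathcal M^1_\varsigma(E)$ the formula $$\{\mu,\nu\}_0(\Lambda)=\int_E d\mu(f)\int_E d\nu(g)\,\sigma(f,g)\,\Lambda(f+g),\qquad\Lambda\in\mathsf B(E),$$ defines a measure $\{\mu,\nu\}_0\in\mathcal M(E)$ (the integrals exist). 2. If $1\le n<\infty$ and $\mu,\nu\in\mathcal M^n_\varsigma(E)$, then $\{\mu,\nu\}_0\in\mathcal M^{n-1}_\varsigma(E)$ and $\|\{\mu,\nu\}_0\|^{n-1}_\varsigma\le c\,c_{n-1}\,\|\mu\|^n_\varsigma\,\|\nu\|^n_\varsigma$. 3. Put $\{\mu,\nu\}_\hbar=\frac i\hbar(\mu\star_\hbar\nu-\nu\star_\hbar\mu)$ for $\hbar\ne0$. For every $n\in\{1,2,\dots\}\cup\{\infty\}$ (with $\infty-1=\infty$) the map $\mathbb R\times\mathcal M^n_\varsigma(E)\times\mathcal M^n_\varsigma(E)\to\mathcal M^{n-1}_\varsigma(E)$,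 $(\hbar,\mu,\nu)\mapsto\{\mu,\nu\}_\hbar$, is well defined and jointly continuous. 4. The map $\{\cdot,\cdot\}_0:\mathcal M^\infty_\varsigma(E)\times\mathcal M^\infty_\varsigma(E)\to\mathcal M^\infty_\varsigma(E)$ is jointly continuous for $\upsilon_\varsigma$, and $(\mathcal M^\infty_\varsigma(E),\star_0,{}^*,\{\cdot,\cdot\}_0)$ is a Poisson algebra. 5. Let $\mathcal P$ be one of the following: - (I) $\mathcal M^\infty_\kappa(E)$ for a seminorm $\kappa$ with $\varsigma\le C\kappa$ for some $C\ge0$; - (II) $\mathcal M(E)\cap\bigcap_{\kappa\in K}\mathcal M^\infty_\kappa(E)$ for a set $K$ of seminorms for which there are a finite $\Gamma\subseteq K$ and constants $a_\kappa>0$ with $\varsigma\le\sum_{\kappa\in\Gamma}a_\kappa\kappa$; - (III) the intersection of a space from (I) or (II) with $\mathcal M(E)_d$ or with $\mathcal M(E)_c$; - (IV) $\mathcal M(E)_{df}$; or an intersection of one of these with $\mathcal M(V)_a$ for one or several finite dimensional subspaces $V$ of $E$. Then $\mathcal P\subseteq\mathcal M^\infty_\varsigma(E)$, $(\mathcal P,\star_0,{}^*,\{\cdot,\cdot\}_0)$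 is a Poisson algebra, and $\mu\star_\hbar\nu\in\mathcal P$ for all $\mu,\nu\in\mathcal P$ and $\hbar\in\mathbb R$. -/

import Mathlib

open MeasureTheory Set Topology
open scoped ENNReal NNReal ComplexConjugate

namespace WeylMeasure

universe u

noncomputable section

/-! ### The finest locally convex topology -/

/-- The finest locally convex vector space topology on a real vector space
(in Mathlib's order on topologies, smaller means finer). -/
@[reducible] def finestLocallyConvex (E : Type u) [AddCommGroup E] [Module ℝ E] : TopologicalSpace E :=
  sInf {t | @IsTopologicalAddGroup E t _ ∧ @ContinuousSMul ℝ E _ _ t ∧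
    @LocallyConvexSpace ℝ E _ _ _ _ t}

/-! ### The total variation norm and moments of complex measures -/

section Norms

variable {E : Type u} [AddCommGroup E] [Module ℝ E] [MeasurableSpace E]

/-- The total variation norm `‖μ‖₁ = |μ|(E)`, as an extended real number. -/
def tvNorm (μ : ComplexMeasure E) : ℝ≥0∞ := μ.variation univ

/-- The `m`-th moment `∫ κ(f)^m d|μ|(f)`, i.e. the total variation norm of the `m`-th moment
measure of `μ`, as an extended real number. -/
def moment (κ : Seminorm ℝ E) (m : ℕ) (μ : ComplexMeasure E) : ℝ≥0∞ :=
  ∫⁻ f, ENNReal.ofReal (κ f ^ m) ∂μ.variation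

/-- `‖μ‖_κ^n = ∑_{m=0}^n ∫ κ^m d|μ|`. -/
def momentNorm (κ : Seminorm ℝ E) (n : ℕ) (μ : ComplexMeasure E) : ℝ≥0∞ :=
  ∑ m ∈ Finset.range (n + 1), moment κ m μ

theorem moment_zero_measure (κ : Seminorm ℝ E) (m : ℕ) :
    moment κ m (0 : ComplexMeasure E) = 0 := by
  simp [moment]

theorem moment_neg (κ : Seminorm ℝ E) (m : ℕ) (μ : ComplexMeasure E) :
    moment κ m (-μ) = moment κ m μ := by
  simp [moment]

theorem moment_add_le (κ : Seminorm ℝ E) (m : ℕ) (μ ν : ComplexMeasure E) :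
    moment κ m (μ + ν) ≤ moment κ m μ + moment κ m ν := by
  unfold moment
  rw [← lintegral_add_measure]
  exact lintegral_mono' VectorMeasure.variation_add_le le_rfl

/-- The (extended) distance `‖μ - ν‖_κ^n`. It is finite between measures of finite `n`-th norm. -/
@[reducible] def momentEDist (κ : Seminorm ℝ E) (n : ℕ) : PseudoEMetricSpace (ComplexMeasure E) where
  edist μ ν := momentNorm κ n (μ - ν)
  edist_self μ := by simp [momentNorm, moment_zero_measure]
  edist_comm μ ν := by
    simp only [momentNorm]
    rw [← neg_sub]
    simp only [moment_neg]
  edist_triangle μ ν ρ := by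
    simp only [momentNorm]
    rw [← Finset.sum_add_distrib]
    refine Finset.sum_le_sum fun m _ => ?_
    rw [← sub_add_sub_cancel μ ν ρ]
    exact moment_add_le κ m _ _

/-- For finite `n`, the topology of the norm `‖·‖_κ^n`; for `n = ∞`, the topology generated by all
these norms. It is only used through its restriction to `momentSpace κ n`. -/
@[reducible] def momentTopology (κ : Seminorm ℝ E) (n : ℕ∞) : TopologicalSpace (ComplexMeasure E) :=
  match n with
  | ⊤ => ⨅ m : ℕ, (momentEDist κ m).toUniformSpace.toTopologicalSpace
  | (m : ℕ) => (momentEDist κ m).toUniformSpace.toTopologicalSpace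

/-- The closure of a set of complex measures in the total variation norm. -/
def tvClosure (S : Set (ComplexMeasure E)) : Set (ComplexMeasure E) :=
  {μ | ∀ ε : ℝ≥0∞, 0 < ε → ∃ ν ∈ S, tvNorm (μ - ν) < ε}

/-! ### Spaces of measures -/

/-- The complex measures concentrated on the subspace `V` (the image of the complex Borel measures
on `V`, when `V` is finite dimensional). -/
def concentratedOn (V : Submodule ℝ E) : Set (ComplexMeasure E) :=
  {μ | μ.variation (V : Set E)ᶜ = 0}

/-- The discrete measures on `V`: those concentrated on a countable set. -/
def discreteOn (V : Submodule ℝ E) : Set (ComplexMeasure E) :=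
  {μ | μ ∈ concentratedOn V ∧ ∃ S : Set E, S.Countable ∧ μ.variation Sᶜ = 0}

/-- The continuous measures on `V`: those without atoms. -/
def atomlessOn (V : Submodule ℝ E) : Set (ComplexMeasure E) :=
  {μ | μ ∈ concentratedOn V ∧ ∀ f : E, μ {f} = 0}

/-- A Haar measure of the finite dimensional subspace `V`, regarded as a measure on `E`: the image
of Lebesgue measure under the coordinates of a basis of `V`. -/
def haarOn (V : Submodule ℝ E) [FiniteDimensional ℝ V] : Measure E :=
  Measure.map (fun x : Fin (Module.finrank ℝ V) → ℝ =>
    ((∑ i, x i • Module.finBasis ℝ V i : V) : E)) volume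

/-- The measures concentrated on `V` and absolutely continuous for the Haar measure of `V`. -/
def absContOn (V : Submodule ℝ E) [FiniteDimensional ℝ V] : Set (ComplexMeasure E) :=
  {μ | μ ∈ concentratedOn V ∧ μ.variation ≪ haarOn V}

variable (E) in
/-- `M(E)`: the total variation closure of the measures concentrated on finite dimensional
subspaces. -/
def regularMeasures : Set (ComplexMeasure E) :=
  tvClosure {μ | ∃ V : Submodule ℝ E, FiniteDimensional ℝ V ∧ μ ∈ concentratedOn V}

variable (E) in
/-- `M(E)_d`. -/
def discreteMeasures : Set (ComplexMeasure E) :=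
  tvClosure {μ | ∃ V : Submodule ℝ E, FiniteDimensional ℝ V ∧ μ ∈ discreteOn V}

variable (E) in
/-- `M(E)_c`. -/
def continuousMeasures : Set (ComplexMeasure E) :=
  tvClosure {μ | ∃ V : Submodule ℝ E, FiniteDimensional ℝ V ∧ μ ∈ atomlessOn V}

variable (E) in
/-- `M(E)_df`: the finite linear combinations of point measures. -/
def finiteMeasures : Set (ComplexMeasure E) :=
  (Submodule.span ℂ (range fun f : E => VectorMeasure.dirac f (1 : ℂ)) :
    Submodule ℂ (ComplexMeasure E))

/-- `M_κ^n(E)`, for `n ∈ ℕ ∪ {∞}`. -/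
def momentSpace (κ : Seminorm ℝ E) (n : ℕ∞) : Set (ComplexMeasure E) :=
  {μ | μ ∈ regularMeasures E ∧ ∀ m : ℕ, (m : ℕ∞) ≤ n → moment κ m μ < ∞}

/-! ### Products of measures -/

/-- The integrand `k(f,g) Λ(f+g)`, where `Λ` also denotes its characteristic function. -/
def kernelIntegrand (k : E → E → ℂ) (Λ : Set E) (f g : E) : ℂ :=
  k f g * Λ.indicator (fun _ => (1 : ℂ)) (f + g)

/-- The iterated integral `∫ dμ(f) ∫ dν(g) k(f,g) Λ(f+g)`. -/
def kernelIntegral (k : E → E → ℂ) (μ ν : ComplexMeasure E) (Λ : Set E) : ℂ :=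
  μ.integral (fun f => ν.integral (kernelIntegrand k Λ f) (ContinuousLinearMap.mul ℝ ℂ))
    (ContinuousLinearMap.mul ℝ ℂ)

open Classical in
/-- The complex measure `Λ ↦ ∫ dμ(f) ∫ dν(g) k(f,g) Λ(f+g)`, if this set function is one
(and `0` otherwise). -/
def kernelProduct (k : E → E → ℂ) (μ ν : ComplexMeasure E) : ComplexMeasure E :=
  if h : ∃ ρ : ComplexMeasure E, ∀ Λ, MeasurableSet Λ → ρ Λ = kernelIntegral k μ ν Λ
  then h.choose else 0

/-- The formula for `kernelProduct` makes sense: the inner and the outer integrand are integrable,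
and the iterated integrals are the values of the complex measure `kernelProduct k μ ν`. -/
def KernelProductDefined (k : E → E → ℂ) (μ ν : ComplexMeasure E) : Prop :=
  ∀ Λ : Set E, MeasurableSet Λ →
    (∀ f, ν.Integrable (kernelIntegrand k Λ f)) ∧
    μ.Integrable (fun f => ν.integral (kernelIntegrand k Λ f) (ContinuousLinearMap.mul ℝ ℂ)) ∧
    kernelProduct k μ ν Λ = kernelIntegral k μ ν Λ

/-- The kernel `exp(-(i/2) ħ σ(f,g))`. -/
def twistKernel (σ : E →ₗ[ℝ] E →ₗ[ℝ] ℝ) (ħ : ℝ) (f g : E) : ℂ :=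
  Complex.exp (-(Complex.I / 2) * ħ * σ f g)

/-- The twisted convolution `μ ⋆_ħ ν`. -/
def twistedConv (σ : E →ₗ[ℝ] E →ₗ[ℝ] ℝ) (ħ : ℝ) (μ ν : ComplexMeasure E) : ComplexMeasure E :=
  kernelProduct (twistKernel σ ħ) μ ν

/-- The bracket `{μ, ν}_0`. -/
def poissonBracket (σ : E →ₗ[ℝ] E →ₗ[ℝ] ℝ) (μ ν : ComplexMeasure E) : ComplexMeasure E :=
  kernelProduct (fun f g => (σ f g : ℂ)) μ ν

open Classical in
/-- The bracket `{μ, ν}_ħ`: the scaled commutator `(i/ħ)(μ ⋆_ħ ν - ν ⋆_ħ μ)` for `ħ ≠ 0`, and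
`{μ, ν}_0` for `ħ = 0`. -/
def bracket (σ : E →ₗ[ℝ] E →ₗ[ℝ] ℝ) (ħ : ℝ) (μ ν : ComplexMeasure E) : ComplexMeasure E :=
  if ħ = 0 then poissonBracket σ μ ν
  else (Complex.I / (ħ : ℂ)) • (twistedConv σ ħ μ ν - twistedConv σ ħ ν μ)

/-- The involution `μ*(Λ) = conj (μ(-Λ))`. -/
def involution (μ : ComplexMeasure E) : ComplexMeasure E :=
  (μ.map (fun f => -f)).mapRange (starRingEnd ℂ).toAddMonoidHom Complex.continuous_conj

theorem involution_apply [MeasurableNeg E] (μ : ComplexMeasure E) {Λ : Set E}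
    (hΛ : MeasurableSet Λ) : involution μ Λ = conj (μ (-Λ)) := by
  simp only [involution, VectorMeasure.mapRange_apply]
  rw [VectorMeasure.map_apply _ measurable_neg hΛ]
  rfl

end Norms

/-! ### Poisson algebras -/

/-- The subset `P` of the complex vector space `V` is a linear subspace which, with the product
`mul`, the involution `inv` and the bracket `br`, is a Poisson algebra: a commutative `*`-algebra
with a bilinear, anticommutative, real bracket that satisfies the Jacobi identity and the Leibniz
rule, and that is `*`-isomorphic to a norm-dense `*`-subalgebra of a commutative C*-algebra. -/
structure IsPoissonAlgebra {V : Type u} [AddCommGroup V] [Module ℂ V] (P : Set V)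
    (mul : V → V → V) (inv : V → V) (br : V → V → V) : Prop where
  zero_mem : (0 : V) ∈ P
  add_mem : ∀ x ∈ P, ∀ y ∈ P, x + y ∈ P
  smul_mem : ∀ (z : ℂ), ∀ x ∈ P, z • x ∈ P
  mul_mem : ∀ x ∈ P, ∀ y ∈ P, mul x y ∈ P
  mul_add_left : ∀ x ∈ P, ∀ y ∈ P, ∀ w ∈ P, mul (x + y) w = mul x w + mul y w
  mul_smul_left : ∀ (z : ℂ), ∀ x ∈ P, ∀ y ∈ P, mul (z • x) y = z • mul x y
  mul_comm : ∀ x ∈ P, ∀ y ∈ P, mul x y = mul y x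
  mul_assoc : ∀ x ∈ P, ∀ y ∈ P, ∀ w ∈ P, mul (mul x y) w = mul x (mul y w)
  inv_mem : ∀ x ∈ P, inv x ∈ P
  inv_inv : ∀ x ∈ P, inv (inv x) = x
  inv_add : ∀ x ∈ P, ∀ y ∈ P, inv (x + y) = inv x + inv y
  inv_smul : ∀ (z : ℂ), ∀ x ∈ P, inv (z • x) = conj z • inv x
  inv_mul : ∀ x ∈ P, ∀ y ∈ P, inv (mul x y) = mul (inv y) (inv x)
  br_mem : ∀ x ∈ P, ∀ y ∈ P, br x y ∈ P
  br_add_left : ∀ x ∈ P, ∀ y ∈ P, ∀ w ∈ P, br (x + y) w = br x w + br y w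
  br_add_right : ∀ x ∈ P, ∀ y ∈ P, ∀ w ∈ P, br x (y + w) = br x y + br x w
  br_smul_left : ∀ (z : ℂ), ∀ x ∈ P, ∀ y ∈ P, br (z • x) y = z • br x y
  br_smul_right : ∀ (z : ℂ), ∀ x ∈ P, ∀ y ∈ P, br x (z • y) = z • br x y
  br_anticomm : ∀ x ∈ P, ∀ y ∈ P, br x y = -br y x
  br_real : ∀ x ∈ P, ∀ y ∈ P, inv (br x y) = br (inv x) (inv y)
  br_jacobi : ∀ x ∈ P, ∀ y ∈ P, ∀ w ∈ P, br x (br y w) + br y (br w x) + br w (br x y) = 0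
  br_leibniz : ∀ x ∈ P, ∀ y ∈ P, ∀ w ∈ P, br x (mul y w) = mul (br x y) w + mul y (br x w)
  dense_in_cstar : ∃ (A : Type u) (_ : NonUnitalCommCStarAlgebra A) (j : V → A),
    InjOn j P ∧ Dense (j '' P) ∧
    (∀ x ∈ P, ∀ y ∈ P, j (x + y) = j x + j y) ∧
    (∀ (z : ℂ), ∀ x ∈ P, j (z • x) = z • j x) ∧
    (∀ x ∈ P, ∀ y ∈ P, j (mul x y) = j x * j y) ∧
    (∀ x ∈ P, j (inv x) = star (j x))

section Cases

variable {E : Type u} [AddCommGroup E] [Module ℝ E] [MeasurableSpace E]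

/-- The algebras of measures with finite moments (cases (I) and (II)): for one seminorm that
dominates `ς`, or for a collection `K` of seminorms such that `ς` is dominated by a positive linear
combination of finitely many of them. -/
inductive IsMomentAlgebra (ς : Seminorm ℝ E) : Set (ComplexMeasure E) → Prop
  | single (κ : Seminorm ℝ E) (C : ℝ) (hC : 0 ≤ C) (hκ : ∀ f, ς f ≤ C * κ f) :
      IsMomentAlgebra ς (momentSpace κ ⊤)
  | collection (K : Set (Seminorm ℝ E)) (Γ : Finset (Seminorm ℝ E)) (hΓ : ∀ κ ∈ Γ, κ ∈ K)
      (a : Seminorm ℝ E → ℝ) (ha : ∀ κ ∈ Γ, 0 < a κ)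
      (hς : ∀ f, ς f ≤ ∑ κ ∈ Γ, a κ * κ f) :
      IsMomentAlgebra ς {μ | μ ∈ regularMeasures E ∧ ∀ κ ∈ K, μ ∈ momentSpace κ ⊤}

/-- The algebras (I)-(IV): moment algebras, their intersections with the discrete or with the
continuous measures, the finite linear combinations of point measures, and intersections of these
with absolutely continuous measures on a finite dimensional subspace. -/
inductive IsListedAlgebra (ς : Seminorm ℝ E) : Set (ComplexMeasure E) → Prop
  | moment (Q : Set (ComplexMeasure E)) (hQ : IsMomentAlgebra ς Q) : IsListedAlgebra ς Q
  | discrete (Q : Set (ComplexMeasure E)) (hQ : IsMomentAlgebra ς Q) :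
      IsListedAlgebra ς (Q ∩ discreteMeasures E)
  | continuous (Q : Set (ComplexMeasure E)) (hQ : IsMomentAlgebra ς Q) :
      IsListedAlgebra ς (Q ∩ continuousMeasures E)
  | absolutelyContinuous (Q : Set (ComplexMeasure E)) (hQ : IsListedAlgebra ς Q)
      (V : Submodule ℝ E) [FiniteDimensional ℝ V] : IsListedAlgebra ς (Q ∩ absContOn V)
  | finite : IsListedAlgebra ς (finiteMeasures E)

end Cases

/-- `c_n`, the largest of the binomial coefficients `n choose k`, `k = 0, …, n`. -/
def binomConst (n : ℕ) : ℕ := (Finset.range (n + 1)).sup fun k => n.choose k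

end

end WeylMeasure

open WeylMeasure

set_option linter.unusedSectionVars false

/-! The topology of `E` need not be second countable, so continuous functions on `E × E`, addition
and `σ` among them, need not be measurable for the product σ-algebra. What saves the theory is that
a complex measure lies in `M(E)` exactly when its variation is carried by an increasing sequence of
finite dimensional subspaces (`mem_regularMeasures_iff`). On the squares of these subspaces the
Borel and the product σ-algebra agree, so continuous functions are a.e. measurable for products of
such measures (`aemeasurable_prod_of_continuous`).

Every measure is handled through a presentation `IsImage ρ P H T`: the image under `T` of a complex
density `H` against a positive measure `P`. The polar decomposition presents `μ` on its own
variation with a density of modulus one. Fubini presents a product with kernel `k` as the image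
under addition of the product density times `k` (`isImage_kernelProduct`). Since a product can be a
factor again, without knowledge of its variation, associativity, Jacobi and Leibniz become pointwise
identities between densities on a triple product, after a cyclic permutation of the factors.

The bracket `{·,·}_ħ` has kernel `σ sinc(ħσ/2)`, continuous also at `ħ = 0` and bounded by `|σ|`
uniformly in `ħ`. Expanding `κ(f+g)^m` by the binomial theorem gives the moment estimate for all `ħ`
at once. Joint continuity is this bilinear estimate together with dominated convergence in `ħ`.

The C*-algebra is the closure of the Fourier transforms inside the bounded functions on the
algebraic dual. Injectivity (`ext_of_integral_exp_eq`) holds because one linear map into a countable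
product of lines is injective on the carrying subspaces, and the image measure is determined by its
finite dimensional marginals. Finally, the listed subspaces are closed under the operations: moment
conditions by the estimates, discreteness, continuity and absolute continuity because they concern
null sets only and survive convolution, and finite combinations of point measures by bilinearity. -/

/-- Every seminorm on `E` is continuous. -/
class HasContinuousSeminorms (E : Type*) [AddCommGroup E] [Module ℝ E] [TopologicalSpace E] :
    Prop where
  continuous_seminorm : ∀ p : Seminorm ℝ E, Continuous p

/-! ### The finest locally convex topology. -/

section FinestTopology

variable (E : Type*) [AddCommGroup E] [Module ℝ E]

theorem isTopologicalAddGroup_finestLocallyConvex :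
    @IsTopologicalAddGroup E (finestLocallyConvex E) _ :=
  topologicalAddGroup_sInf fun _ ht => ht.1

theorem continuousSMul_finestLocallyConvex :
    @ContinuousSMul ℝ E _ _ (finestLocallyConvex E) :=
  continuousSMul_sInf fun _ ht => ht.2.1

/-- A seminorm `p` defines a locally convex vector topology in which `p` is the norm and hence
continuous; the finest such topology refines it. -/
theorem hasContinuousSeminorms_finestLocallyConvex :
    @HasContinuousSeminorms E _ _ (finestLocallyConvex E) := by
  refine @HasContinuousSeminorms.mk E _ _ (finestLocallyConvex E) fun p => ?_
  let : SeminormedAddCommGroup E := p.toAddGroupSeminorm.toSeminormedAddCommGroup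
  let : NormedSpace ℝ E := ⟨fun a x => (map_smul_eq_mul p a x).le⟩
  have h1 : (inferInstance : TopologicalSpace E) ∈ {t | @IsTopologicalAddGroup E t _ ∧
      @ContinuousSMul ℝ E _ _ t ∧ @LocallyConvexSpace ℝ E _ _ _ _ t} :=
    ⟨inferInstance, inferInstance, inferInstance⟩
  have h2 : Continuous (fun x : E => p x) := continuous_norm (E := E)
  exact continuous_le_dom (sInf_le h1) h2

end FinestTopology

/-! ### Consequences of the continuity of all seminorms. -/

section Topological

variable {E : Type*} [AddCommGroup E] [Module ℝ E] [TopologicalSpace E] [IsTopologicalAddGroup E]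
  [HasContinuousSeminorms E]

theorem Seminorm.continuous_of_hasContinuousSeminorms (p : Seminorm ℝ E) : Continuous p :=
  HasContinuousSeminorms.continuous_seminorm p

/-- The function `|φ|` is a seminorm, which gives continuity at zero. -/
theorem LinearMap.continuous_of_hasContinuousSeminorms (φ : E →ₗ[ℝ] ℝ) : Continuous φ := by
  refine continuous_of_continuousAt_zero φ ?_
  have h := ((normSeminorm ℝ ℝ).comp φ).continuous_of_hasContinuousSeminorms.tendsto 0
  rw [map_zero] at h
  rw [ContinuousAt, map_zero]
  exact squeeze_zero_norm (fun x => le_rfl) h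

/-- The algebraic dual separates points, and all its elements are continuous. -/
theorem t2Space_of_hasContinuousSeminorms : T2Space E := by
  refine t2Space_iff_disjoint_nhds.2 fun x y hxy => ?_
  have h : ∃ φ : Module.Dual ℝ E, φ (x - y) ≠ 0 := by
    by_contra! h
    exact hxy (sub_eq_zero.1 ((Module.forall_dual_apply_eq_zero_iff ℝ (x - y)).1 h))
  obtain ⟨φ, hφ⟩ := h
  have hne : φ x ≠ φ y := fun h => hφ (by rw [map_sub, h, sub_self])
  have hc := LinearMap.continuous_of_hasContinuousSeminorms φ
  exact (Filter.disjoint_comap (disjoint_nhds_nhds.2 hne)).mono hc.continuousAt.tendsto.le_comap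
    hc.continuousAt.tendsto.le_comap

theorem continuous_bilin_of_hasContinuousSeminorms (σ : E →ₗ[ℝ] E →ₗ[ℝ] ℝ) (ς : Seminorm ℝ E)
    (c : ℝ) (h : ∀ f g, |σ f g| ≤ c * ς f * ς g) : Continuous fun p : E × E => σ p.1 p.2 := by
  have hς := ς.continuous_of_hasContinuousSeminorms
  rw [continuous_iff_continuousAt]
  rintro ⟨f₀, g₀⟩
  rw [ContinuousAt, tendsto_iff_norm_sub_tendsto_zero]
  have hlim : Filter.Tendsto (fun p : E × E => c * ς (p.1 - f₀) * ς p.2 + c * ς f₀ * ς (p.2 - g₀))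
      (𝓝 (f₀, g₀)) (𝓝 0) := by
    have hcont : Continuous
        (fun p : E × E => c * ς (p.1 - f₀) * ς p.2 + c * ς f₀ * ς (p.2 - g₀)) := by fun_prop
    have := hcont.tendsto (f₀, g₀)
    simpa using this
  refine squeeze_zero (fun _ => norm_nonneg _) (fun p => ?_) hlim
  have : σ p.1 p.2 - σ f₀ g₀ = σ (p.1 - f₀) p.2 + σ f₀ (p.2 - g₀) := by
    simp only [map_sub, LinearMap.sub_apply]; ring
  rw [this, Real.norm_eq_abs]
  exact (abs_add_le _ _).trans (add_le_add (h _ _) (h _ _))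

end Topological

namespace WeylMeasure

/-! ### Finite dimensional subspaces and concentrated measures. -/

section FiniteDimensional

variable {E : Type*} [AddCommGroup E] [Module ℝ E] [TopologicalSpace E] [IsTopologicalAddGroup E]
  [ContinuousSMul ℝ E] [T2Space E]

theorem secondCountableTopology_of_finiteDimensional (V : Submodule ℝ E) [FiniteDimensional ℝ V] :
    SecondCountableTopology V :=
  (Module.finBasis ℝ V).equivFunL.toHomeomorph.secondCountableTopology

theorem measurableSet_of_finiteDimensional [MeasurableSpace E] [BorelSpace E]
    (V : Submodule ℝ E) [FiniteDimensional ℝ V] : MeasurableSet (V : Set E) :=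
  V.closed_of_finiteDimensional.measurableSet

/-- The restriction of a continuous map to the square of a finite dimensional subspace is
measurable for the product `σ`-algebra. -/
theorem measurable_restrict_prod_of_continuous [MeasurableSpace E] [BorelSpace E]
    {Y : Type*} [TopologicalSpace Y] [MeasurableSpace Y] [BorelSpace Y]
    {F : E × E → Y} (hF : Continuous F) (V : Submodule ℝ E) [FiniteDimensional ℝ V] :
    Measurable fun p : V × V => F (p.1, p.2) := by
  have := secondCountableTopology_of_finiteDimensional V
  have hb : BorelSpace V := Subtype.borelSpace _
  have : Continuous fun p : V × V => F (p.1, p.2) := by fun_prop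
  exact this.measurable

end FiniteDimensional

/-- The measure `M` is concentrated on the union of an increasing sequence of finite dimensional
subspaces. -/
def IsConcentrated {E : Type*} [AddCommGroup E] [Module ℝ E] [MeasurableSpace E]
    (M : Measure E) : Prop :=
  ∃ V : ℕ → Submodule ℝ E, Monotone V ∧ (∀ n, FiniteDimensional ℝ (V n)) ∧
    ∀ᵐ x ∂M, ∃ n, x ∈ V n

section Concentrated

variable {E : Type*} [AddCommGroup E] [Module ℝ E] [MeasurableSpace E]

theorem IsConcentrated.mono_ac {M M' : Measure E} (h : IsConcentrated M) (hM : M' ≪ M) :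
    IsConcentrated M' := by
  obtain ⟨V, hV, hfd, hae⟩ := h
  exact ⟨V, hV, hfd, hM.ae_le hae⟩

theorem exists_common_of_isConcentrated {M M' : Measure E} (h : IsConcentrated M)
    (h' : IsConcentrated M') : ∃ V : ℕ → Submodule ℝ E, Monotone V ∧
      (∀ n, FiniteDimensional ℝ (V n)) ∧ (∀ᵐ x ∂M, ∃ n, x ∈ V n) ∧ ∀ᵐ x ∂M', ∃ n, x ∈ V n := by
  obtain ⟨V, hV, hfd, hae⟩ := h
  obtain ⟨V', hV', hfd', hae'⟩ := h'
  refine ⟨fun n => V n ⊔ V' n, fun m n hmn => sup_le_sup (hV hmn) (hV' hmn), fun n => ?_, ?_, ?_⟩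
  · have := hfd n
    have := hfd' n
    infer_instance
  · filter_upwards [hae] with x ⟨n, hn⟩ using ⟨n, Submodule.mem_sup_left hn⟩
  · filter_upwards [hae'] with x ⟨n, hn⟩ using ⟨n, Submodule.mem_sup_right hn⟩

theorem IsConcentrated.add {M M' : Measure E} (h : IsConcentrated M)
    (h' : IsConcentrated M') : IsConcentrated (M + M') := by
  obtain ⟨V, hV, hfd, hae, hae'⟩ := exists_common_of_isConcentrated h h'
  exact ⟨V, hV, hfd, ae_add_measure_iff.2 ⟨hae, hae'⟩⟩

theorem isConcentrated_iff_compl {M : Measure E} : IsConcentrated M ↔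
    ∃ V : ℕ → Submodule ℝ E, Monotone V ∧ (∀ n, FiniteDimensional ℝ (V n)) ∧
      M (⋃ n, (V n : Set E))ᶜ = 0 := by
  have : ∀ V : ℕ → Submodule ℝ E, {x | ¬ ∃ n, x ∈ V n} = (⋃ n, (V n : Set E))ᶜ := by
    intro V; ext x; simp
  simp only [IsConcentrated, ae_iff, this]

variable [TopologicalSpace E] [IsTopologicalAddGroup E] [ContinuousSMul ℝ E] [T2Space E]
  [BorelSpace E]

/-- Continuity alone does not give measurability for the product σ-algebra. It does on each `V n × V
n`, which is second countable, and countably many of these squares carry the product measure. -/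
theorem aemeasurable_prod_of_continuous {Y : Type*} [TopologicalSpace Y] [MeasurableSpace Y]
    [BorelSpace Y] {F : E × E → Y} (hF : Continuous F) {M M' : Measure E} [SFinite M] [SFinite M']
    (h : IsConcentrated M) (h' : IsConcentrated M') : AEMeasurable F (M.prod M') := by
  obtain ⟨V, hV, hfd, hae, hae'⟩ := exists_common_of_isConcentrated h h'
  have hmeas : ∀ n, MeasurableSet ((V n : Set E) ×ˢ (V n : Set E)) := fun n =>
    (measurableSet_of_finiteDimensional (V n)).prod (measurableSet_of_finiteDimensional (V n))
  have hrestr : (M.prod M').restrict (⋃ n, (V n : Set E) ×ˢ (V n : Set E)) = M.prod M' := by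
    refine Measure.restrict_eq_self_of_ae_mem ?_
    have h1 : ∀ᵐ p ∂M.prod M', ∃ n, p.1 ∈ V n := Measure.quasiMeasurePreserving_fst.ae hae
    have h2 : ∀ᵐ p ∂M.prod M', ∃ n, p.2 ∈ V n := Measure.quasiMeasurePreserving_snd.ae hae'
    filter_upwards [h1, h2] with p ⟨m, hm⟩ ⟨n, hn⟩
    -- Monotonicity of `V` is needed here: both coordinates must lie in one and the same subspace.
    exact mem_iUnion.2 ⟨max m n, hV (le_max_left m n) hm, hV (le_max_right m n) hn⟩
  rw [← hrestr, aemeasurable_iUnion_iff]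
  intro n
  refine aemeasurable_restrict_of_measurable_subtype (hmeas n) ?_
  have hm := measurable_restrict_prod_of_continuous hF (V n)
  have hcomp : Measurable fun x : ((V n : Set E) ×ˢ (V n : Set E) : Set (E × E)) =>
      ((⟨x.1.1, x.2.1⟩, ⟨x.1.2, x.2.2⟩) : V n × V n) :=
    (Measurable.subtype_mk (measurable_fst.comp measurable_subtype_coe)).prodMk
      (Measurable.subtype_mk (measurable_snd.comp measurable_subtype_coe))
  exact hm.comp hcomp

theorem map_add_prod_isConcentrated {M M' : Measure E} [SFinite M] [SFinite M']
    (h : IsConcentrated M) (h' : IsConcentrated M') :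
    IsConcentrated ((M.prod M').map fun p => p.1 + p.2) := by
  have hadd := aemeasurable_prod_of_continuous (continuous_add (M := E)) h h'
  obtain ⟨V, hV, hfd, hae, hae'⟩ := exists_common_of_isConcentrated h h'
  refine ⟨V, hV, hfd, ?_⟩
  have hms : MeasurableSet {x | ∃ n, x ∈ V n} := by
    have : {x | ∃ n, x ∈ V n} = ⋃ n, (V n : Set E) := by ext; simp
    rw [this]
    exact MeasurableSet.iUnion fun n => measurableSet_of_finiteDimensional (V n)
  rw [ae_map_iff hadd hms]
  have h1 : ∀ᵐ p ∂M.prod M', ∃ n, p.1 ∈ V n := Measure.quasiMeasurePreserving_fst.ae hae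
  have h2 : ∀ᵐ p ∂M.prod M', ∃ n, p.2 ∈ V n := Measure.quasiMeasurePreserving_snd.ae hae'
  filter_upwards [h1, h2] with p ⟨m, hm⟩ ⟨n, hn⟩
  exact ⟨max m n, add_mem (hV (le_max_left m n) hm) (hV (le_max_right m n) hn)⟩

end Concentrated

end WeylMeasure

namespace WeylMeasure

/-! ### Complex measures as images of complex densities. -/

section Density

variable {X : Type*} [MeasurableSpace X]

instance isFiniteMeasure_variation (μ : ComplexMeasure X) : IsFiniteMeasure μ.variation := by
  have h : μ.variation ≤ (ComplexMeasure.re μ).totalVariation +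
      (ComplexMeasure.im μ).totalVariation := by
    refine VectorMeasure.variation_le_of_forall_enorm_le fun s _ => ?_
    have h1 : ‖μ s‖ₑ ≤ ‖(μ s).re‖ₑ + ‖(μ s).im‖ₑ := by
      have h2 := Complex.norm_le_abs_re_add_abs_im (μ s)
      rw [← ofReal_norm, ← ofReal_norm, ← ofReal_norm,
        ← ENNReal.ofReal_add (norm_nonneg _) (norm_nonneg _)]
      exact ENNReal.ofReal_le_ofReal h2
    exact h1.trans (add_le_add ((ComplexMeasure.re μ).enorm_le_totalVariation s)
      ((ComplexMeasure.im μ).enorm_le_totalVariation s))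
  exact isFiniteMeasure_of_le _ h

/-- The real and the imaginary part are absolutely continuous for the variation, so the
Radon–Nikodym theorem for signed measures applies to each. -/
theorem withDensity_rnDeriv_variation (μ : ComplexMeasure X) :
    μ.variation.withDensityᵥ (μ.rnDeriv μ.variation) = μ := by
  have hre : ComplexMeasure.re μ ≪ᵥ μ.variation.toENNRealVectorMeasure := by
    refine VectorMeasure.AbsolutelyContinuous.mk fun s hs h => ?_
    rw [Measure.toENNRealVectorMeasure_apply_measurable hs] at h
    have : μ s = 0 := by
      simpa [h] using μ.enorm_measure_le_variation s
    change (μ s).re = 0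
    rw [this, Complex.zero_re]
  have him : ComplexMeasure.im μ ≪ᵥ μ.variation.toENNRealVectorMeasure := by
    refine VectorMeasure.AbsolutelyContinuous.mk fun s hs h => ?_
    rw [Measure.toENNRealVectorMeasure_apply_measurable hs] at h
    have : μ s = 0 := by
      simpa [h] using μ.enorm_measure_le_variation s
    change (μ s).im = 0
    rw [this, Complex.zero_im]
  have h1 := SignedMeasure.withDensityᵥ_rnDeriv_eq _ μ.variation hre
  have h2 := SignedMeasure.withDensityᵥ_rnDeriv_eq _ μ.variation him
  ext s hs : 1
  have hint := μ.integrable_rnDeriv μ.variation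
  rw [withDensityᵥ_apply hint hs]
  apply Complex.ext
  · rw [← RCLike.re_eq_complex_re, ← integral_re hint.integrableOn, RCLike.re_eq_complex_re]
    change ∫ x in s, (ComplexMeasure.re μ).rnDeriv μ.variation x ∂μ.variation = ComplexMeasure.re μ s
    rw [← withDensityᵥ_apply (SignedMeasure.integrable_rnDeriv _ _) hs, h1]
  · rw [← RCLike.im_eq_complex_im, ← integral_im hint.integrableOn, RCLike.im_eq_complex_im]
    change ∫ x in s, (ComplexMeasure.im μ).rnDeriv μ.variation x ∂μ.variation = ComplexMeasure.im μ s
    rw [← withDensityᵥ_apply (SignedMeasure.integrable_rnDeriv _ _) hs, h2]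

/-- The variation of `h dP` is `|h| dP`. For `P = |μ|` and `h` the density of `μ` this reads `|h|
d|μ| = d|μ|`, so `|h| = 1` almost everywhere. -/
theorem enorm_rnDeriv_variation (μ : ComplexMeasure X) :
    (fun x => ‖μ.rnDeriv μ.variation x‖ₑ) =ᵐ[μ.variation] 1 := by
  have hint := μ.integrable_rnDeriv μ.variation
  have h := Measure.variation_withDensityᵥ hint
  rw [withDensity_rnDeriv_variation] at h
  have h' : μ.variation.withDensity (fun x => ‖μ.rnDeriv μ.variation x‖ₑ) =
      μ.variation.withDensity 1 := by
    rw [withDensity_one, ← h]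
  exact (withDensity_eq_iff_of_sigmaFinite hint.aestronglyMeasurable.enorm
    measurable_one.aemeasurable).1 h'

variable {Ω : Type*} [MeasurableSpace Ω]

theorem absolutelyContinuous_map_of_aemeasurable {P P' : Measure Ω} (h : P' ≪ P) {T : Ω → X}
    (hT : AEMeasurable T P) : P'.map T ≪ P.map T := by
  rw [Measure.map_congr hT.ae_eq_mk, Measure.map_congr (h.ae_eq hT.ae_eq_mk)]
  exact h.map hT.measurable_mk

theorem integrable_mul_indicator_one {P : Measure Ω} {H : Ω → ℂ}
    (hH : Integrable H P) {T : Ω → X} (hT : AEMeasurable T P) {Λ : Set X} (hΛ : MeasurableSet Λ) :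
    Integrable (fun ω => H ω * Λ.indicator (fun _ => (1 : ℂ)) (T ω)) P := by
  have hm : Measurable (Λ.indicator fun _ => (1 : ℂ)) := measurable_const.indicator hΛ
  refine hH.mono (hH.aestronglyMeasurable.mul
    (hm.comp_aemeasurable hT).aestronglyMeasurable) (Filter.Eventually.of_forall fun ω => ?_)
  by_cases h : T ω ∈ Λ <;> simp [h]

/-- `ρ` is the image under `T` of the measure with density `H` with respect to `P`. -/
structure IsImage (ρ : ComplexMeasure X) (P : Measure Ω) (H : Ω → ℂ) (T : Ω → X) : Prop where
  integrable : Integrable H P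
  aemeasurable : AEMeasurable T P
  apply_eq : ∀ Λ, MeasurableSet Λ → ρ Λ = ∫ ω, H ω * Λ.indicator (fun _ => (1 : ℂ)) (T ω) ∂P

theorem isImage_variation (μ : ComplexMeasure X) :
    IsImage μ μ.variation (μ.rnDeriv μ.variation) id := by
  have hint := μ.integrable_rnDeriv μ.variation
  refine ⟨hint, aemeasurable_id, fun Λ hΛ => ?_⟩
  conv_lhs => rw [← withDensity_rnDeriv_variation μ]
  rw [withDensityᵥ_apply hint hΛ, ← integral_indicator hΛ]
  congr with x
  by_cases hx : x ∈ Λ <;> simp [hx]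

theorem IsImage.ext {ρ ρ' : ComplexMeasure X} {P : Measure Ω} {H : Ω → ℂ} {T : Ω → X}
    (h : IsImage ρ P H T) (h' : IsImage ρ' P H T) : ρ = ρ' := by
  ext Λ hΛ : 1
  rw [h.apply_eq Λ hΛ, h'.apply_eq Λ hΛ]

/-- Since `T` is only a.e. measurable (addition on `E × E` is the case of interest), the
push-forward is taken along a measurable version. -/
theorem exists_isImage {P : Measure Ω} {H : Ω → ℂ} {T : Ω → X} (hH : Integrable H P)
    (hT : AEMeasurable T P) : ∃ ρ : ComplexMeasure X, IsImage ρ P H T := by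
  refine ⟨(P.withDensityᵥ H).map (hT.mk T), hH, hT, fun Λ hΛ => ?_⟩
  rw [VectorMeasure.map_apply _ hT.measurable_mk hΛ,
    withDensityᵥ_apply hH (hT.measurable_mk hΛ), ← integral_indicator (hT.measurable_mk hΛ)]
  refine integral_congr_ae ?_
  filter_upwards [hT.ae_eq_mk] with ω hω
  rw [hω]
  by_cases hx : hT.mk T ω ∈ Λ
  · simp [hx]
  · simp [hx]

/-- The positive measure that dominates the image of a complex density. -/
theorem IsImage.variation_le {ρ : ComplexMeasure X} {P : Measure Ω} {H : Ω → ℂ} {T : Ω → X}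
    (h : IsImage ρ P H T) : ρ.variation ≤ (P.withDensity fun ω => ‖H ω‖ₑ).map T := by
  refine VectorMeasure.variation_le_of_forall_enorm_le fun Λ hΛ => ?_
  have hT : AEMeasurable T (P.withDensity fun ω => ‖H ω‖ₑ) :=
    h.aemeasurable.mono_ac (withDensity_absolutelyContinuous _ _)
  have h2 : ((P.withDensity fun ω => ‖H ω‖ₑ).map T) Λ =
      ∫⁻ ω, ‖H ω‖ₑ * Λ.indicator 1 (T ω) ∂P := by
    rw [← lintegral_indicator_one hΛ,
      lintegral_map' (measurable_one.indicator hΛ).aemeasurable hT]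
    have h3 : AEMeasurable (fun ω => Λ.indicator (1 : X → ℝ≥0∞) (T ω)) P :=
      (measurable_one.indicator hΛ).comp_aemeasurable h.aemeasurable
    rw [lintegral_withDensity_eq_lintegral_mul₀ h.integrable.aestronglyMeasurable.enorm h3]
    rfl
  rw [h.apply_eq Λ hΛ, h2]
  refine (enorm_integral_le_lintegral_enorm _).trans (lintegral_mono fun ω => ?_)
  by_cases hx : T ω ∈ Λ <;> simp [hx]

theorem IsImage.lintegral_le {ρ : ComplexMeasure X} {P : Measure Ω} {H : Ω → ℂ} {T : Ω → X}
    (h : IsImage ρ P H T) {G : X → ℝ≥0∞} (hG : AEMeasurable G (P.map T)) :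
    ∫⁻ x, G x ∂ρ.variation ≤ ∫⁻ ω, ‖H ω‖ₑ * G (T ω) ∂P := by
  have hac : P.withDensity (fun ω => ‖H ω‖ₑ) ≪ P := withDensity_absolutelyContinuous _ _
  have hT : AEMeasurable T (P.withDensity fun ω => ‖H ω‖ₑ) := h.aemeasurable.mono_ac hac
  have hG' : AEMeasurable G ((P.withDensity fun ω => ‖H ω‖ₑ).map T) :=
    hG.mono_ac (absolutelyContinuous_map_of_aemeasurable hac h.aemeasurable)
  refine (lintegral_mono' h.variation_le le_rfl).trans ?_
  rw [lintegral_map' hG' hT]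
  exact (lintegral_withDensity_eq_lintegral_mul₀
    h.integrable.aestronglyMeasurable.enorm (hG.comp_aemeasurable h.aemeasurable)).le

theorem IsImage.variation_ac {ρ : ComplexMeasure X} {P : Measure Ω} {H : Ω → ℂ} {T : Ω → X}
    (h : IsImage ρ P H T) : ρ.variation ≪ P.map T :=
  h.variation_le.absolutelyContinuous.trans
    (absolutelyContinuous_map_of_aemeasurable (withDensity_absolutelyContinuous _ _) h.aemeasurable)

theorem lintegral_map_withDensity_enorm {P : Measure Ω} {H : Ω → ℂ} {T : Ω → X}
    (hH : AEStronglyMeasurable H P) (hT : AEMeasurable T P) {G : X → ℝ≥0∞}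
    (hG : AEMeasurable G ((P.withDensity fun ω => ‖H ω‖ₑ).map T)) :
    ∫⁻ x, G x ∂((P.withDensity fun ω => ‖H ω‖ₑ).map T) = ∫⁻ ω, ‖H ω‖ₑ * G (T ω) ∂P := by
  have hac : P.withDensity (fun ω => ‖H ω‖ₑ) ≪ P := withDensity_absolutelyContinuous _ _
  have hT' := hT.mono_ac hac
  rw [lintegral_map' hG hT']
  exact lintegral_withDensity_eq_lintegral_mul₀' hH.enorm (hG.comp_aemeasurable hT')

theorem integrable_mul_comp_of_integrable_map {P : Measure Ω} {H : Ω → ℂ} {T : Ω → X}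
    (hH : AEStronglyMeasurable H P) (hT : AEMeasurable T P) {F : X → ℂ}
    (hF : Integrable F ((P.withDensity fun ω => ‖H ω‖ₑ).map T)) :
    Integrable (fun ω => H ω * F (T ω)) P := by
  have hac : P.withDensity (fun ω => ‖H ω‖ₑ) ≪ P := withDensity_absolutelyContinuous _ _
  have hT' := hT.mono_ac hac
  refine ⟨?_, ?_⟩
  · have h1 : AEStronglyMeasurable (F ∘ T) (P.withDensity fun ω => ‖H ω‖ₑ) :=
      hF.aestronglyMeasurable.comp_aemeasurable hT'
    obtain ⟨F', hF', hFF'⟩ := h1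
    rw [Filter.EventuallyEq, ae_withDensity_iff' hH.enorm] at hFF'
    refine (hH.mul hF'.aestronglyMeasurable).congr ?_
    filter_upwards [hFF'] with ω hω
    -- The measure with density `|H|` gives no information where `H` vanishes, but there both
    -- products are zero.
    by_cases h0 : H ω = 0
    · simp [h0]
    · simp only [Pi.mul_apply, ← hω (by simpa using h0), Function.comp]
  · rw [HasFiniteIntegral]
    have := lintegral_map_withDensity_enorm hH hT hF.aestronglyMeasurable.enorm
    simp only [enorm_mul]
    rw [← this]
    exact hF.2

/-- For indicators this is the definition of `IsImage`, and both sides are 1-Lipschitz in `F` for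
the `L¹` distance of the image of `|H| P`. Integrability is required for that measure and not only
for the variation of `ρ`: cancellations can make the latter smaller, and the right-hand side might
then diverge. -/
theorem IsImage.integral_eq_of_integrable_map {ρ : ComplexMeasure X} {P : Measure Ω} {H : Ω → ℂ}
    {T : Ω → X} (h : IsImage ρ P H T) {F : X → ℂ}
    (hF : Integrable F ((P.withDensity fun ω => ‖H ω‖ₑ).map T)) :
    ρ.integral F (ContinuousLinearMap.mul ℝ ℂ) = ∫ ω, H ω * F (T ω) ∂P := by
  have hH := h.integrable.aestronglyMeasurable
  have hfin : IsFiniteMeasure (P.withDensity fun ω => ‖H ω‖ₑ) :=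
    isFiniteMeasure_withDensity h.integrable.2.ne
  refine Integrable.induction (fun F : X → ℂ => ρ.integral F (ContinuousLinearMap.mul ℝ ℂ) =
    ∫ ω, H ω * F (T ω) ∂P) ?_ ?_ ?_ ?_ hF
  · intro z s hs _
    rw [VectorMeasure.integral_indicator_const _ hs, h.apply_eq s hs]
    rw [ContinuousLinearMap.mul_apply', ← integral_const_mul]
    congr with ω
    by_cases hx : T ω ∈ s <;> simp [hx, mul_comm]
  · intro f g _ hf hg ihf ihg
    have h1 := hf.mono_measure h.variation_le
    have h2 := hg.mono_measure h.variation_le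
    rw [VectorMeasure.integral_add h1 h2, ihf, ihg, ← integral_add
      (integrable_mul_comp_of_integrable_map hH h.aemeasurable hf)
      (integrable_mul_comp_of_integrable_map hH h.aemeasurable hg)]
    simp only [Pi.add_apply, mul_add]
  · refine isClosed_eq (LipschitzWith.continuous (K := 1) fun f g => ?_)
      (LipschitzWith.continuous (K := 1) fun f g => ?_)
    · have hf := L1.integrable_coeFn f
      have hg := L1.integrable_coeFn g
      refine (VectorMeasure.edist_integral_le_lintegral_edist (hf.mono_measure h.variation_le)
        (hg.mono_measure h.variation_le)).trans ?_
      rw [L1.edist_def]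
      refine mul_le_mul' ?_ (lintegral_mono' h.variation_le le_rfl)
      rw [← ofReal_norm, ENNReal.coe_one]
      exact ENNReal.ofReal_le_one.2 (ContinuousLinearMap.opNorm_mul_le ℝ ℂ)
    · have hf := L1.integrable_coeFn f
      have hg := L1.integrable_coeFn g
      rw [edist_eq_enorm_sub, ← integral_sub
        (integrable_mul_comp_of_integrable_map hH h.aemeasurable hf)
        (integrable_mul_comp_of_integrable_map hH h.aemeasurable hg), L1.edist_def]
      refine (enorm_integral_le_lintegral_enorm _).trans ?_
      simp only [edist_eq_enorm_sub, ENNReal.coe_one, one_mul]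
      have hfg := lintegral_map_withDensity_enorm hH h.aemeasurable
        (hf.aestronglyMeasurable.sub hg.aestronglyMeasurable).enorm
      simp only [Pi.sub_apply] at hfg
      simp only [hfg, ← enorm_mul, mul_sub, le_refl]
  · intro f g hfg hf ihf
    rw [← VectorMeasure.integral_congr_ae (h.variation_le.absolutelyContinuous.ae_le hfg), ihf]
    have hT' := h.aemeasurable.mono_ac (withDensity_absolutelyContinuous P fun ω => ‖H ω‖ₑ)
    have := ae_of_ae_map hT' hfg
    rw [ae_withDensity_iff' hH.enorm] at this
    refine integral_congr_ae ?_
    filter_upwards [this] with ω hω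
    by_cases h0 : H ω = 0
    · simp [h0]
    · rw [hω (by simpa using h0)]

theorem integrable_map_withDensity_enorm {P : Measure Ω} {H : Ω → ℂ} {T : Ω → X}
    (hH : AEStronglyMeasurable H P) (hT : AEMeasurable T P) {F : X → ℂ}
    (hF : AEStronglyMeasurable F (P.map T)) (hFi : Integrable (fun ω => H ω * F (T ω)) P) :
    Integrable F ((P.withDensity fun ω => ‖H ω‖ₑ).map T) := by
  have hF' := hF.mono_ac (absolutelyContinuous_map_of_aemeasurable
    (withDensity_absolutelyContinuous P fun ω => ‖H ω‖ₑ) hT)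
  refine ⟨hF', ?_⟩
  rw [HasFiniteIntegral, lintegral_map_withDensity_enorm hH hT hF'.enorm]
  simpa only [HasFiniteIntegral, enorm_mul] using hFi.2

theorem IsImage.integrable_comp {ρ : ComplexMeasure X} {P : Measure Ω} {H : Ω → ℂ} {T : Ω → X}
    (h : IsImage ρ P H T) {F : X → ℂ} (hF : AEStronglyMeasurable F (P.map T))
    (hFi : Integrable (fun ω => H ω * F (T ω)) P) : ρ.Integrable F :=
  (integrable_map_withDensity_enorm h.integrable.aestronglyMeasurable h.aemeasurable hF
    hFi).mono_measure h.variation_le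

theorem IsImage.integral_eq {ρ : ComplexMeasure X} {P : Measure Ω} {H : Ω → ℂ} {T : Ω → X}
    (h : IsImage ρ P H T) {F : X → ℂ} (hF : AEStronglyMeasurable F (P.map T))
    (hFi : Integrable (fun ω => H ω * F (T ω)) P) :
    ρ.integral F (ContinuousLinearMap.mul ℝ ℂ) = ∫ ω, H ω * F (T ω) ∂P :=
  h.integral_eq_of_integrable_map (integrable_map_withDensity_enorm
    h.integrable.aestronglyMeasurable h.aemeasurable hF hFi)

end Density

end WeylMeasure

namespace WeylMeasure

/-! ### Total variation closures and null sets. -/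

section Closure

variable {E : Type*} [MeasurableSpace E]

theorem tvNorm_sub_restrict [AddCommGroup E] [Module ℝ E] (μ : ComplexMeasure E) {s : Set E}
    (hs : MeasurableSet s) : tvNorm (μ - μ.restrict s) = μ.variation sᶜ := by
  have h : μ - μ.restrict s = μ.restrict sᶜ := by
    rw [sub_eq_iff_eq_add, add_comm]
    exact (VectorMeasure.restrict_add_restrict_compl hs).symm
  rw [tvNorm, h, VectorMeasure.variation_restrict hs.compl, Measure.restrict_apply_univ]

variable [AddCommGroup E] [Module ℝ E]

theorem tvClosure_mono {S S' : Set (ComplexMeasure E)} (h : S ⊆ S') :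
    tvClosure S ⊆ tvClosure S' := fun μ hμ ε hε => by
  obtain ⟨ν, hν, hlt⟩ := hμ ε hε
  exact ⟨ν, h hν, hlt⟩

/-- The restrictions to `s n` approximate `μ` with error `|μ|((s n)ᶜ)`, which tends to zero because
the variation is finite. -/
theorem mem_tvClosure_of_restrict {S : Set (ComplexMeasure E)} {μ : ComplexMeasure E}
    {s : ℕ → Set E} (hs : ∀ n, MeasurableSet (s n)) (hmono : Monotone s)
    (hS : ∀ n, μ.restrict (s n) ∈ S) (h : μ.variation (⋃ n, s n)ᶜ = 0) : μ ∈ tvClosure S := by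
  intro ε hε
  have hlim : Filter.Tendsto (fun n => μ.variation (s n)ᶜ) Filter.atTop (𝓝 0) := by
    rw [← h, compl_iUnion]
    exact tendsto_measure_iInter_atTop (fun n => (hs n).compl.nullMeasurableSet)
      (fun m n hmn => compl_subset_compl.2 (hmono hmn)) ⟨0, measure_ne_top _ _⟩
  obtain ⟨n, hn⟩ := (hlim.eventually (gt_mem_nhds hε)).exists
  exact ⟨μ.restrict (s n), hS n, by rwa [tvNorm_sub_restrict μ (hs n)]⟩

/-- A null set common to all members of a sequence converging in variation is null for the limit.
This turns membership in a closure into a countable condition on null sets. -/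
theorem exists_seq_of_mem_tvClosure {S : Set (ComplexMeasure E)} {μ : ComplexMeasure E}
    (h : μ ∈ tvClosure S) : ∃ ν : ℕ → ComplexMeasure E, (∀ n, ν n ∈ S) ∧
      ∀ N : Set E, (∀ n, (ν n).variation N = 0) → μ.variation N = 0 := by
  have hpos : ∀ n : ℕ, (0 : ℝ≥0∞) < ((n : ℝ≥0∞) + 1)⁻¹ := fun n => by
    simp
  choose ν hν hlt using fun n : ℕ => h _ (hpos n)
  refine ⟨ν, hν, fun N hN => ?_⟩
  refine le_antisymm (ENNReal.le_of_forall_pos_le_add fun ε hε _ => ?_) bot_le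
  obtain ⟨n, hn⟩ := ENNReal.exists_inv_nat_lt (ENNReal.coe_ne_zero.2 hε.ne')
  rw [zero_add]
  have h1 : μ.variation N ≤ (μ - ν n).variation N + (ν n).variation N := by
    have := VectorMeasure.variation_add_le (μ := μ - ν n) (ν := ν n)
    rw [sub_add_cancel] at this
    exact this N
  rw [hN n, add_zero] at h1
  refine h1.trans ((measure_mono (subset_univ N)).trans ((hlt n).le.trans (le_trans ?_ hn.le)))
  exact ENNReal.inv_le_inv.2 le_self_add

variable [TopologicalSpace E] [IsTopologicalAddGroup E] [ContinuousSMul ℝ E] [T2Space E]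
  [BorelSpace E]

/-- Countably many approximants involve countably many subspaces, whose partial suprema form an
increasing sequence carrying `μ`. Conversely, the restrictions to the `V n` approximate `μ`. -/
theorem mem_regularMeasures_iff {μ : ComplexMeasure E} :
    μ ∈ regularMeasures E ↔ IsConcentrated μ.variation := by
  constructor
  · intro h
    obtain ⟨ν, hν, hN⟩ := exists_seq_of_mem_tvClosure h
    choose V hfd hV using hν
    rw [isConcentrated_iff_compl]
    have hfd' : ∀ n, FiniteDimensional ℝ (partialSups V n) := by
      intro n
      induction n with
      | zero => rw [partialSups_zero]; exact hfd 0
      | succ n ih =>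
        have := hfd (n + 1)
        rw [partialSups_add_one]
        infer_instance
    refine ⟨partialSups V, (partialSups V).monotone, hfd', hN _ fun n => ?_⟩
    refine measure_mono_null (compl_subset_compl.2 ?_) (hV n)
    exact Subset.trans (SetLike.coe_subset_coe.2 (le_partialSups V n))
      (subset_iUnion (fun n => (partialSups V n : Set E)) n)
  · intro h
    obtain ⟨V, hV, hfd, hae⟩ := isConcentrated_iff_compl.1 h
    refine mem_tvClosure_of_restrict (fun n => measurableSet_of_finiteDimensional (V n))
      (fun m n hmn => hV hmn) (fun n => ⟨V n, hfd n, ?_⟩) hae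
    have hm := measurableSet_of_finiteDimensional (V n)
    rw [concentratedOn, mem_ofPred_eq, VectorMeasure.variation_restrict hm,
      Measure.restrict_apply hm.compl, compl_inter_self, measure_empty]

/-- A countable carrier is an increasing union of finite sets, and a finite set spans a finite
dimensional subspace; so no subspace has to appear in the criterion. -/
theorem mem_discreteMeasures_iff {μ : ComplexMeasure E} :
    μ ∈ discreteMeasures E ↔ ∃ S : Set E, S.Countable ∧ μ.variation Sᶜ = 0 := by
  constructor
  · intro h
    obtain ⟨ν, hν, hN⟩ := exists_seq_of_mem_tvClosure h
    choose V hfd hV S hS hS0 using hν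
    refine ⟨⋃ n, S n, countable_iUnion hS, hN _ fun n => ?_⟩
    exact measure_mono_null (compl_subset_compl.2 (subset_iUnion S n)) (hS0 n)
  · rintro ⟨S, hS, h0⟩
    -- The point `0` is added only to make the set nonempty, so that it is the range of a sequence.
    obtain ⟨f, hf⟩ := (hS.insert 0).exists_eq_range (insert_nonempty 0 S)
    let s : ℕ → Set E := fun n => f '' Iic n
    have hfin : ∀ n, (s n).Finite := fun n => (finite_Iic n).image f
    refine mem_tvClosure_of_restrict (s := s) (fun n => (hfin n).measurableSet)
      (fun m n hmn => image_mono (Iic_subset_Iic.2 hmn)) (fun n => ?_) ?_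
    · refine ⟨Submodule.span ℝ (s n), FiniteDimensional.span_of_finite ℝ (hfin n), ?_, s n,
        (hfin n).countable, ?_⟩
      · rw [concentratedOn, mem_ofPred_eq, VectorMeasure.variation_restrict (hfin n).measurableSet]
        refine measure_mono_null (compl_subset_compl.2 (Submodule.subset_span)) ?_
        rw [Measure.restrict_apply (hfin n).measurableSet.compl, compl_inter_self, measure_empty]
      · rw [VectorMeasure.variation_restrict (hfin n).measurableSet,
          Measure.restrict_apply (hfin n).measurableSet.compl, compl_inter_self, measure_empty]
    · refine measure_mono_null (compl_subset_compl.2 fun x hx => ?_) h0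
      have : x ∈ range f := hf ▸ mem_insert_of_mem 0 hx
      obtain ⟨n, rfl⟩ := this
      exact mem_iUnion.2 ⟨n, n, mem_Iic.2 le_rfl, rfl⟩

theorem variation_singleton_eq_zero_iff {μ : ComplexMeasure E} {f : E} :
    μ.variation {f} = 0 ↔ μ {f} = 0 := by
  rw [VectorMeasure.variation_apply_eq_zero (measurableSet_singleton f)]
  refine ⟨fun h => h _ subset_rfl (measurableSet_singleton f), fun h t ht _ => ?_⟩
  rcases subset_singleton_iff_eq.1 ht with rfl | rfl
  · exact μ.empty
  · exact h

theorem mem_continuousMeasures_iff {μ : ComplexMeasure E} :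
    μ ∈ continuousMeasures E ↔ IsConcentrated μ.variation ∧ ∀ f, μ.variation {f} = 0 := by
  constructor
  · intro h
    refine ⟨mem_regularMeasures_iff.1 (tvClosure_mono ?_ h), fun f => ?_⟩
    · rintro ν ⟨V, hfd, hV⟩
      exact ⟨V, hfd, hV.1⟩
    · obtain ⟨ν, hν, hN⟩ := exists_seq_of_mem_tvClosure h
      choose V hfd hV hat using hν
      exact hN _ fun n => variation_singleton_eq_zero_iff.2 (hat n f)
  · rintro ⟨h, hat⟩
    obtain ⟨V, hV, hfd, hae⟩ := isConcentrated_iff_compl.1 h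
    refine mem_tvClosure_of_restrict (fun n => measurableSet_of_finiteDimensional (V n))
      (fun m n hmn => hV hmn) (fun n => ⟨V n, hfd n, ?_, fun f => ?_⟩) hae
    all_goals have hm := measurableSet_of_finiteDimensional (V n)
    · rw [concentratedOn, mem_ofPred_eq, VectorMeasure.variation_restrict hm,
        Measure.restrict_apply hm.compl, compl_inter_self, measure_empty]
    · rw [← variation_singleton_eq_zero_iff, VectorMeasure.variation_restrict hm]
      exact le_antisymm ((Measure.restrict_apply_le _ _).trans (hat f).le) bot_le

end Closure

end WeylMeasure

namespace WeylMeasure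

theorem map_prodMk_comp_of_aemeasurable {X Y Ω₁ Ω₂ : Type*} [MeasurableSpace X] [MeasurableSpace Y]
    [MeasurableSpace Ω₁] [MeasurableSpace Ω₂] {P₁ : Measure Ω₁} {P₂ : Measure Ω₂} [SFinite P₁]
    [SFinite P₂] {T₁ : Ω₁ → X} {T₂ : Ω₂ → Y} (h₁ : AEMeasurable T₁ P₁) (h₂ : AEMeasurable T₂ P₂) :
    AEMeasurable (fun p : Ω₁ × Ω₂ => (T₁ p.1, T₂ p.2)) (P₁.prod P₂) ∧
      (P₁.prod P₂).map (fun p : Ω₁ × Ω₂ => (T₁ p.1, T₂ p.2)) = (P₁.map T₁).prod (P₂.map T₂) := by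
  have e₁ : ∀ᵐ p ∂P₁.prod P₂, T₁ p.1 = h₁.mk T₁ p.1 :=
    Measure.quasiMeasurePreserving_fst.ae h₁.ae_eq_mk
  have e₂ : ∀ᵐ p ∂P₁.prod P₂, T₂ p.2 = h₂.mk T₂ p.2 :=
    Measure.quasiMeasurePreserving_snd.ae h₂.ae_eq_mk
  have e : (fun p : Ω₁ × Ω₂ => (T₁ p.1, T₂ p.2)) =ᵐ[P₁.prod P₂]
      Prod.map (h₁.mk T₁) (h₂.mk T₂) := by
    filter_upwards [e₁, e₂] with p hp₁ hp₂
    rw [hp₁, hp₂, Prod.map]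
  refine ⟨⟨_, h₁.measurable_mk.prodMap h₂.measurable_mk, e⟩, ?_⟩
  rw [Measure.map_congr e, Measure.map_congr h₁.ae_eq_mk, Measure.map_congr h₂.ae_eq_mk,
    Measure.map_prod_map _ _ h₁.measurable_mk h₂.measurable_mk]

/-! ### Kernel products as images of product densities. -/

section KernelProduct

variable {E : Type*} [AddCommGroup E] [Module ℝ E] [TopologicalSpace E] [IsTopologicalAddGroup E]
  [ContinuousSMul ℝ E] [T2Space E] [MeasurableSpace E] [BorelSpace E]
  {Ω₁ Ω₂ : Type*} [MeasurableSpace Ω₁] [MeasurableSpace Ω₂]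

theorem aemeasurable_comp_prod_of_continuous {Y : Type*} [TopologicalSpace Y] [MeasurableSpace Y]
    [BorelSpace Y] {F : E × E → Y} (hF : Continuous F)
    {P₁ : Measure Ω₁} {P₂ : Measure Ω₂} [SFinite P₁] [SFinite P₂] {T₁ : Ω₁ → E} {T₂ : Ω₂ → E}
    (h₁ : AEMeasurable T₁ P₁) (h₂ : AEMeasurable T₂ P₂)
    (hc₁ : IsConcentrated (P₁.map T₁)) (hc₂ : IsConcentrated (P₂.map T₂)) :
    AEMeasurable (fun p : Ω₁ × Ω₂ => F (T₁ p.1, T₂ p.2)) (P₁.prod P₂) := by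
  obtain ⟨hm, hmap⟩ := map_prodMk_comp_of_aemeasurable h₁ h₂
  have h := aemeasurable_prod_of_continuous hF hc₁ hc₂
  rw [← hmap] at h
  exact h.comp_aemeasurable hm

theorem isConcentrated_map_add {P₁ : Measure Ω₁} {P₂ : Measure Ω₂} [SFinite P₁] [SFinite P₂]
    {T₁ : Ω₁ → E} {T₂ : Ω₂ → E} (h₁ : AEMeasurable T₁ P₁) (h₂ : AEMeasurable T₂ P₂)
    (hc₁ : IsConcentrated (P₁.map T₁)) (hc₂ : IsConcentrated (P₂.map T₂)) :
    IsConcentrated ((P₁.prod P₂).map fun p : Ω₁ × Ω₂ => T₁ p.1 + T₂ p.2) := by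
  obtain ⟨hm, hmap⟩ := map_prodMk_comp_of_aemeasurable h₁ h₂
  have hadd := aemeasurable_prod_of_continuous (continuous_add (M := E)) hc₁ hc₂
  have h := map_add_prod_isConcentrated hc₁ hc₂
  rw [← hmap] at h hadd
  rwa [AEMeasurable.map_map_of_aemeasurable hadd hm] at h

/-- This is Fubini: the inner and the outer integral are evaluated in the given presentations, and
the iterated integral becomes one over the product. The presentations are arbitrary, so a product
can itself be a factor, presented on a product space. The inner integrability is assumed for every
`f`, as `KernelProductDefined` demands it without exceptional set. -/
theorem isImage_kernelProduct {k : E → E → ℂ} (hk : Continuous fun p : E × E => k p.1 p.2)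
    {μ ν : ComplexMeasure E} {P₁ : Measure Ω₁} {P₂ : Measure Ω₂} [SFinite P₁] [SFinite P₂]
    {H₁ : Ω₁ → ℂ} {H₂ : Ω₂ → ℂ} {T₁ : Ω₁ → E} {T₂ : Ω₂ → E}
    (hμ : IsImage μ P₁ H₁ T₁) (hν : IsImage ν P₂ H₂ T₂)
    (hc₁ : IsConcentrated (P₁.map T₁)) (hc₂ : IsConcentrated (P₂.map T₂))
    (hint₁ : ∀ f, Integrable (fun ω => H₂ ω * k f (T₂ ω)) P₂)
    (hint : Integrable (fun p : Ω₁ × Ω₂ => H₁ p.1 * H₂ p.2 * k (T₁ p.1) (T₂ p.2)) (P₁.prod P₂)) :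
    KernelProductDefined k μ ν ∧ IsImage (kernelProduct k μ ν) (P₁.prod P₂)
      (fun p => H₁ p.1 * H₂ p.2 * k (T₁ p.1) (T₂ p.2)) (fun p => T₁ p.1 + T₂ p.2) := by
  have hT : AEMeasurable (fun p : Ω₁ × Ω₂ => T₁ p.1 + T₂ p.2) (P₁.prod P₂) :=
    aemeasurable_comp_prod_of_continuous (F := fun p : E × E => p.1 + p.2) continuous_add
      hμ.aemeasurable hν.aemeasurable hc₁ hc₂
  have inner : ∀ Λ, MeasurableSet Λ → ∀ f, ν.Integrable (kernelIntegrand k Λ f) ∧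
      ν.integral (kernelIntegrand k Λ f) (ContinuousLinearMap.mul ℝ ℂ) =
        ∫ ω, H₂ ω * kernelIntegrand k Λ f (T₂ ω) ∂P₂ := by
    intro Λ hΛ f
    have hm : Measurable (kernelIntegrand k Λ f) := by
      have h1 : Continuous (k f) := hk.comp (Continuous.prodMk_right f)
      have h2 : Measurable (Λ.indicator fun _ => (1 : ℂ)) := measurable_const.indicator hΛ
      exact h1.measurable.mul (h2.comp (continuous_const_add f).measurable)
    have hi : Integrable (fun ω => H₂ ω * kernelIntegrand k Λ f (T₂ ω)) P₂ := by
      refine (integrable_mul_indicator_one (hint₁ f) (T := fun ω => f + T₂ ω)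
        ((continuous_const_add f).measurable.comp_aemeasurable hν.aemeasurable) hΛ).congr
        (Filter.Eventually.of_forall fun ω => ?_)
      simp only [kernelIntegrand, mul_assoc]
    exact ⟨hν.integrable_comp hm.aestronglyMeasurable hi,
      hν.integral_eq hm.aestronglyMeasurable hi⟩
  have outer : ∀ Λ, MeasurableSet Λ → μ.Integrable (fun f =>
      ν.integral (kernelIntegrand k Λ f) (ContinuousLinearMap.mul ℝ ℂ)) ∧
      kernelIntegral k μ ν Λ = ∫ p, H₁ p.1 * H₂ p.2 * k (T₁ p.1) (T₂ p.2) *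
        Λ.indicator (fun _ => (1 : ℂ)) (T₁ p.1 + T₂ p.2) ∂P₁.prod P₂ := by
    intro Λ hΛ
    let G : E → ℂ := fun f => ∫ ω, H₂ ω * kernelIntegrand k Λ f (T₂ ω) ∂P₂
    have hG : (fun f => ν.integral (kernelIntegrand k Λ f) (ContinuousLinearMap.mul ℝ ℂ)) = G :=
      funext fun f => (inner Λ hΛ f).2
    have hGm : AEStronglyMeasurable G (P₁.map T₁) := by
      -- The outer integrand must be measurable as a function on `E`, not only after composition
      -- with `T₁`. Hence the partial integral is taken over `E × Ω₂`, the first factor being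
      -- presented by the identity.
      have hc₁' : IsConcentrated ((P₁.map T₁).map id) := by rwa [Measure.map_id]
      have h1 : AEMeasurable (fun p : E × Ω₂ => k p.1 (T₂ p.2)) ((P₁.map T₁).prod P₂) :=
        aemeasurable_comp_prod_of_continuous hk aemeasurable_id hν.aemeasurable hc₁' hc₂
      have h2 : AEMeasurable (fun p : E × Ω₂ => p.1 + T₂ p.2) ((P₁.map T₁).prod P₂) :=
        aemeasurable_comp_prod_of_continuous (F := fun p : E × E => p.1 + p.2) continuous_add
          aemeasurable_id hν.aemeasurable hc₁' hc₂
      have h3 : Measurable (Λ.indicator fun _ => (1 : ℂ)) := measurable_const.indicator hΛ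
      have h4 : AEStronglyMeasurable (fun p : E × Ω₂ => H₂ p.2 * kernelIntegrand k Λ p.1 (T₂ p.2))
          ((P₁.map T₁).prod P₂) :=
        hν.integrable.aestronglyMeasurable.comp_snd.mul
          (h1.mul (h3.comp_aemeasurable h2)).aestronglyMeasurable
      exact h4.integral_prod_right'
    have hprod := integrable_mul_indicator_one hint hT hΛ
    have hleft : ∀ ω₁, ∫ ω₂, H₁ ω₁ * H₂ ω₂ * k (T₁ ω₁) (T₂ ω₂) *
        Λ.indicator (fun _ => (1 : ℂ)) (T₁ ω₁ + T₂ ω₂) ∂P₂ = H₁ ω₁ * G (T₁ ω₁) := by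
      intro ω₁
      rw [← integral_const_mul]
      simp only [kernelIntegrand, mul_assoc]
    have hi : Integrable (fun ω => H₁ ω * G (T₁ ω)) P₁ := by
      refine hprod.integral_prod_left.congr (Filter.Eventually.of_forall fun ω₁ => ?_)
      exact hleft ω₁
    refine ⟨hG ▸ hμ.integrable_comp hGm hi, ?_⟩
    rw [kernelIntegral, hG, hμ.integral_eq hGm hi, integral_prod _ hprod]
    simp only [hleft]
  obtain ⟨ρ, hρ⟩ := exists_isImage hint hT
  have hex : ∃ ρ : ComplexMeasure E, ∀ Λ, MeasurableSet Λ → ρ Λ = kernelIntegral k μ ν Λ :=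
    ⟨ρ, fun Λ hΛ => by rw [(outer Λ hΛ).2, hρ.apply_eq Λ hΛ]⟩
  have hprod : ∀ Λ, MeasurableSet Λ → kernelProduct k μ ν Λ = kernelIntegral k μ ν Λ := by
    intro Λ hΛ
    rw [kernelProduct, dif_pos hex]
    exact hex.choose_spec Λ hΛ
  exact ⟨fun Λ hΛ => ⟨fun f => (inner Λ hΛ f).1, (outer Λ hΛ).1, hprod Λ hΛ⟩, hint, hT,
    fun Λ hΛ => by rw [hprod Λ hΛ, (outer Λ hΛ).2]⟩

end KernelProduct

end WeylMeasure

namespace WeylMeasure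

/-! ### Operations on presentations. -/

section ImageOperations

variable {X : Type*} [MeasurableSpace X] {Ω Ω' : Type*} [MeasurableSpace Ω] [MeasurableSpace Ω']

theorem IsImage.add {ρ ρ' : ComplexMeasure X} {P : Measure Ω} {H H' : Ω → ℂ} {T : Ω → X}
    (h : IsImage ρ P H T) (h' : IsImage ρ' P H' T) :
    IsImage (ρ + ρ') P (fun ω => H ω + H' ω) T := by
  refine ⟨h.integrable.add h'.integrable, h.aemeasurable, fun Λ hΛ => ?_⟩
  rw [_root_.add_apply, h.apply_eq Λ hΛ, h'.apply_eq Λ hΛ, ← integral_add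
    (integrable_mul_indicator_one h.integrable h.aemeasurable hΛ)
    (integrable_mul_indicator_one h'.integrable h.aemeasurable hΛ)]
  simp only [add_mul]

theorem IsImage.smul {ρ : ComplexMeasure X} {P : Measure Ω} {H : Ω → ℂ} {T : Ω → X}
    (h : IsImage ρ P H T) (z : ℂ) : IsImage (z • ρ) P (fun ω => z * H ω) T := by
  refine ⟨h.integrable.const_mul z, h.aemeasurable, fun Λ hΛ => ?_⟩
  rw [_root_.smul_apply, h.apply_eq Λ hΛ, smul_eq_mul, ← integral_const_mul]
  simp only [mul_assoc]

theorem IsImage.neg {ρ : ComplexMeasure X} {P : Measure Ω} {H : Ω → ℂ} {T : Ω → X}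
    (h : IsImage ρ P H T) : IsImage (-ρ) P (fun ω => -H ω) T := by
  refine ⟨h.integrable.neg, h.aemeasurable, fun Λ hΛ => ?_⟩
  rw [_root_.neg_apply, h.apply_eq Λ hΛ, ← integral_neg]
  simp only [neg_mul]

theorem IsImage.sub {ρ ρ' : ComplexMeasure X} {P : Measure Ω} {H H' : Ω → ℂ} {T : Ω → X}
    (h : IsImage ρ P H T) (h' : IsImage ρ' P H' T) :
    IsImage (ρ - ρ') P (fun ω => H ω - H' ω) T := by
  simpa only [sub_eq_add_neg] using h.add h'.neg

theorem IsImage.congr {ρ : ComplexMeasure X} {P : Measure Ω} {H H' : Ω → ℂ} {T T' : Ω → X}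
    (h : IsImage ρ P H T) (hH : ∀ ω, H ω = H' ω) (hT : ∀ ω, T ω = T' ω) : IsImage ρ P H' T' := by
  rwa [← funext hH, ← funext hT]

/-- The reduction behind most algebraic identities: once both sides are presented on one measure
space, only pointwise identities of densities and maps remain. -/
theorem IsImage.eq_of_eq {ρ ρ' : ComplexMeasure X} {P : Measure Ω} {H H' : Ω → ℂ} {T T' : Ω → X}
    (h : IsImage ρ P H T) (h' : IsImage ρ' P H' T') (hH : ∀ ω, H ω = H' ω)
    (hT : ∀ ω, T ω = T' ω) : ρ = ρ' :=
  (h.congr hH hT).ext h'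

theorem IsImage.comp_equiv {ρ : ComplexMeasure X} {P : Measure Ω} {H : Ω → ℂ} {T : Ω → X}
    (h : IsImage ρ P H T) {P' : Measure Ω'} (e : Ω' ≃ᵐ Ω) (he : MeasurePreserving e P' P) :
    IsImage ρ P' (fun ω => H (e ω)) (fun ω => T (e ω)) := by
  refine ⟨he.integrable_comp_of_integrable h.integrable,
    h.aemeasurable.comp_quasiMeasurePreserving he.quasiMeasurePreserving, fun Λ hΛ => ?_⟩
  rw [h.apply_eq Λ hΛ, ← he.integral_comp']

/-- The cyclic permutation of the factors of a triple product. -/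
def cyclicEquiv (X : Type*) [MeasurableSpace X] : X × X × X ≃ᵐ X × X × X :=
  MeasurableEquiv.prodComm.trans MeasurableEquiv.prodAssoc

theorem measurePreserving_cyclicEquiv (P Q R : Measure X) [SFinite P] [SFinite Q] [SFinite R] :
    MeasurePreserving (cyclicEquiv X) (P.prod (Q.prod R)) (Q.prod (R.prod P)) :=
  (Measure.measurePreserving_swap (μ := P) (ν := Q.prod R)).trans (e := MeasurableEquiv.prodComm)
    (measurePreserving_prodAssoc Q R P)

variable {E : Type*} [AddCommGroup E] [Module ℝ E] [MeasurableSpace E]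

theorem IsImage.involution [MeasurableNeg E] {ρ : ComplexMeasure E} {P : Measure Ω} {H : Ω → ℂ}
    {T : Ω → E} (h : IsImage ρ P H T) :
    IsImage (involution ρ) P (fun ω => conj (H ω)) (fun ω => -T ω) := by
  refine ⟨?_, h.aemeasurable.neg, fun Λ hΛ => ?_⟩
  · exact (LinearIsometryEquiv.integrable_comp_iff Complex.conjLIE).2 h.integrable
  · rw [involution_apply ρ hΛ, h.apply_eq _ hΛ.neg, ← integral_conj]
    congr with ω
    by_cases hx : -T ω ∈ Λ
    · have : T ω ∈ -Λ := hx
      simp [hx, this]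
    · have : T ω ∉ -Λ := hx
      simp [hx, this]

end ImageOperations

end WeylMeasure

namespace WeylMeasure

/-! ### Moment spaces and the polar decomposition. -/

section MomentSpaces

variable {E : Type*} [AddCommGroup E] [Module ℝ E] [MeasurableSpace E]

theorem tvNorm_zero : tvNorm (0 : ComplexMeasure E) = 0 := by
  simp [tvNorm]

theorem zero_mem_regularMeasures : (0 : ComplexMeasure E) ∈ regularMeasures E := fun ε hε =>
  ⟨0, ⟨⊥, inferInstance, by simp [concentratedOn]⟩, by rw [sub_zero, tvNorm_zero]; exact hε⟩

theorem zero_mem_momentSpace (κ : Seminorm ℝ E) (n : ℕ∞) :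
    (0 : ComplexMeasure E) ∈ momentSpace κ n :=
  ⟨zero_mem_regularMeasures, fun m _ => by rw [moment_zero_measure]; exact ENNReal.zero_lt_top⟩

theorem moment_smul (κ : Seminorm ℝ E) (m : ℕ) (z : ℂ) (μ : ComplexMeasure E) :
    moment κ m (z • μ) = ‖z‖ₑ * moment κ m μ := by
  rw [moment, VectorMeasure.variation_smul, moment, lintegral_smul_measure]
  rfl

theorem momentSpace_mono (κ : Seminorm ℝ E) {m n : ℕ∞} (h : m ≤ n) :
    momentSpace κ n ⊆ momentSpace κ m := fun _ hμ => ⟨hμ.1, fun j hj => hμ.2 j (hj.trans h)⟩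

variable [TopologicalSpace E] [IsTopologicalAddGroup E] [ContinuousSMul ℝ E] [T2Space E]
  [BorelSpace E]

theorem add_mem_regularMeasures {μ ν : ComplexMeasure E} (hμ : μ ∈ regularMeasures E)
    (hν : ν ∈ regularMeasures E) : μ + ν ∈ regularMeasures E :=
  mem_regularMeasures_iff.2 (((mem_regularMeasures_iff.1 hμ).add
    (mem_regularMeasures_iff.1 hν)).mono_ac VectorMeasure.variation_add_le.absolutelyContinuous)

theorem variation_smul_ac (z : ℂ) (μ : ComplexMeasure E) :
    (z • μ).variation ≪ μ.variation := by
  rw [VectorMeasure.variation_smul]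
  exact Measure.smul_absolutelyContinuous

theorem smul_mem_regularMeasures (z : ℂ) {μ : ComplexMeasure E} (hμ : μ ∈ regularMeasures E) :
    z • μ ∈ regularMeasures E :=
  mem_regularMeasures_iff.2 ((mem_regularMeasures_iff.1 hμ).mono_ac (variation_smul_ac z μ))

theorem add_mem_momentSpace {κ : Seminorm ℝ E} {n : ℕ∞} {μ ν : ComplexMeasure E}
    (hμ : μ ∈ momentSpace κ n) (hν : ν ∈ momentSpace κ n) : μ + ν ∈ momentSpace κ n :=
  ⟨add_mem_regularMeasures hμ.1 hν.1, fun m hm =>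
    (moment_add_le κ m μ ν).trans_lt (ENNReal.add_lt_top.2 ⟨hμ.2 m hm, hν.2 m hm⟩)⟩

theorem smul_mem_momentSpace {κ : Seminorm ℝ E} {n : ℕ∞} (z : ℂ) {μ : ComplexMeasure E}
    (hμ : μ ∈ momentSpace κ n) : z • μ ∈ momentSpace κ n :=
  ⟨smul_mem_regularMeasures z hμ.1, fun m hm => by
    rw [moment_smul]
    exact ENNReal.mul_lt_top enorm_lt_top (hμ.2 m hm)⟩

theorem sub_mem_momentSpace {κ : Seminorm ℝ E} {n : ℕ∞} {μ ν : ComplexMeasure E}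
    (hμ : μ ∈ momentSpace κ n) (hν : ν ∈ momentSpace κ n) : μ - ν ∈ momentSpace κ n := by
  have hneg : -ν ∈ momentSpace κ n := by
    refine ⟨mem_regularMeasures_iff.2 ?_, fun m hm => ?_⟩
    · rw [VectorMeasure.variation_neg]
      exact mem_regularMeasures_iff.1 hν.1
    · rw [moment_neg]
      exact hν.2 m hm
  rw [sub_eq_add_neg]
  exact add_mem_momentSpace hμ hneg

/-- The zeroth moment is the total variation, which is always finite. -/
theorem momentSpace_zero (κ : Seminorm ℝ E) : momentSpace κ 0 = regularMeasures E := by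
  refine Subset.antisymm (fun μ hμ => hμ.1) fun μ hμ => ⟨hμ, fun m hm => ?_⟩
  have : m = 0 := by simpa using hm
  subst this
  simp [moment, measure_lt_top]

/-- The density of a complex measure with respect to its variation. -/
noncomputable def density (μ : ComplexMeasure E) : E → ℂ := μ.rnDeriv μ.variation

theorem isImage_density (μ : ComplexMeasure E) : IsImage μ μ.variation (density μ) id :=
  isImage_variation μ

theorem enorm_density (μ : ComplexMeasure E) : ∀ᵐ f ∂μ.variation, ‖density μ f‖ₑ = 1 :=
  enorm_rnDeriv_variation μ

theorem norm_density (μ : ComplexMeasure E) : ∀ᵐ f ∂μ.variation, ‖density μ f‖ = 1 := by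
  filter_upwards [enorm_density μ] with f hf
  rw [← toReal_enorm, hf, ENNReal.toReal_one]

theorem variation_involution_le (μ : ComplexMeasure E) :
    (involution μ).variation ≤ μ.variation.map (fun f => -f) := by
  refine VectorMeasure.variation_le_of_forall_enorm_le fun s hs => ?_
  rw [involution_apply μ hs, Measure.map_apply measurable_neg hs, RCLike.enorm_conj]
  exact μ.enorm_measure_le_variation _

theorem isConcentrated_map_neg {M : Measure E} (h : IsConcentrated M) :
    IsConcentrated (M.map fun f => -f) := by
  obtain ⟨V, hV, hfd, hae⟩ := isConcentrated_iff_compl.1 h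
  refine isConcentrated_iff_compl.2 ⟨V, hV, hfd, ?_⟩
  rw [Measure.map_apply measurable_neg
    (MeasurableSet.iUnion fun n => measurableSet_of_finiteDimensional (V n)).compl]
  convert hae using 2
  ext x
  simp

theorem involution_mem_regularMeasures {μ : ComplexMeasure E} (hμ : μ ∈ regularMeasures E) :
    involution μ ∈ regularMeasures E :=
  mem_regularMeasures_iff.2 ((isConcentrated_map_neg (mem_regularMeasures_iff.1 hμ)).mono_ac
    (variation_involution_le μ).absolutelyContinuous)

variable [HasContinuousSeminorms E]

theorem involution_mem_momentSpace {κ : Seminorm ℝ E} {n : ℕ∞} {μ : ComplexMeasure E}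
    (hμ : μ ∈ momentSpace κ n) : involution μ ∈ momentSpace κ n := by
  refine ⟨involution_mem_regularMeasures hμ.1, fun m hm => lt_of_le_of_lt ?_ (hμ.2 m hm)⟩
  have hκ := κ.continuous_of_hasContinuousSeminorms
  refine (lintegral_mono' (variation_involution_le μ) le_rfl).trans ?_
  rw [lintegral_map (by fun_prop) measurable_neg]
  simp only [map_neg_eq_map, moment, le_refl]

theorem integrable_one_add_pow {κ : Seminorm ℝ E} {i : ℕ} {μ : ComplexMeasure E}
    (hμ : μ ∈ momentSpace κ i) : Integrable (fun f => (1 + κ f) ^ i) μ.variation := by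
  have hκ := κ.continuous_of_hasContinuousSeminorms
  have hi : Integrable (fun f => κ f ^ i) μ.variation := by
    refine ⟨(by fun_prop : Continuous fun f => κ f ^ i).measurable.aestronglyMeasurable, ?_⟩
    rw [hasFiniteIntegral_iff_ofReal
      (Filter.Eventually.of_forall fun f => pow_nonneg (apply_nonneg κ f) i)]
    exact hμ.2 i le_rfl
  -- The majorant comes from `(1 + x)^i ≤ 2^(i-1) (1 + x^i)`.
  refine Integrable.mono' (((integrable_const (1 : ℝ)).add hi).const_mul (2 ^ (i - 1)))
    (by fun_prop : Continuous fun f => (1 + κ f) ^ i).measurable.aestronglyMeasurable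
    (Filter.Eventually.of_forall fun f => ?_)
  have h0 := apply_nonneg κ f
  rw [Real.norm_of_nonneg (by positivity)]
  simpa using add_pow_le zero_le_one h0 i

end MomentSpaces

/-! ### Kernels of polynomial growth. -/

section Kernels

variable {E : Type*} [AddCommGroup E] [Module ℝ E] [TopologicalSpace E]

/-- A jointly continuous kernel of growth at most `(1 + ς f)^i (1 + ς g)^i`. -/
structure IsAdmissible (ς : Seminorm ℝ E) (i : ℕ) (k : E → E → ℂ) : Prop where
  continuous : Continuous fun p : E × E => k p.1 p.2
  growth : ∃ a : ℝ, ∀ f g, ‖k f g‖ ≤ a * ((1 + ς f) ^ i * (1 + ς g) ^ i)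

theorem IsAdmissible.flip {ς : Seminorm ℝ E} {i : ℕ} {k : E → E → ℂ} (hk : IsAdmissible ς i k) :
    IsAdmissible ς i (fun f g => k g f) := by
  refine ⟨hk.continuous.comp continuous_swap, ?_⟩
  obtain ⟨a, ha⟩ := hk.growth
  exact ⟨a, fun f g => (ha g f).trans_eq (by ring)⟩

variable [IsTopologicalAddGroup E] [ContinuousSMul ℝ E] [T2Space E] [MeasurableSpace E]
  [BorelSpace E] [HasContinuousSeminorms E] {Ω₁ Ω₂ : Type*} [MeasurableSpace Ω₁]
  [MeasurableSpace Ω₂] {ς : Seminorm ℝ E} {i : ℕ} {k : E → E → ℂ}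

/-- The growth bound is a product of a function of `f` and a function of `g`, so integrability on
the product space reduces to a weighted condition on each factor. -/
theorem IsAdmissible.isImage_of_isImage (hk : IsAdmissible ς i k) {μ ν : ComplexMeasure E}
    {P₁ : Measure Ω₁} {P₂ : Measure Ω₂} [SFinite P₁] [SFinite P₂]
    {H₁ : Ω₁ → ℂ} {H₂ : Ω₂ → ℂ} {T₁ : Ω₁ → E} {T₂ : Ω₂ → E}
    (hμ : IsImage μ P₁ H₁ T₁) (hν : IsImage ν P₂ H₂ T₂)
    (hc₁ : IsConcentrated (P₁.map T₁)) (hc₂ : IsConcentrated (P₂.map T₂))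
    (h₁ : Integrable (fun ω => ‖H₁ ω‖ * (1 + ς (T₁ ω)) ^ i) P₁)
    (h₂ : Integrable (fun ω => ‖H₂ ω‖ * (1 + ς (T₂ ω)) ^ i) P₂) :
    KernelProductDefined k μ ν ∧ IsImage (kernelProduct k μ ν) (P₁.prod P₂)
      (fun p => H₁ p.1 * H₂ p.2 * k (T₁ p.1) (T₂ p.2)) (fun p => T₁ p.1 + T₂ p.2) := by
  obtain ⟨a, ha⟩ := hk.growth
  refine isImage_kernelProduct hk.continuous hμ hν hc₁ hc₂ (fun f => ?_) ?_
  · have hkf : Continuous (k f) := hk.continuous.comp (Continuous.prodMk_right f)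
    refine Integrable.mono' (h₂.const_mul (a * (1 + ς f) ^ i))
      (hν.integrable.aestronglyMeasurable.mul
        (hkf.measurable.comp_aemeasurable hν.aemeasurable).aestronglyMeasurable)
      (Filter.Eventually.of_forall fun ω => ?_)
    rw [norm_mul]
    exact (mul_le_mul_of_nonneg_left (ha f (T₂ ω)) (norm_nonneg _)).trans_eq (by ring)
  · refine Integrable.mono' ((h₁.mul_prod h₂).const_mul a)
      ((hμ.integrable.aestronglyMeasurable.comp_fst.mul
        hν.integrable.aestronglyMeasurable.comp_snd).mul
        (aemeasurable_comp_prod_of_continuous hk.continuous hμ.aemeasurable hν.aemeasurable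
          hc₁ hc₂).aestronglyMeasurable)
      (Filter.Eventually.of_forall fun p => ?_)
    rw [norm_mul, norm_mul]
    exact (mul_le_mul_of_nonneg_left (ha (T₁ p.1) (T₂ p.2)) (by positivity)).trans_eq (by ring)

theorem integrable_norm_density_mul {μ : ComplexMeasure E} (hμ : μ ∈ momentSpace ς i) :
    Integrable (fun f => ‖density μ f‖ * (1 + ς (id f)) ^ i) μ.variation := by
  refine (integrable_one_add_pow hμ).congr ?_
  filter_upwards [norm_density μ] with f hf
  rw [hf, one_mul, id]

theorem isConcentrated_map_id {μ : ComplexMeasure E} (hμ : μ ∈ regularMeasures E) :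
    IsConcentrated (μ.variation.map id) := by
  rw [Measure.map_id]
  exact mem_regularMeasures_iff.1 hμ

theorem IsAdmissible.isImage (hk : IsAdmissible ς i k) {μ ν : ComplexMeasure E}
    (hμ : μ ∈ momentSpace ς i) (hν : ν ∈ momentSpace ς i) :
    KernelProductDefined k μ ν ∧ IsImage (kernelProduct k μ ν) (μ.variation.prod ν.variation)
      (fun p => density μ p.1 * density ν p.2 * k p.1 p.2) (fun p => p.1 + p.2) :=
  hk.isImage_of_isImage (isImage_density μ) (isImage_density ν) (isConcentrated_map_id hμ.1)
    (isConcentrated_map_id hν.1) (integrable_norm_density_mul hμ) (integrable_norm_density_mul hν)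

theorem IsAdmissible.variation_ac (hk : IsAdmissible ς i k) {μ ν : ComplexMeasure E}
    (hμ : μ ∈ momentSpace ς i) (hν : ν ∈ momentSpace ς i) :
    (kernelProduct k μ ν).variation ≪
      (μ.variation.prod ν.variation).map fun p : E × E => p.1 + p.2 :=
  (hk.isImage hμ hν).2.variation_ac

theorem IsAdmissible.mem_regularMeasures (hk : IsAdmissible ς i k) {μ ν : ComplexMeasure E}
    (hμ : μ ∈ momentSpace ς i) (hν : ν ∈ momentSpace ς i) :
    kernelProduct k μ ν ∈ regularMeasures E :=
  mem_regularMeasures_iff.2 ((map_add_prod_isConcentrated (mem_regularMeasures_iff.1 hμ.1)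
    (mem_regularMeasures_iff.1 hν.1)).mono_ac (hk.variation_ac hμ hν))

theorem IsAdmissible.kernelProduct_swap (hk : IsAdmissible ς i k) {μ ν : ComplexMeasure E}
    (hμ : μ ∈ momentSpace ς i) (hν : ν ∈ momentSpace ς i) :
    kernelProduct k μ ν = kernelProduct (fun f g => k g f) ν μ := by
  have h := (hk.isImage hμ hν).2.comp_equiv MeasurableEquiv.prodComm
    (Measure.measurePreserving_swap (μ := ν.variation) (ν := μ.variation))
  exact h.eq_of_eq (hk.flip.isImage hν hμ).2
    (fun p => by
      change density μ p.2 * density ν p.1 * k p.2 p.1 = _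
      ring) (fun p => add_comm _ _)

/-- The inner product enters through its presentation on the product of two variations, so its own
variation is never needed. Its weighted integrability costs moments of order `j + i` of `ν` and `ρ`,
all of which are finite. -/
theorem IsAdmissible.isImage_triple {i j : ℕ} {k l : E → E → ℂ} (hk : IsAdmissible ς i k)
    (hl : IsAdmissible ς j l) {μ ν ρ : ComplexMeasure E} (hμ : μ ∈ momentSpace ς ⊤)
    (hν : ν ∈ momentSpace ς ⊤) (hρ : ρ ∈ momentSpace ς ⊤) :
    IsImage (kernelProduct k μ (kernelProduct l ν ρ))
      (μ.variation.prod (ν.variation.prod ρ.variation))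
      (fun p => density μ p.1 * (density ν p.2.1 * density ρ p.2.2 * l p.2.1 p.2.2) *
        k p.1 (p.2.1 + p.2.2)) (fun p => p.1 + (p.2.1 + p.2.2)) := by
  have top : ∀ {n : ℕ} {τ : ComplexMeasure E}, τ ∈ momentSpace ς ⊤ → τ ∈ momentSpace ς n :=
    fun h => momentSpace_mono ς le_top h
  have h := (hl.isImage (top hν) (top hρ)).2
  have hcν := isConcentrated_map_id hν.1
  have hcρ := isConcentrated_map_id hρ.1
  refine (hk.isImage_of_isImage (isImage_density μ) h (isConcentrated_map_id hμ.1)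
    (isConcentrated_map_add aemeasurable_id aemeasurable_id hcν hcρ)
    (integrable_norm_density_mul (top hμ)) ?_).2
  obtain ⟨a, ha⟩ := hl.growth
  have hς := ς.continuous_of_hasContinuousSeminorms
  refine Integrable.mono' (((integrable_norm_density_mul (i := j + i) (top hν)).mul_prod
    (integrable_norm_density_mul (i := j + i) (top hρ))).const_mul a)
    (h.integrable.aestronglyMeasurable.norm.mul
      ((by fun_prop : Continuous fun f => (1 + ς f) ^ i).measurable.comp_aemeasurable
        h.aemeasurable).aestronglyMeasurable) (Filter.Eventually.of_forall fun p => ?_)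
  have h1 := apply_nonneg ς p.1
  have h2 := apply_nonneg ς p.2
  have h3 := apply_nonneg ς (p.1 + p.2)
  have hw : (1 + ς (p.1 + p.2)) ^ i ≤ ((1 + ς p.1) * (1 + ς p.2)) ^ i := by
    refine pow_le_pow_left₀ (by positivity) ?_ i
    -- The weight is submultiplicative: `1 + ς(f+g) ≤ (1 + ς f)(1 + ς g)`.
    nlinarith [map_add_le_add ς p.1 p.2, mul_nonneg h1 h2]
  rw [mul_pow] at hw
  rw [norm_mul, norm_norm, norm_mul, norm_mul, Real.norm_of_nonneg (by positivity)]
  calc _ ≤ ‖density ν p.1‖ * ‖density ρ p.2‖ * (a * ((1 + ς p.1) ^ j * (1 + ς p.2) ^ j)) *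
        ((1 + ς p.1) ^ i * (1 + ς p.2) ^ i) := by
        have ha' := ha p.1 p.2
        -- The sign of `a` is not given; the bound is nonnegative because it dominates a norm.
        have : 0 ≤ a * ((1 + ς p.1) ^ j * (1 + ς p.2) ^ j) := (norm_nonneg _).trans ha'
        gcongr
    _ = _ := by simp only [id]; ring

/-- The measures `μ`, `μ'` and `μ + μ'` are presented on different variations, so additivity is read
off from the outer integral instead of from densities. -/
theorem IsAdmissible.kernelProduct_add_left (hk : IsAdmissible ς i k) {μ μ' ν : ComplexMeasure E}
    (hμ : μ ∈ momentSpace ς i) (hμ' : μ' ∈ momentSpace ς i) (hν : ν ∈ momentSpace ς i) :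
    kernelProduct k (μ + μ') ν = kernelProduct k μ ν + kernelProduct k μ' ν := by
  ext Λ hΛ : 1
  obtain ⟨-, h1, h2⟩ := (hk.isImage hμ hν).1 Λ hΛ
  obtain ⟨-, h1', h2'⟩ := (hk.isImage hμ' hν).1 Λ hΛ
  obtain ⟨-, -, h3⟩ := (hk.isImage (add_mem_momentSpace hμ hμ') hν).1 Λ hΛ
  rw [_root_.add_apply, h2, h2', h3, kernelIntegral, VectorMeasure.integral_add_vectorMeasure h1 h1']
  rfl

theorem IsAdmissible.kernelProduct_add_right (hk : IsAdmissible ς i k) {μ ν ν' : ComplexMeasure E}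
    (hμ : μ ∈ momentSpace ς i) (hν : ν ∈ momentSpace ς i) (hν' : ν' ∈ momentSpace ς i) :
    kernelProduct k μ (ν + ν') = kernelProduct k μ ν + kernelProduct k μ ν' := by
  rw [hk.kernelProduct_swap hμ (add_mem_momentSpace hν hν'), hk.kernelProduct_swap hμ hν,
    hk.kernelProduct_swap hμ hν', hk.flip.kernelProduct_add_left hν hν' hμ]

theorem IsAdmissible.kernelProduct_smul_left (hk : IsAdmissible ς i k) (z : ℂ)
    {μ ν : ComplexMeasure E} (hμ : μ ∈ momentSpace ς i) (hν : ν ∈ momentSpace ς i) :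
    kernelProduct k (z • μ) ν = z • kernelProduct k μ ν := by
  -- Here `z • μ` is presented on the variation of `μ` rather than on its own, so that both sides
  -- live on the same space.
  have h := (hk.isImage_of_isImage ((isImage_density μ).smul z) (isImage_density ν)
    (isConcentrated_map_id hμ.1) (isConcentrated_map_id hν.1)
    (((integrable_norm_density_mul hμ).const_mul ‖z‖).congr
      (Filter.Eventually.of_forall fun f => by simp only [norm_mul, mul_assoc]))
    (integrable_norm_density_mul hν)).2
  exact h.eq_of_eq ((hk.isImage hμ hν).2.smul z) (fun p => by simp only [id]; ring) fun p => rfl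

theorem IsAdmissible.kernelProduct_smul_right (hk : IsAdmissible ς i k) (z : ℂ)
    {μ ν : ComplexMeasure E} (hμ : μ ∈ momentSpace ς i) (hν : ν ∈ momentSpace ς i) :
    kernelProduct k μ (z • ν) = z • kernelProduct k μ ν := by
  rw [hk.kernelProduct_swap hμ (smul_mem_momentSpace z hν), hk.kernelProduct_swap hμ hν,
    hk.flip.kernelProduct_smul_left z hν hμ]

/-- The involution conjugates the density and reflects the map; `hconj` is exactly the compatibility
of the kernel with these two operations. -/
theorem IsAdmissible.involution_kernelProduct (hk : IsAdmissible ς i k)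
    (hconj : ∀ f g, conj (k f g) = k (-f) (-g))
    {μ ν : ComplexMeasure E} (hμ : μ ∈ momentSpace ς i) (hν : ν ∈ momentSpace ς i) :
    involution (kernelProduct k μ ν) = kernelProduct k (involution μ) (involution ν) := by
  have hint : ∀ {μ : ComplexMeasure E}, μ ∈ momentSpace ς i →
      Integrable (fun f => ‖conj (density μ f)‖ * (1 + ς (-id f)) ^ i) μ.variation := by
    intro μ hμ
    refine (integrable_norm_density_mul hμ).congr (Filter.Eventually.of_forall fun f => ?_)
    simp only [RCLike.norm_conj, map_neg_eq_map]
  have h := (hk.isImage_of_isImage (isImage_density μ).involution (isImage_density ν).involution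
    (isConcentrated_map_neg (mem_regularMeasures_iff.1 hμ.1))
    (isConcentrated_map_neg (mem_regularMeasures_iff.1 hν.1)) (hint hμ) (hint hν)).2
  exact (hk.isImage hμ hν).2.involution.eq_of_eq h
    (fun p => by simp only [map_mul, hconj, id]) (fun p => by simp only [id, neg_add])

end Kernels

end WeylMeasure

namespace WeylMeasure

/-! ### Moment estimates. -/

theorem choose_le_binomConst {m n j : ℕ} (hm : m ≤ n) : m.choose j ≤ binomConst n := by
  by_cases hj : j ≤ n
  · exact (Nat.choose_le_choose j hm).trans
      (Finset.le_sup (f := fun k => n.choose k) (Finset.mem_range.2 (Nat.lt_succ_of_le hj)))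
  · rw [Nat.choose_eq_zero_of_lt (by omega)]
    exact Nat.zero_le _

/-- The pairs `(j + i, m - j + i)` are distinct and lie in the square `[0, n + i]²`, so the left
side is a part of the expanded product. -/
theorem sum_range_antidiagonal_le (n i : ℕ) (F G : ℕ → ℝ≥0∞) :
    ∑ m ∈ Finset.range (n + 1), ∑ j ∈ Finset.range (m + 1), F (j + i) * G (m - j + i) ≤
      (∑ m ∈ Finset.range (n + i + 1), F m) * ∑ m ∈ Finset.range (n + i + 1), G m := by
  rw [Finset.sum_mul_sum, Finset.sum_sigma', ← Finset.sum_product']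
  let e : (Σ _ : ℕ, ℕ) → ℕ × ℕ := fun x => (x.2 + i, x.1 - x.2 + i)
  have hinj : Set.InjOn e ((Finset.range (n + 1)).sigma fun m => Finset.range (m + 1)) := by
    rintro ⟨m, j⟩ h ⟨m', j'⟩ h' heq
    simp only [Finset.coe_sigma, Set.mem_sigma_iff, Finset.coe_range, Set.mem_Iio] at h h'
    simp only [e, Prod.mk.injEq] at heq
    obtain rfl : j = j' := by omega
    obtain rfl : m = m' := by omega
    rfl
  rw [← Finset.sum_image (f := fun p : ℕ × ℕ => F p.1 * G p.2) (g := e) hinj]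
  refine Finset.sum_le_sum_of_subset fun p hp => ?_
  obtain ⟨⟨m, j⟩, h, rfl⟩ := Finset.mem_image.1 hp
  simp only [Finset.mem_sigma, Finset.mem_range] at h
  simp only [e, Finset.mem_product, Finset.mem_range]
  omega

section Moments

variable {E : Type*} [AddCommGroup E] [Module ℝ E] [MeasurableSpace E]

/-- The moment of the absolute value of `kernelProduct k μ ν`, computed without cancellations. -/
noncomputable def absMoment (κ : Seminorm ℝ E) (m : ℕ) (k : E → E → ℂ) (μ ν : ComplexMeasure E) :
    ℝ≥0∞ :=
  ∫⁻ p, ‖k p.1 p.2‖ₑ * ENNReal.ofReal (κ (p.1 + p.2) ^ m) ∂μ.variation.prod ν.variation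

theorem momentNorm_mono (κ : Seminorm ℝ E) {m n : ℕ} (h : m ≤ n) (μ : ComplexMeasure E) :
    momentNorm κ m μ ≤ momentNorm κ n μ :=
  Finset.sum_le_sum_of_subset (Finset.range_mono (Nat.add_le_add_right h 1))

theorem momentNorm_add_le (κ : Seminorm ℝ E) (n : ℕ) (μ ν : ComplexMeasure E) :
    momentNorm κ n (μ + ν) ≤ momentNorm κ n μ + momentNorm κ n ν := by
  simp only [momentNorm, ← Finset.sum_add_distrib]
  exact Finset.sum_le_sum fun m _ => moment_add_le κ m μ ν

theorem momentNorm_lt_top {κ : Seminorm ℝ E} {n : ℕ} {μ : ComplexMeasure E}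
    (h : μ ∈ momentSpace κ n) : momentNorm κ n μ < ∞ :=
  ENNReal.sum_lt_top.2 fun m hm =>
    h.2 m (Nat.cast_le.2 (Nat.lt_succ_iff.1 (Finset.mem_range.1 hm)))

variable [TopologicalSpace E] [IsTopologicalAddGroup E] [ContinuousSMul ℝ E] [T2Space E]
  [BorelSpace E] [HasContinuousSeminorms E]

theorem isAdmissible_of_bound {k : E → E → ℂ} (hk : Continuous fun p : E × E => k p.1 p.2)
    {κ : Seminorm ℝ E} {i : ℕ} {a : ℝ} (ha : 0 ≤ a)
    (hb : ∀ f g, ‖k f g‖ ≤ a * (κ f ^ i * κ g ^ i)) : IsAdmissible κ i k := by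
  refine ⟨hk, a, fun f g => (hb f g).trans ?_⟩
  have h1 := apply_nonneg κ f
  have h2 := apply_nonneg κ g
  gcongr <;> linarith

/-- The variation of an image is at most the image of the absolute density, and the polar densities
have modulus one. -/
theorem moment_kernelProduct_le {κ ς : Seminorm ℝ E} {i : ℕ} {k : E → E → ℂ}
    (hk : IsAdmissible ς i k) {μ ν : ComplexMeasure E} (hμ : μ ∈ momentSpace ς i)
    (hν : ν ∈ momentSpace ς i) (m : ℕ) :
    moment κ m (kernelProduct k μ ν) ≤ absMoment κ m k μ ν := by
  have hκ := κ.continuous_of_hasContinuousSeminorms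
  refine ((hk.isImage hμ hν).2.lintegral_le
    (by fun_prop : Continuous fun f => κ f ^ m).measurable.ennreal_ofReal.aemeasurable).trans_eq ?_
  refine lintegral_congr_ae ?_
  have e₁ : ∀ᵐ p ∂μ.variation.prod ν.variation, ‖density μ p.1‖ₑ = 1 :=
    Measure.quasiMeasurePreserving_fst.ae (enorm_density μ)
  have e₂ : ∀ᵐ p ∂μ.variation.prod ν.variation, ‖density ν p.2‖ₑ = 1 :=
    Measure.quasiMeasurePreserving_snd.ae (enorm_density ν)
  filter_upwards [e₁, e₂] with p h₁ h₂
  rw [enorm_mul, enorm_mul, h₁, h₂, one_mul, one_mul]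

/-- Subadditivity of `κ` and the binomial theorem bound the integrand by a sum of products of a
function of `f` and a function of `g`; Tonelli then factors each term. -/
theorem absMoment_le {κ : Seminorm ℝ E} {i : ℕ} {k : E → E → ℂ} {a : ℝ} (ha : 0 ≤ a)
    (hb : ∀ f g, ‖k f g‖ ≤ a * (κ f ^ i * κ g ^ i)) (μ ν : ComplexMeasure E) (m : ℕ) :
    absMoment κ m k μ ν ≤ ENNReal.ofReal a * ∑ j ∈ Finset.range (m + 1),
      (m.choose j : ℝ≥0∞) * (moment κ (j + i) μ * moment κ (m - j + i) ν) := by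
  have hκ := κ.continuous_of_hasContinuousSeminorms
  have hm : ∀ j : ℕ, Measurable fun f => ENNReal.ofReal (κ f ^ j) := fun j =>
    (by fun_prop : Continuous fun f => κ f ^ j).measurable.ennreal_ofReal
  have hpt : ∀ p : E × E, ‖k p.1 p.2‖ₑ * ENNReal.ofReal (κ (p.1 + p.2) ^ m) ≤
      ENNReal.ofReal a * ∑ j ∈ Finset.range (m + 1), (m.choose j : ℝ≥0∞) *
        (ENNReal.ofReal (κ p.1 ^ (j + i)) * ENNReal.ofReal (κ p.2 ^ (m - j + i))) := by
    intro p
    have h1 := apply_nonneg κ p.1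
    have h2 := apply_nonneg κ p.2
    have h3 := apply_nonneg κ (p.1 + p.2)
    have hsum : ∑ j ∈ Finset.range (m + 1), (m.choose j : ℝ≥0∞) *
        (ENNReal.ofReal (κ p.1 ^ (j + i)) * ENNReal.ofReal (κ p.2 ^ (m - j + i))) =
        ENNReal.ofReal (∑ j ∈ Finset.range (m + 1), (m.choose j : ℝ) *
          (κ p.1 ^ (j + i) * κ p.2 ^ (m - j + i))) := by
      rw [ENNReal.ofReal_sum_of_nonneg fun j _ => by positivity]
      refine Finset.sum_congr rfl fun j _ => ?_
      rw [ENNReal.ofReal_mul (by positivity), ENNReal.ofReal_mul (by positivity),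
        ENNReal.ofReal_natCast]
    rw [hsum, ← ofReal_norm, ← ENNReal.ofReal_mul (norm_nonneg _), ← ENNReal.ofReal_mul ha]
    refine ENNReal.ofReal_le_ofReal ?_
    calc ‖k p.1 p.2‖ * κ (p.1 + p.2) ^ m
        ≤ (a * (κ p.1 ^ i * κ p.2 ^ i)) * (κ p.1 + κ p.2) ^ m := by
          have := hb p.1 p.2
          have := map_add_le_add κ p.1 p.2
          gcongr
      _ = _ := by
          rw [add_pow, Finset.mul_sum, Finset.mul_sum]
          refine Finset.sum_congr rfl fun j _ => ?_
          ring
  refine (lintegral_mono hpt).trans_eq ?_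
  rw [lintegral_const_mul' _ _ ENNReal.ofReal_ne_top, lintegral_finsetSum]
  · congr 1
    refine Finset.sum_congr rfl fun j _ => ?_
    rw [lintegral_const_mul' _ _ (ENNReal.natCast_ne_top _),
      lintegral_prod_mul (hm _).aemeasurable (hm _).aemeasurable]
    rfl
  · intro j _
    exact (((hm _).comp measurable_fst).mul ((hm _).comp measurable_snd)).const_mul _

theorem absMoment_lt_top {κ : Seminorm ℝ E} {i : ℕ} {k : E → E → ℂ} {a : ℝ} (ha : 0 ≤ a)
    (hb : ∀ f g, ‖k f g‖ ≤ a * (κ f ^ i * κ g ^ i)) {μ ν : ComplexMeasure E} {m : ℕ}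
    (hμ : μ ∈ momentSpace κ (m + i : ℕ)) (hν : ν ∈ momentSpace κ (m + i : ℕ)) :
    absMoment κ m k μ ν < ∞ := by
  refine (absMoment_le ha hb μ ν m).trans_lt (ENNReal.mul_lt_top ENNReal.ofReal_lt_top
    (ENNReal.sum_lt_top.2 fun j hj => ENNReal.mul_lt_top (by simp) (ENNReal.mul_lt_top
      (hμ.2 _ (Nat.cast_le.2 ?_)) (hν.2 _ (Nat.cast_le.2 ?_)))))
  · have := Finset.mem_range.1 hj
    omega
  · omega

/-- The exponent `i` is the number of moments lost: `0` for the twisted convolutions, `1` for the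
brackets. -/
theorem momentNorm_kernelProduct_le {κ : Seminorm ℝ E} {i : ℕ} {k : E → E → ℂ}
    (hk : Continuous fun p : E × E => k p.1 p.2) {a : ℝ} (ha : 0 ≤ a)
    (hb : ∀ f g, ‖k f g‖ ≤ a * (κ f ^ i * κ g ^ i)) {μ ν : ComplexMeasure E}
    (hμ : μ ∈ momentSpace κ i) (hν : ν ∈ momentSpace κ i) (n : ℕ) :
    momentNorm κ n (kernelProduct k μ ν) ≤ ENNReal.ofReal a * (binomConst n : ℝ≥0∞) *
      momentNorm κ (n + i) μ * momentNorm κ (n + i) ν := by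
  calc momentNorm κ n (kernelProduct k μ ν)
      ≤ ∑ m ∈ Finset.range (n + 1), ENNReal.ofReal a * ∑ j ∈ Finset.range (m + 1),
        (binomConst n : ℝ≥0∞) * (moment κ (j + i) μ * moment κ (m - j + i) ν) := by
        refine Finset.sum_le_sum fun m hm => ((moment_kernelProduct_le
          (isAdmissible_of_bound hk ha hb) hμ hν m).trans (absMoment_le ha hb μ ν m)).trans ?_
        gcongr with j hj
        exact choose_le_binomConst (Nat.lt_succ_iff.1 (Finset.mem_range.1 hm))
    _ = ENNReal.ofReal a * (binomConst n : ℝ≥0∞) * ∑ m ∈ Finset.range (n + 1),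
        ∑ j ∈ Finset.range (m + 1), moment κ (j + i) μ * moment κ (m - j + i) ν := by
        simp only [← Finset.mul_sum, mul_assoc]
    _ ≤ _ := by
        rw [mul_assoc (ENNReal.ofReal a * _)]
        gcongr
        exact sum_range_antidiagonal_le n i _ _

theorem kernelProduct_mem_momentSpace {κ : Seminorm ℝ E} {i : ℕ} {k : E → E → ℂ}
    (hk : Continuous fun p : E × E => k p.1 p.2) {a : ℝ} (ha : 0 ≤ a)
    (hb : ∀ f g, ‖k f g‖ ≤ a * (κ f ^ i * κ g ^ i)) {μ ν : ComplexMeasure E} {n : ℕ∞}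
    (hμ : μ ∈ momentSpace κ (n + i)) (hν : ν ∈ momentSpace κ (n + i)) :
    kernelProduct k μ ν ∈ momentSpace κ n := by
  have hμ' := momentSpace_mono κ le_add_self hμ
  have hν' := momentSpace_mono κ le_add_self hν
  have hadm := isAdmissible_of_bound hk ha hb
  refine ⟨hadm.mem_regularMeasures hμ' hν', fun m hm =>
    (moment_kernelProduct_le hadm hμ' hν' m).trans_lt (absMoment_lt_top ha hb
      (momentSpace_mono κ ?_ hμ) (momentSpace_mono κ ?_ hν))⟩ <;>
  · rw [Nat.cast_add]
    exact add_le_add_left hm _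

end Moments

end WeylMeasure

namespace WeylMeasure

/-! ### The bracket kernel and its dependence on `ħ`. -/

section Bracket

variable {E : Type*} [AddCommGroup E] [Module ℝ E]

/-- The kernel `(2/ħ) sin(ħ σ(f,g) / 2)` of the bracket `{·,·}_ħ`, equal to `σ(f,g)` for `ħ = 0`. -/
noncomputable def bracketKernel (σ : E →ₗ[ℝ] E →ₗ[ℝ] ℝ) (ħ : ℝ) (f g : E) : ℂ :=
  ((σ f g * Real.sinc (ħ * σ f g / 2) : ℝ) : ℂ)

theorem bracketKernel_zero (σ : E →ₗ[ℝ] E →ₗ[ℝ] ℝ) :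
    bracketKernel σ 0 = fun f g => (σ f g : ℂ) := by
  ext f g
  simp [bracketKernel]

theorem norm_bracketKernel_le (σ : E →ₗ[ℝ] E →ₗ[ℝ] ℝ) (ħ : ℝ) (f g : E) :
    ‖bracketKernel σ ħ f g‖ ≤ |σ f g| := by
  rw [bracketKernel, Complex.norm_real, norm_mul, Real.norm_eq_abs, Real.norm_eq_abs]
  exact mul_le_of_le_one_right (abs_nonneg _) (Real.abs_sinc_le_one _)

theorem norm_twistKernel (σ : E →ₗ[ℝ] E →ₗ[ℝ] ℝ) (ħ : ℝ) (f g : E) :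
    ‖twistKernel σ ħ f g‖ = 1 := by
  have : -(Complex.I / 2) * ħ * σ f g = ((-(ħ * σ f g / 2) : ℝ) : ℂ) * Complex.I := by
    push_cast; ring
  rw [twistKernel, this, Complex.norm_exp_ofReal_mul_I]

theorem twistKernel_zero (σ : E →ₗ[ℝ] E →ₗ[ℝ] ℝ) : twistKernel σ 0 = fun _ _ => 1 := by
  ext f g
  simp [twistKernel]

/-- With `y = ħ σ(f,g) / 2`, antisymmetry turns the difference into `exp(-iy) - exp(iy) = -2i sin
y`; the factor `i/ħ` leaves `(2/ħ) sin y = σ(f,g) sinc y`. -/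
theorem bracketKernel_eq (σ : E →ₗ[ℝ] E →ₗ[ℝ] ℝ) (hσ : ∀ f g, σ f g = -σ g f) {ħ : ℝ}
    (hħ : ħ ≠ 0) (f g : E) :
    Complex.I / ħ * (twistKernel σ ħ f g - twistKernel σ ħ g f) = bracketKernel σ ħ f g := by
  have hħ' : (ħ : ℂ) ≠ 0 := Complex.ofReal_ne_zero.2 hħ
  have h1 : -(Complex.I / 2) * ħ * σ f g = -(((ħ * σ f g / 2 : ℝ) : ℂ) * Complex.I) := by
    push_cast; ring
  have h2 : -(Complex.I / 2) * ħ * ((-σ f g : ℝ) : ℂ) = ((ħ * σ f g / 2 : ℝ) : ℂ) * Complex.I := by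
    push_cast; ring
  rw [twistKernel, twistKernel, hσ g f, h1, h2, bracketKernel]
  set y : ℝ := ħ * σ f g / 2 with hy
  have h3 : Complex.exp (-((y : ℂ) * Complex.I)) - Complex.exp ((y : ℂ) * Complex.I) =
      -(2 * Complex.I * Complex.sin y) := by
    rw [Complex.sin, ← neg_mul]
    ring_nf
    rw [Complex.I_sq]
    ring
  rw [h3]
  have h4 : Complex.I / ħ * -(2 * Complex.I * Complex.sin y) = 2 / ħ * Complex.sin y := by
    have : Complex.I / ħ * -(2 * Complex.I * Complex.sin y) =
      -(Complex.I ^ 2) * (2 / ħ * Complex.sin y) := by ring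
    rw [this, Complex.I_sq]
    ring
  rw [h4]
  by_cases h0 : σ f g = 0
  · simp [hy, h0]
  · have hy0 : y ≠ 0 := by rw [hy]; positivity
    rw [Real.sinc_of_ne_zero hy0]
    have h5 : σ f g * (Real.sin y / y) = 2 / ħ * Real.sin y := by
      rw [hy]; field_simp
    rw [h5]
    push_cast
    ring

variable [TopologicalSpace E] [IsTopologicalAddGroup E] [HasContinuousSeminorms E]
  {σ : E →ₗ[ℝ] E →ₗ[ℝ] ℝ} {ς : Seminorm ℝ E} {c : ℝ}

theorem continuous_bracketKernel (h : ∀ f g, |σ f g| ≤ c * ς f * ς g) :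
    Continuous fun p : ℝ × E × E => bracketKernel σ p.1 p.2.1 p.2.2 := by
  have hσ : Continuous fun p : ℝ × E × E => σ p.2.1 p.2.2 :=
    (continuous_bilin_of_hasContinuousSeminorms σ ς c h).comp continuous_snd
  exact Complex.continuous_ofReal.comp
    (hσ.mul (Real.continuous_sinc.comp ((continuous_fst.mul hσ).div_const 2)))

theorem continuous_bracketKernel_apply (h : ∀ f g, |σ f g| ≤ c * ς f * ς g) (ħ : ℝ) :
    Continuous fun p : E × E => bracketKernel σ ħ p.1 p.2 :=
  (continuous_bracketKernel h).comp (Continuous.prodMk_right ħ)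

theorem continuous_twistKernel (h : ∀ f g, |σ f g| ≤ c * ς f * ς g) (ħ : ℝ) :
    Continuous fun p : E × E => twistKernel σ ħ p.1 p.2 := by
  have hσ := continuous_bilin_of_hasContinuousSeminorms σ ς c h
  unfold twistKernel
  fun_prop

/-- The bound does not depend on `ħ`, because `|sinc| ≤ 1`. Both the bilinear estimate and the
dominated convergence below rest on this uniformity. -/
theorem bracketKernel_bound (h : ∀ f g, |σ f g| ≤ c * ς f * ς g) (ħ : ℝ) (f g : E) :
    ‖bracketKernel σ ħ f g‖ ≤ c * (ς f ^ 1 * ς g ^ 1) :=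
  (norm_bracketKernel_le σ ħ f g).trans ((h f g).trans_eq (by ring))

theorem twistKernel_bound (κ : Seminorm ℝ E) (ħ : ℝ) (f g : E) :
    ‖twistKernel σ ħ f g‖ ≤ 1 * (κ f ^ 0 * κ g ^ 0) := by
  rw [norm_twistKernel]; simp

variable [ContinuousSMul ℝ E] [T2Space E] [MeasurableSpace E] [BorelSpace E]

theorem isAdmissible_bracketKernel (hc : 0 ≤ c) (h : ∀ f g, |σ f g| ≤ c * ς f * ς g) (ħ : ℝ) :
    IsAdmissible ς 1 (bracketKernel σ ħ) :=
  isAdmissible_of_bound (continuous_bracketKernel_apply h ħ) hc (bracketKernel_bound h ħ)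

theorem isAdmissible_sigma (hc : 0 ≤ c) (h : ∀ f g, |σ f g| ≤ c * ς f * ς g) :
    IsAdmissible ς 1 fun f g => (σ f g : ℂ) :=
  bracketKernel_zero σ ▸ isAdmissible_bracketKernel hc h 0

theorem isAdmissible_twistKernel (h : ∀ f g, |σ f g| ≤ c * ς f * ς g) (κ : Seminorm ℝ E) (ħ : ℝ) :
    IsAdmissible κ 0 (twistKernel σ ħ) :=
  isAdmissible_of_bound (continuous_twistKernel h ħ) zero_le_one (twistKernel_bound κ ħ)

theorem bracket_zero (μ ν : ComplexMeasure E) : bracket σ 0 μ ν = poissonBracket σ μ ν :=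
  if_pos rfl

theorem bracket_eq_kernelProduct (hσ : ∀ f g, σ f g = -σ g f) (hc : 0 ≤ c)
    (h : ∀ f g, |σ f g| ≤ c * ς f * ς g) (ħ : ℝ)
    {μ ν : ComplexMeasure E} (hμ : μ ∈ momentSpace ς 1) (hν : ν ∈ momentSpace ς 1) :
    bracket σ ħ μ ν = kernelProduct (bracketKernel σ ħ) μ ν := by
  by_cases hħ : ħ = 0
  · subst hħ
    rw [bracket_zero, bracketKernel_zero, poissonBracket]
  · rw [bracket, if_neg hħ, twistedConv, twistedConv]
    have hμ' : μ ∈ momentSpace ς ((0 : ℕ) : ℕ∞) := momentSpace_mono ς zero_le_one hμ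
    have hν' : ν ∈ momentSpace ς ((0 : ℕ) : ℕ∞) := momentSpace_mono ς zero_le_one hν
    have htw := isAdmissible_twistKernel h ς ħ
    -- The reversed product is rewritten as a product of `μ` and `ν` in this order with the flipped
    -- kernel, so the commutator is a difference of two densities on one space.
    rw [htw.kernelProduct_swap hν' hμ']
    refine (((htw.isImage hμ' hν').2.sub (htw.flip.isImage hμ' hν').2).smul
      (Complex.I / ħ)).eq_of_eq ((isAdmissible_bracketKernel hc h ħ).isImage
        (i := 1) (by exact_mod_cast hμ) (by exact_mod_cast hν)).2 (fun p => ?_) fun p => rfl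
    rw [← bracketKernel_eq σ hσ hħ]
    ring

theorem kernelProduct_sub {k l : E → E → ℂ} {i : ℕ} (hk : IsAdmissible ς i k)
    (hl : IsAdmissible ς i l) (hkl : IsAdmissible ς i fun f g => k f g - l f g)
    {μ ν : ComplexMeasure E} (hμ : μ ∈ momentSpace ς i) (hν : ν ∈ momentSpace ς i) :
    kernelProduct k μ ν - kernelProduct l μ ν = kernelProduct (fun f g => k f g - l f g) μ ν :=
  ((hk.isImage hμ hν).2.sub (hl.isImage hμ hν).2).eq_of_eq (hkl.isImage hμ hν).2
    (fun p => by ring) fun p => rfl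

theorem kernelProduct_sub_sub {k l : E → E → ℂ} {i : ℕ} (hk : IsAdmissible ς i k)
    (hl : IsAdmissible ς i l) (hkl : IsAdmissible ς i fun f g => k f g - l f g)
    {μ ν μ₀ ν₀ : ComplexMeasure E} (hμ : μ ∈ momentSpace ς i) (hν : ν ∈ momentSpace ς i)
    (hμ₀ : μ₀ ∈ momentSpace ς i) (hν₀ : ν₀ ∈ momentSpace ς i) :
    kernelProduct k μ ν - kernelProduct l μ₀ ν₀ = kernelProduct k (μ - μ₀) ν +
      kernelProduct k μ₀ (ν - ν₀) + kernelProduct (fun f g => k f g - l f g) μ₀ ν₀ := by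
  have h1 := hk.kernelProduct_add_left (sub_mem_momentSpace hμ hμ₀) hμ₀ hν
  have h2 := hk.kernelProduct_add_right hμ₀ (sub_mem_momentSpace hν hν₀) hν₀
  rw [sub_add_cancel] at h1 h2
  rw [← kernelProduct_sub hk hl hkl hμ₀ hν₀, h1, h2]
  abel

/-- Dominated convergence with majorant `2c ς(f) ς(g) ς(f+g)^m`, integrable since the moments up to
order `m + 1` are finite. -/
theorem tendsto_absMoment_bracketKernel (hc : 0 ≤ c) (h : ∀ f g, |σ f g| ≤ c * ς f * ς g)
    {m : ℕ} {μ ν : ComplexMeasure E} (hμ : μ ∈ momentSpace ς (m + 1 : ℕ))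
    (hν : ν ∈ momentSpace ς (m + 1 : ℕ)) (ħ₀ : ℝ) :
    Filter.Tendsto (fun ħ => absMoment ς m
      (fun f g => bracketKernel σ ħ f g - bracketKernel σ ħ₀ f g) μ ν) (𝓝 ħ₀) (𝓝 0) := by
  have hς := ς.continuous_of_hasContinuousSeminorms
  have hcμ := mem_regularMeasures_iff.1 hμ.1
  have hcν := mem_regularMeasures_iff.1 hν.1
  have hbd : ∀ ħ f g, ‖bracketKernel σ ħ f g - bracketKernel σ ħ₀ f g‖ ≤
      2 * c * (ς f ^ 1 * ς g ^ 1) := fun ħ f g =>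
    (norm_sub_le _ _).trans ((add_le_add (bracketKernel_bound h ħ f g)
      (bracketKernel_bound h ħ₀ f g)).trans_eq (by ring))
  let bk : E → E → ℂ := fun f g => ((2 * c * (ς f ^ 1 * ς g ^ 1) : ℝ) : ℂ)
  have hbk : ∀ f g, ‖bk f g‖ = 2 * c * (ς f ^ 1 * ς g ^ 1) := fun f g => by
    have h1 := apply_nonneg ς f
    have h2 := apply_nonneg ς g
    simp only [bk, Complex.norm_real]
    exact Real.norm_of_nonneg (by positivity)
  have hzero : ∫⁻ _ : E × E, (0 : ℝ≥0∞) ∂μ.variation.prod ν.variation = 0 := lintegral_zero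
  rw [← hzero]
  refine tendsto_lintegral_filter_of_dominated_convergence'
    (fun p => ‖bk p.1 p.2‖ₑ * ENNReal.ofReal (ς (p.1 + p.2) ^ m))
    (Filter.Eventually.of_forall fun ħ => ?_)
    (Filter.Eventually.of_forall fun ħ => Filter.Eventually.of_forall fun p => ?_)
    (absMoment_lt_top (k := bk) (by positivity) (fun f g => (hbk f g).le) hμ hν).ne
    (Filter.Eventually.of_forall fun p => ?_)
  · have h1 := aemeasurable_prod_of_continuous ((continuous_bracketKernel_apply h ħ).sub
      (continuous_bracketKernel_apply h ħ₀)) hcμ hcν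
    have h2 := aemeasurable_prod_of_continuous
      (by fun_prop : Continuous fun p : E × E => ς (p.1 + p.2) ^ m) hcμ hcν
    exact h1.enorm.mul h2.ennreal_ofReal
  · refine mul_le_mul_left ?_ _
    rw [← ofReal_norm, ← ofReal_norm, hbk]
    exact ENNReal.ofReal_le_ofReal (hbd ħ p.1 p.2)
  · have hcont : Continuous fun ħ => bracketKernel σ ħ p.1 p.2 - bracketKernel σ ħ₀ p.1 p.2 :=
      ((continuous_bracketKernel h).comp (Continuous.prodMk_left p)).sub continuous_const
    have h1 : Filter.Tendsto (fun ħ => ‖bracketKernel σ ħ p.1 p.2 - bracketKernel σ ħ₀ p.1 p.2‖ₑ)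
        (𝓝 ħ₀) (𝓝 0) := by
      have := hcont.enorm.tendsto ħ₀
      simpa using this
    have h2 := ENNReal.Tendsto.mul_const (b := ENNReal.ofReal (ς (p.1 + p.2) ^ m)) h1
      (Or.inr ENNReal.ofReal_ne_top)
    rwa [zero_mul] at h2

/-- The difference of brackets splits into a change of `μ`, a change of `ν` and a change of the
kernel at the fixed `μ₀`, `ν₀`. The first two are small by the bilinear estimate, uniform in `ħ`;
the last by dominated convergence. -/
theorem tendsto_momentNorm_bracket (hσ : ∀ f g, σ f g = -σ g f) (hc : 0 ≤ c)
    (h : ∀ f g, |σ f g| ≤ c * ς f * ς g) {m : ℕ} {ι : Type*} {l : Filter ι} {ħ : ι → ℝ}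
    {μ ν : ι → ComplexMeasure E} {ħ₀ : ℝ} {μ₀ ν₀ : ComplexMeasure E}
    (hμ₀ : μ₀ ∈ momentSpace ς (m + 1 : ℕ)) (hν₀ : ν₀ ∈ momentSpace ς (m + 1 : ℕ))
    (hμ : ∀ᶠ x in l, μ x ∈ momentSpace ς (m + 1 : ℕ))
    (hν : ∀ᶠ x in l, ν x ∈ momentSpace ς (m + 1 : ℕ)) (hħ : Filter.Tendsto ħ l (𝓝 ħ₀))
    (hμl : Filter.Tendsto (fun x => momentNorm ς (m + 1) (μ x - μ₀)) l (𝓝 0))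
    (hνl : Filter.Tendsto (fun x => momentNorm ς (m + 1) (ν x - ν₀)) l (𝓝 0)) :
    Filter.Tendsto (fun x => momentNorm ς m (bracket σ (ħ x) (μ x) (ν x) - bracket σ ħ₀ μ₀ ν₀))
      l (𝓝 0) := by
  set C : ℝ≥0∞ := ENNReal.ofReal c * (binomConst m : ℝ≥0∞) with hC
  have hCtop : C ≠ ∞ := ENNReal.mul_ne_top ENNReal.ofReal_ne_top (ENNReal.natCast_ne_top _)
  have hNμ₀ := (momentNorm_lt_top hμ₀).ne
  have hNν₀ := (momentNorm_lt_top hν₀).ne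
  have h1le : ∀ {τ : ComplexMeasure E}, τ ∈ momentSpace ς (m + 1 : ℕ) →
      τ ∈ momentSpace ς ((1 : ℕ) : ℕ∞) := fun hτ =>
    momentSpace_mono ς (Nat.cast_le.2 (Nat.le_add_left 1 m)) hτ
  have hbound : Filter.Tendsto (fun x => C * momentNorm ς (m + 1) (μ x - μ₀) *
      (momentNorm ς (m + 1) (ν x - ν₀) + momentNorm ς (m + 1) ν₀) +
      C * momentNorm ς (m + 1) μ₀ * momentNorm ς (m + 1) (ν x - ν₀) +
      ∑ j ∈ Finset.range (m + 1), absMoment ς j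
        (fun f g => bracketKernel σ (ħ x) f g - bracketKernel σ ħ₀ f g) μ₀ ν₀) l (𝓝 0) := by
    have t1 := ENNReal.Tendsto.mul (ENNReal.Tendsto.const_mul (a := C) hμl (Or.inr hCtop))
      (Or.inr (by simpa using hNν₀)) (hνl.add_const (momentNorm ς (m + 1) ν₀))
      (Or.inr (by simp))
    have t2 := ENNReal.Tendsto.const_mul (a := C * momentNorm ς (m + 1) μ₀) hνl
      (Or.inr (ENNReal.mul_ne_top hCtop hNμ₀))
    have t3 : Filter.Tendsto (fun x => ∑ j ∈ Finset.range (m + 1), absMoment ς j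
        (fun f g => bracketKernel σ (ħ x) f g - bracketKernel σ ħ₀ f g) μ₀ ν₀) l
        (𝓝 (∑ _j ∈ Finset.range (m + 1), 0)) := by
      refine tendsto_finsetSum _ fun j hj => ?_
      have hjm : ((j + 1 : ℕ) : ℕ∞) ≤ (m + 1 : ℕ) :=
        Nat.cast_le.2 (Nat.succ_le_of_lt (Finset.mem_range.1 hj))
      exact (tendsto_absMoment_bracketKernel hc h (momentSpace_mono ς hjm hμ₀)
        (momentSpace_mono ς hjm hν₀) ħ₀).comp hħ
    have := (t1.add t2).add t3
    simpa using this
  refine tendsto_of_tendsto_of_tendsto_of_le_of_le' tendsto_const_nhds hbound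
    (Filter.Eventually.of_forall fun _ => bot_le) ?_
  filter_upwards [hμ, hν] with x hx hy
  have hk := isAdmissible_bracketKernel hc h (ħ x)
  have hl := isAdmissible_bracketKernel hc h ħ₀
  have hkl : IsAdmissible ς 1 fun f g => bracketKernel σ (ħ x) f g - bracketKernel σ ħ₀ f g :=
    isAdmissible_of_bound (a := c + c) ((continuous_bracketKernel_apply h (ħ x)).sub
      (continuous_bracketKernel_apply h ħ₀)) (by positivity) fun f g =>
        (norm_sub_le _ _).trans ((add_le_add (bracketKernel_bound h (ħ x) f g)
          (bracketKernel_bound h ħ₀ f g)).trans_eq (by ring))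
  have hle : ∀ {τ τ' : ComplexMeasure E}, τ ∈ momentSpace ς (m + 1 : ℕ) →
      τ' ∈ momentSpace ς (m + 1 : ℕ) → momentNorm ς m (kernelProduct (bracketKernel σ (ħ x)) τ τ') ≤
        C * momentNorm ς (m + 1) τ * momentNorm ς (m + 1) τ' := fun hτ hτ' =>
    momentNorm_kernelProduct_le (continuous_bracketKernel_apply h (ħ x)) hc
      (bracketKernel_bound h (ħ x)) (h1le hτ) (h1le hτ') m
  rw [bracket_eq_kernelProduct hσ hc h _ (h1le hx) (h1le hy),
    bracket_eq_kernelProduct hσ hc h _ (h1le hμ₀) (h1le hν₀),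
    kernelProduct_sub_sub hk hl hkl (h1le hx) (h1le hy) (h1le hμ₀) (h1le hν₀)]
  refine (momentNorm_add_le _ _ _ _).trans (add_le_add ((momentNorm_add_le _ _ _ _).trans
    (add_le_add ?_ (hle hμ₀ (sub_mem_momentSpace hy hν₀)))) ?_)
  · refine (hle (sub_mem_momentSpace hx hμ₀) hy).trans ?_
    gcongr
    -- The norm of `ν x` is replaced by a quantity with a known finite limit.
    have := momentNorm_add_le ς (m + 1) (ν x - ν₀) ν₀
    rwa [sub_add_cancel] at this
  · exact Finset.sum_le_sum fun j _ => moment_kernelProduct_le hkl (h1le hμ₀) (h1le hν₀) j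

end Bracket

end WeylMeasure

namespace WeylMeasure

/-! ### Joint continuity in the moment topologies. -/

section Topology

variable {E : Type*} [AddCommGroup E] [Module ℝ E] [MeasurableSpace E]

theorem tendsto_momentEDist_iff {κ : Seminorm ℝ E} {n : ℕ} {ι : Type*} {l : Filter ι}
    {F : ι → ComplexMeasure E} {μ : ComplexMeasure E} :
    Filter.Tendsto F l (@nhds _ (momentEDist κ n).toUniformSpace.toTopologicalSpace μ) ↔
      Filter.Tendsto (fun x => momentNorm κ n (F x - μ)) l (𝓝 0) := by
  let : PseudoEMetricSpace (ComplexMeasure E) := momentEDist κ n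
  have h : Filter.Tendsto F l (𝓝 μ) ↔ ∀ ε > 0, ∀ᶠ x in l, edist (F x) μ < ε :=
    EMetric.tendsto_nhds
  refine h.trans ⟨fun h => ENNReal.tendsto_nhds_zero.2 fun ε hε => ?_, fun h ε hε => ?_⟩
  · filter_upwards [h ε hε] with x hx using hx.le
  · exact h.eventually (gt_mem_nhds hε)

/-- The norms increase with `m`, so for finite `n` the top one controls all; this gives finite and
infinite `n` the same criterion. -/
theorem tendsto_momentTopology_iff {κ : Seminorm ℝ E} {n : ℕ∞} {ι : Type*} {l : Filter ι}
    {F : ι → ComplexMeasure E} {μ : ComplexMeasure E} :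
    Filter.Tendsto F l (@nhds _ (momentTopology κ n) μ) ↔
      ∀ m : ℕ, (m : ℕ∞) ≤ n → Filter.Tendsto (fun x => momentNorm κ m (F x - μ)) l (𝓝 0) := by
  induction n using ENat.recTopCoe with
  | top =>
    change Filter.Tendsto F l (@nhds _ (⨅ m : ℕ,
      (momentEDist κ m).toUniformSpace.toTopologicalSpace) μ) ↔ _
    simp only [nhds_iInf, Filter.tendsto_iInf, tendsto_momentEDist_iff, le_top, true_imp_iff]
  | coe n =>
    change Filter.Tendsto F l (@nhds _ (momentEDist κ n).toUniformSpace.toTopologicalSpace μ) ↔ _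
    rw [tendsto_momentEDist_iff]
    refine ⟨fun h m hm => ?_, fun h => h n le_rfl⟩
    exact tendsto_of_tendsto_of_tendsto_of_le_of_le tendsto_const_nhds h (fun _ => bot_le)
      fun x => momentNorm_mono κ (Nat.cast_le.1 hm) _

theorem natCast_add_one_le_of_le_sub_one {m : ℕ} {n : ℕ∞} (hn : 1 ≤ n) (h : (m : ℕ∞) ≤ n - 1) :
    ((m + 1 : ℕ) : ℕ∞) ≤ n := by
  rw [Nat.cast_add, Nat.cast_one]
  exact (add_le_add_left h 1).trans_eq (tsub_add_cancel_of_le hn)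

variable [TopologicalSpace E] [IsTopologicalAddGroup E] [HasContinuousSeminorms E]
  [ContinuousSMul ℝ E] [T2Space E] [BorelSpace E]
  {σ : E →ₗ[ℝ] E →ₗ[ℝ] ℝ} {ς : Seminorm ℝ E} {c : ℝ}

theorem bracket_mem_momentSpace (hσ : ∀ f g, σ f g = -σ g f) (hc : 0 ≤ c)
    (h : ∀ f g, |σ f g| ≤ c * ς f * ς g) {n : ℕ∞} (hn : 1 ≤ n) (ħ : ℝ) {μ ν : ComplexMeasure E}
    (hμ : μ ∈ momentSpace ς n) (hν : ν ∈ momentSpace ς n) :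
    bracket σ ħ μ ν ∈ momentSpace ς (n - 1) := by
  rw [bracket_eq_kernelProduct hσ hc h ħ (momentSpace_mono ς hn hμ) (momentSpace_mono ς hn hν)]
  have hcast : n - 1 + ((1 : ℕ) : ℕ∞) = n := by
    rw [Nat.cast_one]; exact tsub_add_cancel_of_le hn
  exact kernelProduct_mem_momentSpace (i := 1) (continuous_bracketKernel_apply h ħ) hc
    (bracketKernel_bound h ħ) (by rwa [hcast]) (by rwa [hcast])

theorem continuousOn_bracket (hσ : ∀ f g, σ f g = -σ g f) (hc : 0 ≤ c)
    (h : ∀ f g, |σ f g| ≤ c * ς f * ς g) {n : ℕ∞} (hn : 1 ≤ n) :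
    @ContinuousOn (ℝ × ComplexMeasure E × ComplexMeasure E) (ComplexMeasure E)
      (@instTopologicalSpaceProd _ _ inferInstance
        (@instTopologicalSpaceProd _ _ (momentTopology ς n) (momentTopology ς n)))
      (momentTopology ς (n - 1)) (fun p => bracket σ p.1 p.2.1 p.2.2)
      (univ ×ˢ momentSpace ς n ×ˢ momentSpace ς n) := by
  rintro ⟨ħ₀, μ₀, ν₀⟩ ⟨-, hμ₀, hν₀⟩
  refine tendsto_momentTopology_iff.2 fun m hm => ?_
  have hmn := natCast_add_one_le_of_le_sub_one hn hm
  have hs : ∀ᶠ p : ℝ × ComplexMeasure E × ComplexMeasure E in @nhdsWithin _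
      (@instTopologicalSpaceProd _ _ inferInstance
        (@instTopologicalSpaceProd _ _ (momentTopology ς n) (momentTopology ς n)))
      (ħ₀, μ₀, ν₀) (univ ×ˢ momentSpace ς n ×ˢ momentSpace ς n),
      p ∈ univ ×ˢ momentSpace ς n ×ˢ momentSpace ς n := @self_mem_nhdsWithin _
        (@instTopologicalSpaceProd _ _ inferInstance
        (@instTopologicalSpaceProd _ _ (momentTopology ς n) (momentTopology ς n))) _ _
  refine tendsto_momentNorm_bracket hσ hc h (momentSpace_mono ς hmn hμ₀)
    (momentSpace_mono ς hmn hν₀) (hs.mono fun p hp => momentSpace_mono ς hmn hp.2.1)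
    (hs.mono fun p hp => momentSpace_mono ς hmn hp.2.2) ?_ ?_ ?_
  · let := momentTopology (E := E) ς n
    exact (continuous_fst.tendsto _).mono_left nhdsWithin_le_nhds
  · refine tendsto_momentTopology_iff.1 ?_ (m + 1) hmn
    let := momentTopology (E := E) ς n
    exact ((continuous_fst.comp continuous_snd).tendsto _).mono_left nhdsWithin_le_nhds
  · refine tendsto_momentTopology_iff.1 ?_ (m + 1) hmn
    let := momentTopology (E := E) ς n
    exact ((continuous_snd.comp continuous_snd).tendsto _).mono_left nhdsWithin_le_nhds

theorem continuousOn_poissonBracket (hσ : ∀ f g, σ f g = -σ g f) (hc : 0 ≤ c)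
    (h : ∀ f g, |σ f g| ≤ c * ς f * ς g) :
    @ContinuousOn (ComplexMeasure E × ComplexMeasure E) (ComplexMeasure E)
      (@instTopologicalSpaceProd _ _ (momentTopology ς ⊤) (momentTopology ς ⊤))
      (momentTopology ς ⊤) (fun p => poissonBracket σ p.1 p.2)
      (momentSpace ς ⊤ ×ˢ momentSpace ς ⊤) := by
  have hb := continuousOn_bracket (n := ⊤) hσ hc h le_top
  simp only [← bracket_zero]
  let := momentTopology (E := E) ς ⊤
  have hc : Continuous fun p : ComplexMeasure E × ComplexMeasure E => ((0 : ℝ), p.1, p.2) :=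
    continuous_const.prodMk (continuous_fst.prodMk continuous_snd)
  exact ContinuousOn.comp hb hc.continuousOn fun p hp => ⟨mem_univ _, hp.1, hp.2⟩

end Topology

end WeylMeasure

namespace WeylMeasure

theorem IsImage.cyclic {X Y : Type*} [MeasurableSpace X] [MeasurableSpace Y]
    {ρ : ComplexMeasure Y} {P Q R : Measure X} [SFinite P] [SFinite Q] [SFinite R]
    {H : X × X × X → ℂ} {T : X × X × X → Y} (h : IsImage ρ (Q.prod (R.prod P)) H T) :
    IsImage ρ (P.prod (Q.prod R)) (fun p => H (p.2.1, p.2.2, p.1))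
      (fun p => T (p.2.1, p.2.2, p.1)) :=
  h.comp_equiv (cyclicEquiv X) (measurePreserving_cyclicEquiv P Q R)

theorem isImage_zero {X Ω : Type*} [MeasurableSpace X] [MeasurableSpace Ω] {P : Measure Ω}
    {T : Ω → X} (hT : AEMeasurable T P) : IsImage (0 : ComplexMeasure X) P (fun _ => 0) T :=
  ⟨integrable_zero _ _ _, hT, fun Λ _ => by simp⟩

section Involution

variable {E : Type*} [AddCommGroup E] [Module ℝ E] [MeasurableSpace E] [MeasurableNeg E]

theorem involution_involution (μ : ComplexMeasure E) : involution (involution μ) = μ := by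
  ext Λ hΛ : 1
  rw [involution_apply _ hΛ, involution_apply _ hΛ.neg, neg_neg, Complex.conj_conj]

theorem involution_add (μ ν : ComplexMeasure E) :
    involution (μ + ν) = involution μ + involution ν := by
  ext Λ hΛ : 1
  rw [_root_.add_apply, involution_apply _ hΛ, involution_apply _ hΛ, involution_apply _ hΛ,
    _root_.add_apply, map_add]

theorem involution_smul (z : ℂ) (μ : ComplexMeasure E) :
    involution (z • μ) = conj z • involution μ := by
  ext Λ hΛ : 1
  rw [_root_.smul_apply, involution_apply _ hΛ, involution_apply _ hΛ, _root_.smul_apply,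
    smul_eq_mul, smul_eq_mul, map_mul]

end Involution

/-! ### The algebraic identities. -/

section Algebra

variable {E : Type*} [AddCommGroup E] [Module ℝ E] [MeasurableSpace E] [TopologicalSpace E]
  [IsTopologicalAddGroup E] [HasContinuousSeminorms E] [ContinuousSMul ℝ E] [T2Space E]
  [BorelSpace E] {σ : E →ₗ[ℝ] E →ₗ[ℝ] ℝ} {ς : Seminorm ℝ E} {c : ℝ}

theorem twistedConv_mem_momentSpace (h : ∀ f g, |σ f g| ≤ c * ς f * ς g) (κ : Seminorm ℝ E)
    {n : ℕ∞} (ħ : ℝ) {μ ν : ComplexMeasure E} (hμ : μ ∈ momentSpace κ n)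
    (hν : ν ∈ momentSpace κ n) : twistedConv σ ħ μ ν ∈ momentSpace κ n :=
  kernelProduct_mem_momentSpace (i := 0) (continuous_twistKernel h ħ) zero_le_one
    (twistKernel_bound κ ħ) (by simpa using hμ) (by simpa using hν)

theorem poissonBracket_mem_momentSpace_top (hc : 0 ≤ c) (h : ∀ f g, |σ f g| ≤ c * ς f * ς g)
    {μ ν : ComplexMeasure E} (hμ : μ ∈ momentSpace ς ⊤) (hν : ν ∈ momentSpace ς ⊤) :
    poissonBracket σ μ ν ∈ momentSpace ς ⊤ := by
  have hk := continuous_bracketKernel_apply h 0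
  have hb := bracketKernel_bound h 0
  rw [bracketKernel_zero] at hk hb
  exact kernelProduct_mem_momentSpace (i := 1) hk hc hb (by simpa using hμ) (by simpa using hν)

theorem mem_momentSpace_natCast {μ : ComplexMeasure E} (hμ : μ ∈ momentSpace ς ⊤) (i : ℕ) :
    μ ∈ momentSpace ς i := momentSpace_mono ς le_top hμ

theorem twistedConv_zero_comm (h : ∀ f g, |σ f g| ≤ c * ς f * ς g) {μ ν : ComplexMeasure E}
    (hμ : μ ∈ momentSpace ς ⊤) (hν : ν ∈ momentSpace ς ⊤) :
    twistedConv σ 0 μ ν = twistedConv σ 0 ν μ := by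
  rw [twistedConv, (isAdmissible_twistKernel h ς 0).kernelProduct_swap
    (mem_momentSpace_natCast hμ 0) (mem_momentSpace_natCast hν 0), twistKernel_zero, twistedConv,
    twistKernel_zero]

/-- Commutativity turns `(μν)ρ` into `ρ(μν)`, nested to the right as `isImage_triple` requires; two
rotations restore the order of the factors. -/
theorem twistedConv_zero_assoc (h : ∀ f g, |σ f g| ≤ c * ς f * ς g) {μ ν ρ : ComplexMeasure E}
    (hμ : μ ∈ momentSpace ς ⊤) (hν : ν ∈ momentSpace ς ⊤) (hρ : ρ ∈ momentSpace ς ⊤) :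
    twistedConv σ 0 (twistedConv σ 0 μ ν) ρ = twistedConv σ 0 μ (twistedConv σ 0 ν ρ) := by
  have hk := isAdmissible_twistKernel h ς 0
  rw [twistedConv_zero_comm h (twistedConv_mem_momentSpace h ς 0 hμ hν) hρ]
  refine (hk.isImage_triple hk hρ hμ hν).cyclic.cyclic.eq_of_eq (hk.isImage_triple hk hμ hν hρ)
    (fun p => ?_) fun p => ?_
  · simp only [twistKernel_zero]; ring
  · simp only; abel

theorem poissonBracket_anticomm (hσ : ∀ f g, σ f g = -σ g f) (hc : 0 ≤ c)
    (h : ∀ f g, |σ f g| ≤ c * ς f * ς g) {μ ν : ComplexMeasure E}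
    (hμ : μ ∈ momentSpace ς ⊤) (hν : ν ∈ momentSpace ς ⊤) :
    poissonBracket σ μ ν = -poissonBracket σ ν μ := by
  have hk := isAdmissible_sigma hc h
  have hμ' := mem_momentSpace_natCast hμ 1
  have hν' := mem_momentSpace_natCast hν 1
  rw [poissonBracket, hk.kernelProduct_swap hμ' hν']
  refine (hk.flip.isImage hν' hμ').2.eq_of_eq (hk.isImage hν' hμ').2.neg (fun p => ?_) fun p => rfl
  rw [hσ p.2 p.1]
  push_cast
  ring

/-- The three terms are rotations of each other. On the common triple product the sum of densities
contains the cyclic sum of `σ(f,g+k) σ(g,k)`, which vanishes by bilinearity and antisymmetry. -/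
theorem poissonBracket_jacobi (hσ : ∀ f g, σ f g = -σ g f) (hc : 0 ≤ c)
    (h : ∀ f g, |σ f g| ≤ c * ς f * ς g) {μ ν ρ : ComplexMeasure E}
    (hμ : μ ∈ momentSpace ς ⊤) (hν : ν ∈ momentSpace ς ⊤) (hρ : ρ ∈ momentSpace ς ⊤) :
    poissonBracket σ μ (poissonBracket σ ν ρ) + poissonBracket σ ν (poissonBracket σ ρ μ) +
      poissonBracket σ ρ (poissonBracket σ μ ν) = 0 := by
  have hk := isAdmissible_sigma hc h
  have h1 := hk.isImage_triple hk hμ hν hρ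
  have h2 := ((hk.isImage_triple hk hν hρ hμ).cyclic).congr (fun _ => rfl)
    (T' := fun p => p.1 + (p.2.1 + p.2.2)) fun p => by simp only; abel
  have h3 := ((hk.isImage_triple hk hρ hμ hν).cyclic.cyclic).congr (fun _ => rfl)
    (T' := fun p => p.1 + (p.2.1 + p.2.2)) fun p => by simp only; abel
  refine ((h1.add h2).add h3).eq_of_eq (isImage_zero h1.aemeasurable) (fun p => ?_) fun p => rfl
  simp only [map_add]
  rw [hσ p.2.2 p.1, hσ p.2.1 p.1, hσ p.2.2 p.2.1]
  push_cast
  ring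

/-- On the triple product this is the additivity `σ(f,g+k) = σ(f,g) + σ(f,k)`. -/
theorem poissonBracket_leibniz (hc : 0 ≤ c)
    (h : ∀ f g, |σ f g| ≤ c * ς f * ς g) {μ ν ρ : ComplexMeasure E}
    (hμ : μ ∈ momentSpace ς ⊤) (hν : ν ∈ momentSpace ς ⊤) (hρ : ρ ∈ momentSpace ς ⊤) :
    poissonBracket σ μ (twistedConv σ 0 ν ρ) =
      twistedConv σ 0 (poissonBracket σ μ ν) ρ + twistedConv σ 0 ν (poissonBracket σ μ ρ) := by
  have hk := isAdmissible_sigma hc h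
  have ht := isAdmissible_twistKernel h ς 0
  have h1 := hk.isImage_triple ht hμ hν hρ
  have h2 := ((ht.isImage_triple hk hρ hμ hν).cyclic.cyclic).congr (fun _ => rfl)
    (T' := fun p => p.1 + (p.2.1 + p.2.2)) fun p => by simp only; abel
  have h3 := ((ht.isImage_triple hk.flip hν hρ hμ).cyclic).congr (fun _ => rfl)
    (T' := fun p => p.1 + (p.2.1 + p.2.2)) fun p => by simp only; abel
  rw [twistedConv_zero_comm h (poissonBracket_mem_momentSpace_top hc h hμ hν) hρ]
  simp only [poissonBracket]
  -- The order `(ν, μ, ρ)` is not a rotation of `(μ, ν, ρ)`; flipping the inner kernel gives `(ν, ρ,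
  -- μ)`, which is one.
  rw [hk.kernelProduct_swap (mem_momentSpace_natCast hμ 1) (mem_momentSpace_natCast hρ 1)]
  refine h1.eq_of_eq (h2.add h3) (fun p => ?_) fun p => rfl
  simp only [twistKernel_zero, map_add]
  push_cast
  ring

theorem involution_twistedConv_zero (h : ∀ f g, |σ f g| ≤ c * ς f * ς g) {μ ν : ComplexMeasure E}
    (hμ : μ ∈ momentSpace ς ⊤) (hν : ν ∈ momentSpace ς ⊤) :
    involution (twistedConv σ 0 μ ν) = twistedConv σ 0 (involution ν) (involution μ) := by
  rw [twistedConv_zero_comm h (involution_mem_momentSpace hν) (involution_mem_momentSpace hμ)]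
  exact (isAdmissible_twistKernel h ς 0).involution_kernelProduct
    (fun f g => by simp [twistKernel_zero]) (mem_momentSpace_natCast hμ 0)
    (mem_momentSpace_natCast hν 0)

theorem involution_poissonBracket (hc : 0 ≤ c) (h : ∀ f g, |σ f g| ≤ c * ς f * ς g)
    {μ ν : ComplexMeasure E} (hμ : μ ∈ momentSpace ς ⊤) (hν : ν ∈ momentSpace ς ⊤) :
    involution (poissonBracket σ μ ν) = poissonBracket σ (involution μ) (involution ν) :=
  (isAdmissible_sigma hc h).involution_kernelProduct (fun f g => by simp)
    (mem_momentSpace_natCast hμ 1) (mem_momentSpace_natCast hν 1)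

end Algebra

end WeylMeasure

namespace WeylMeasure

/-! ### Uniqueness for the Fourier transform. -/

section Separation

variable {E : Type*} [AddCommGroup E] [Module ℝ E] [TopologicalSpace E] [IsTopologicalAddGroup E]
  [HasContinuousSeminorms E] [ContinuousSMul ℝ E] [T2Space E] [MeasurableSpace E] [BorelSpace E]

theorem exists_linearMap_injOn (V : Submodule ℝ E) [FiniteDimensional ℝ V] :
    ∃ ψ : E →ₗ[ℝ] (Fin (Module.finrank ℝ V) → ℝ), InjOn ψ (V : Set E) := by
  obtain ⟨ψ, hψ⟩ := LinearMap.exists_extend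
    ((Module.finBasis ℝ V).equivFun : V →ₗ[ℝ] (Fin (Module.finrank ℝ V) → ℝ))
  refine ⟨ψ, fun x hx y hy hxy => ?_⟩
  have h1 : ∀ z : V, ψ z = (Module.finBasis ℝ V).equivFun z := fun z =>
    LinearMap.congr_fun hψ z
  have h2 : (⟨x, hx⟩ : V) = ⟨y, hy⟩ := (Module.finBasis ℝ V).equivFun.injective (by
    rw [← h1, ← h1]; exact hxy)
  exact congrArg Subtype.val h2

theorem measurable_linearMap_pi {ι : Type*} (Φ : E →ₗ[ℝ] (ι → ℝ)) : Measurable Φ :=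
  measurable_pi_iff.2 fun i =>
    (LinearMap.continuous_of_hasContinuousSeminorms (LinearMap.proj i ∘ₗ Φ)).measurable

/-- A functional of finitely many coordinates of `Φ` is an element of the algebraic dual, so the
finite marginals have equal characteristic functions; a finite measure on a product is determined by
them. -/
theorem map_eq_map_of_integral_exp_eq {ι : Type*} {M N : Measure E} [IsFiniteMeasure M]
    [IsFiniteMeasure N]
    (h : ∀ φ : Module.Dual ℝ E, ∫ f, Complex.exp (φ f * Complex.I) ∂M =
      ∫ f, Complex.exp (φ f * Complex.I) ∂N) (Φ : E →ₗ[ℝ] (ι → ℝ)) : M.map Φ = N.map Φ := by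
  have hΦ := measurable_linearMap_pi Φ
  have key : ∀ J : Finset ι, (N.map Φ).map J.restrict = (M.map Φ).map J.restrict := by
    intro J
    refine Measure.ext_of_charFunDual (funext fun L => ?_)
    have aux : ∀ (M : Measure E), charFunDual ((M.map Φ).map J.restrict) L =
        ∫ f, Complex.exp (((L : (J → ℝ) →ₗ[ℝ] ℝ) ∘ₗ LinearMap.funLeft ℝ ℝ (Subtype.val : J → ι) ∘ₗ Φ :
          Module.Dual ℝ E) f * Complex.I) ∂M := by
      intro M
      rw [charFunDual_apply, Measure.map_map (Finset.measurable_restrict J) hΦ, integral_map]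
      · rfl
      · exact ((Finset.measurable_restrict J).comp hΦ).aemeasurable
      · exact (by fun_prop : Continuous fun v : J → ℝ =>
          Complex.exp (L v * Complex.I)).aestronglyMeasurable
    rw [aux, aux, h]
  exact IsProjectiveLimit.unique (P := fun J : Finset ι => (M.map Φ).map J.restrict)
    (fun J => rfl) key

/-- In coordinates `Λ ∩ V` is a Borel set in a Euclidean space, and injective measurable images of
such sets in a countable product are Borel (Lusin–Souslin). -/
theorem measurableSet_image_of_injOn {ι : Type*} [Countable ι] (Φ : E →ₗ[ℝ] (ι → ℝ))
    (V : Submodule ℝ E) [FiniteDimensional ℝ V] (hΦ : InjOn Φ (V : Set E)) {Λ : Set E}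
    (hΛ : MeasurableSet Λ) : MeasurableSet (Φ '' (Λ ∩ V)) := by
  let g : (Fin (Module.finrank ℝ V) → ℝ) →ₗ[ℝ] E :=
    V.subtype ∘ₗ ((Module.finBasis ℝ V).equivFun.symm : _ →ₗ[ℝ] V)
  have hg : Continuous g := g.continuous_of_finiteDimensional
  have hginj : Function.Injective g := V.subtype_injective.comp
    (Module.finBasis ℝ V).equivFun.symm.injective
  have hgV : ∀ x, g x ∈ V := fun x => ((Module.finBasis ℝ V).equivFun.symm x).2
  have himg : Λ ∩ V = g '' (g ⁻¹' Λ) := by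
    rw [image_preimage_eq_inter_range]
    congr 1
    ext y
    refine ⟨fun hy => ⟨(Module.finBasis ℝ V).equivFun ⟨y, hy⟩, ?_⟩, ?_⟩
    · simp [g]
    · rintro ⟨x, rfl⟩
      exact hgV x
  rw [himg, image_image]
  refine (hg.measurable hΛ).image_of_measurable_injOn
    ((measurable_linearMap_pi Φ).comp hg.measurable) fun x _ y _ hxy => ?_
  exact hginj (hΦ (hgV x) (hgV y) hxy)

/-- A single `Φ` collects coordinates of all the `V n` and is injective on their union. Up to null
sets every Borel `Λ` is then a preimage `Φ ⁻¹' B` with `B` Borel, and the image measures agree. -/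
theorem ext_of_integral_exp_eq {M N : Measure E} [IsFiniteMeasure M] [IsFiniteMeasure N]
    (hM : IsConcentrated M) (hN : IsConcentrated N)
    (h : ∀ φ : Module.Dual ℝ E, ∫ f, Complex.exp (φ f * Complex.I) ∂M =
      ∫ f, Complex.exp (φ f * Complex.I) ∂N) : M = N := by
  obtain ⟨V, hV, hfd, haM, haN⟩ := exists_common_of_isConcentrated hM hN
  choose ψ hψ using fun n => exists_linearMap_injOn (V n)
  let Φ : E →ₗ[ℝ] ((Σ n, Fin (Module.finrank ℝ (V n))) → ℝ) :=
    LinearMap.pi fun p => LinearMap.proj p.2 ∘ₗ ψ p.1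
  have hΦ : ∀ n, InjOn Φ (V n : Set E) := fun n x hx y hy hxy =>
    hψ n hx hy (funext fun i => congrFun hxy ⟨n, i⟩)
  have hmap := map_eq_map_of_integral_exp_eq h Φ
  ext Λ hΛ
  let B : Set ((Σ n, Fin (Module.finrank ℝ (V n))) → ℝ) := ⋃ n, Φ '' (Λ ∩ V n)
  have hB : MeasurableSet B := MeasurableSet.iUnion fun n =>
    measurableSet_image_of_injOn Φ (V n) (hΦ n) hΛ
  have aux : ∀ f, (∃ n, f ∈ V n) → (f ∈ Φ ⁻¹' B ↔ f ∈ Λ) := by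
    rintro f ⟨n, hn⟩
    refine ⟨fun hf => ?_, fun hf => mem_iUnion.2 ⟨n, f, ⟨hf, hn⟩, rfl⟩⟩
    obtain ⟨m, g, ⟨hgΛ, hgm⟩, hgf⟩ := mem_iUnion.1 hf
    have := hΦ (max m n) (hV (le_max_left m n) hgm) (hV (le_max_right m n) hn) hgf
    rwa [← this]
  have aux' : ∀ M : Measure E, (∀ᵐ f ∂M, ∃ n, f ∈ V n) → M Λ = M.map Φ B := by
    intro M hM
    rw [Measure.map_apply (measurable_linearMap_pi Φ) hB]
    refine measure_congr ?_
    filter_upwards [hM] with f hf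
    exact propext (aux f hf).symm
  rw [aux' M haM, aux' N haN, hmap]

/-- The positive and the negative part of `a` define two positive finite measures with equal Fourier
transforms. -/
theorem integral_mul_indicator_eq_zero_of_real {M : Measure E}
    (hM : IsConcentrated M) {a : E → ℝ} (ha : Integrable a M)
    (h : ∀ φ : Module.Dual ℝ E, ∫ f, (a f : ℂ) * Complex.exp (φ f * Complex.I) ∂M = 0)
    {Λ : Set E} (hΛ : MeasurableSet Λ) :
    ∫ f, (a f : ℂ) * Λ.indicator (fun _ => (1 : ℂ)) f ∂M = 0 := by
  let Q : (E → ℝ) → Measure E := fun a => M.withDensity fun f => ENNReal.ofReal (a f)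
  have hQ : ∀ {a : E → ℝ}, Integrable a M → IsFiniteMeasure (Q a) := fun {a} ha =>
    isFiniteMeasure_withDensity_ofReal ha.2
  have hfin1 := hQ ha
  have hfin2 := hQ ha.neg
  have hint : ∀ {a : E → ℝ}, Integrable a M → ∀ F : E → ℂ,
      ∫ f, F f ∂(Q a) = ∫ f, ((max (a f) 0 : ℝ) : ℂ) * F f ∂M := by
    intro a ha F
    rw [integral_withDensity_eq_integral_toReal_smul₀ ha.aemeasurable.ennreal_ofReal
      (Filter.Eventually.of_forall fun f => ENNReal.ofReal_lt_top)]
    refine integral_congr_ae (Filter.Eventually.of_forall fun f => ?_)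
    simp only [ENNReal.toReal_ofReal', Complex.real_smul]
  have hsub : ∀ {F : E → ℂ}, AEStronglyMeasurable F M → (∀ f, ‖F f‖ ≤ 1) →
      ∫ f, F f ∂(Q a) - ∫ f, F f ∂(Q (-a)) = ∫ f, (a f : ℂ) * F f ∂M := by
    intro F hF hF1
    have hi : ∀ {a : E → ℝ}, Integrable a M →
        Integrable (fun f => ((max (a f) 0 : ℝ) : ℂ) * F f) M := fun {a} ha =>
      (ha.pos_part.ofReal (𝕜 := ℂ)).mul_bdd hF (Filter.Eventually.of_forall hF1)
    rw [hint ha, hint ha.neg, ← integral_sub (hi ha) (hi ha.neg)]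
    refine integral_congr_ae (Filter.Eventually.of_forall fun f => ?_)
    simp only [← sub_mul, ← Complex.ofReal_sub, Pi.neg_apply]
    rw [max_zero_sub_eq_self]
  have hexp : ∀ φ : Module.Dual ℝ E, Measurable fun f : E => Complex.exp (φ f * Complex.I) :=
    fun φ => by
      have := LinearMap.continuous_of_hasContinuousSeminorms φ
      exact (by fun_prop : Continuous fun f : E => Complex.exp (φ f * Complex.I)).measurable
  have heq : Q a = Q (-a) := by
    refine ext_of_integral_exp_eq (hM.mono_ac (withDensity_absolutelyContinuous _ _))
      (hM.mono_ac (withDensity_absolutelyContinuous _ _)) fun φ => sub_eq_zero.1 ?_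
    rw [hsub (hexp φ).aestronglyMeasurable fun f => (Complex.norm_exp_ofReal_mul_I _).le, h]
  rw [← hsub, heq, sub_self]
  · exact (measurable_const.indicator hΛ).aestronglyMeasurable
  · intro f
    by_cases hf : f ∈ Λ <;> simp [hf]

theorem integral_mul_indicator_eq_zero {M : Measure E}
    (hM : IsConcentrated M) {H : E → ℂ} (hH : Integrable H M)
    (h : ∀ φ : Module.Dual ℝ E, ∫ f, H f * Complex.exp (φ f * Complex.I) ∂M = 0)
    {Λ : Set E} (hΛ : MeasurableSet Λ) :
    ∫ f, H f * Λ.indicator (fun _ => (1 : ℂ)) f ∂M = 0 := by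
  have hexp : ∀ φ : Module.Dual ℝ E, AEStronglyMeasurable
      (fun f : E => Complex.exp (φ f * Complex.I)) M := fun φ => by
    have := LinearMap.continuous_of_hasContinuousSeminorms φ
    exact (by fun_prop : Continuous fun f : E =>
      Complex.exp (φ f * Complex.I)).measurable.aestronglyMeasurable
  have hint : ∀ (φ : Module.Dual ℝ E) {H : E → ℂ}, Integrable H M →
      Integrable (fun f => H f * Complex.exp (φ f * Complex.I)) M := fun φ H hH =>
    hH.mul_bdd (hexp φ) (Filter.Eventually.of_forall fun f =>
      (Complex.norm_exp_ofReal_mul_I _).le)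
  have hHc : Integrable (fun f => conj (H f)) M := (LinearIsometryEquiv.integrable_comp_iff Complex.conjLIE).2 hH
  have hc : ∀ φ : Module.Dual ℝ E, ∫ f, conj (H f) * Complex.exp (φ f * Complex.I) ∂M = 0 := by
    intro φ
    -- Conjugating the hypothesis at `-φ` gives it for `conj H` at `φ`, hence for the real and the
    -- imaginary part of `H`.
    have h1 := congrArg (starRingEnd ℂ) (h (-φ))
    rw [← integral_conj, map_zero] at h1
    rw [← h1]
    refine integral_congr_ae (Filter.Eventually.of_forall fun f => ?_)
    simp [← Complex.exp_conj]
  have hre := integral_mul_indicator_eq_zero_of_real hM hH.re (fun φ => by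
    have : ∀ f, ((RCLike.re (H f) : ℝ) : ℂ) * Complex.exp (φ f * Complex.I) =
        (1 / 2) * (H f * Complex.exp (φ f * Complex.I) +
          conj (H f) * Complex.exp (φ f * Complex.I)) := fun f => by
      rw [← add_mul, Complex.add_conj]
      simp only [RCLike.re_to_complex]
      push_cast
      ring
    simp only [this]
    rw [integral_const_mul, integral_add (hint φ hH) (hint φ hHc), h, hc, add_zero, mul_zero]) hΛ
  have him := integral_mul_indicator_eq_zero_of_real hM hH.im (fun φ => by
    have : ∀ f, ((RCLike.im (H f) : ℝ) : ℂ) * Complex.exp (φ f * Complex.I) =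
        (-Complex.I / 2) * (H f * Complex.exp (φ f * Complex.I) -
          conj (H f) * Complex.exp (φ f * Complex.I)) := fun f => by
      rw [← sub_mul, Complex.sub_conj]
      simp only [RCLike.im_to_complex]
      push_cast
      linear_combination ((H f).im * Complex.exp (φ f * Complex.I)) * Complex.I_mul_I
    simp only [this]
    rw [integral_const_mul, integral_sub (hint φ hH) (hint φ hHc), h, hc, sub_zero, mul_zero]) hΛ
  have hi : ∀ {a : E → ℝ}, Integrable a M →
      Integrable (fun f => (a f : ℂ) * Λ.indicator (fun _ => (1 : ℂ)) f) M := fun {a} ha =>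
    (ha.ofReal (𝕜 := ℂ)).mul_bdd (c := 1) (measurable_const.indicator hΛ).aestronglyMeasurable
      (Filter.Eventually.of_forall fun f => by by_cases hf : f ∈ Λ <;> simp [hf])
  have hsum : ∀ f, H f * Λ.indicator (fun _ => (1 : ℂ)) f =
      ((RCLike.re (H f) : ℝ) : ℂ) * Λ.indicator (fun _ => (1 : ℂ)) f +
      Complex.I * (((RCLike.im (H f) : ℝ) : ℂ) * Λ.indicator (fun _ => (1 : ℂ)) f) := fun f => by
    conv_lhs => rw [← Complex.re_add_im (H f)]
    simp only [RCLike.re_to_complex, RCLike.im_to_complex]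
    ring
  simp only [hsum]
  rw [integral_add (hi hH.re) ((hi hH.im).const_mul _), integral_const_mul, hre, him, mul_zero,
    add_zero]

end Separation

end WeylMeasure

/-! ### Realisation in a commutative C*-algebra. -/

namespace WeylMeasure

universe u

/-- The algebra is the closure of `F '' P` in `B`. As `j` has to be defined on all of `V`, it is set
to zero off `P`, where nothing is required of it. -/
theorem exists_dense_in_cstar {V B : Type u} [AddCommGroup V] [Module ℂ V]
    [NonUnitalCommCStarAlgebra B] {P : Set V} {mul : V → V → V} {inv : V → V} (F : V → B)
    (zero_mem : 0 ∈ P) (add_mem : ∀ x ∈ P, ∀ y ∈ P, x + y ∈ P)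
    (smul_mem : ∀ (z : ℂ), ∀ x ∈ P, z • x ∈ P) (mul_mem : ∀ x ∈ P, ∀ y ∈ P, mul x y ∈ P)
    (inv_mem : ∀ x ∈ P, inv x ∈ P) (hinj : InjOn F P)
    (map_add : ∀ x ∈ P, ∀ y ∈ P, F (x + y) = F x + F y)
    (map_smul : ∀ (z : ℂ), ∀ x ∈ P, F (z • x) = z • F x)
    (map_mul : ∀ x ∈ P, ∀ y ∈ P, F (mul x y) = F x * F y)
    (map_inv : ∀ x ∈ P, F (inv x) = star (F x)) :
    ∃ (A : Type u) (_ : NonUnitalCommCStarAlgebra A) (j : V → A),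
      InjOn j P ∧ Dense (j '' P) ∧ (∀ x ∈ P, ∀ y ∈ P, j (x + y) = j x + j y) ∧
      (∀ (z : ℂ), ∀ x ∈ P, j (z • x) = z • j x) ∧ (∀ x ∈ P, ∀ y ∈ P, j (mul x y) = j x * j y) ∧
      (∀ x ∈ P, j (inv x) = star (j x)) := by
  classical
  let S : NonUnitalStarSubalgebra ℂ B :=
    { carrier := F '' P
      add_mem' := by
        rintro _ _ ⟨x, hx, rfl⟩ ⟨y, hy, rfl⟩
        exact ⟨x + y, add_mem x hx y hy, map_add x hx y hy⟩
      zero_mem' := ⟨0, zero_mem, by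
        have := map_smul 0 0 zero_mem
        rwa [zero_smul, zero_smul] at this⟩
      mul_mem' := by
        rintro _ _ ⟨x, hx, rfl⟩ ⟨y, hy, rfl⟩
        exact ⟨mul x y, mul_mem x hx y hy, map_mul x hx y hy⟩
      smul_mem' := by
        rintro z _ ⟨x, hx, rfl⟩
        exact ⟨z • x, smul_mem z x hx, map_smul z x hx⟩
      star_mem' := by
        rintro _ ⟨x, hx, rfl⟩
        exact ⟨inv x, inv_mem x hx, map_inv x hx⟩ }
  have hcl : IsClosed (S.topologicalClosure : Set B) := S.isClosed_topologicalClosure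
  have hS : ∀ x ∈ P, F x ∈ S.topologicalClosure := fun x hx =>
    S.le_topologicalClosure ⟨x, hx, rfl⟩
  let j : V → S.topologicalClosure := fun x => if hx : x ∈ P then ⟨F x, hS x hx⟩ else 0
  have hj : ∀ x ∈ P, (j x : B) = F x := fun x hx => by simp [j, hx]
  refine ⟨S.topologicalClosure, NonUnitalStarSubalgebra.nonUnitalCommCStarAlgebra _, j,
    fun x hx y hy hxy => hinj hx hy ?_, ?_, fun x hx y hy => Subtype.ext ?_,
    fun z x hx => Subtype.ext ?_, fun x hx y hy => Subtype.ext ?_, fun x hx => Subtype.ext ?_⟩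
  · rw [← hj x hx, ← hj y hy, hxy]
  · refine Subtype.dense_iff.2 fun b hb => ?_
    have himg : Subtype.val '' (j '' P) = F '' P := by
      rw [image_image]
      exact image_congr hj
    exact himg ▸ hb
  · rw [hj _ (add_mem x hx y hy), map_add x hx y hy, ← hj x hx, ← hj y hy]
    rfl
  · rw [hj _ (smul_mem z x hx), map_smul z x hx, ← hj x hx]
    rfl
  · rw [hj _ (mul_mem x hx y hy), map_mul x hx y hy, ← hj x hx, ← hj y hy]
    rfl
  · rw [hj _ (inv_mem x hx), map_inv x hx, ← hj x hx]
    rfl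

section Fourier

variable {E : Type*} [AddCommGroup E] [Module ℝ E] [MeasurableSpace E]
  [TopologicalSpace E] [IsTopologicalAddGroup E]
  [HasContinuousSeminorms E] [ContinuousSMul ℝ E] [T2Space E] [BorelSpace E]
  {σ : E →ₗ[ℝ] E →ₗ[ℝ] ℝ} {ς : Seminorm ℝ E} {c : ℝ}

/-- The Fourier transform of a complex measure, as a function on the algebraic dual. -/
noncomputable def fourier (μ : ComplexMeasure E) (φ : Module.Dual ℝ E) : ℂ :=
  ∫ f, density μ f * Complex.exp (φ f * Complex.I) ∂μ.variation

theorem norm_fourier_le (μ : ComplexMeasure E) (φ : Module.Dual ℝ E) :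
    ‖fourier μ φ‖ ≤ μ.variation.real univ := by
  refine (norm_integral_le_integral_norm _).trans_eq ?_
  rw [integral_congr_ae (g := fun _ => (1 : ℝ)), integral_const, smul_eq_mul, mul_one]
  filter_upwards [norm_density μ] with f hf
  rw [norm_mul, hf, Complex.norm_exp_ofReal_mul_I, mul_one]

/-- The Fourier transform of a complex measure, as a bounded function on the algebraic dual. -/
noncomputable def fourierBounded (μ : ComplexMeasure E) : lp (fun _ : Module.Dual ℝ E => ℂ) ∞ :=
  ⟨fourier μ, memℓp_infty ⟨μ.variation.real univ, by
    rintro _ ⟨φ, rfl⟩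
    exact norm_fourier_le μ φ⟩⟩

theorem measurable_exp_dual (φ : Module.Dual ℝ E) :
    Measurable fun f : E => Complex.exp (φ f * Complex.I) := by
  have := LinearMap.continuous_of_hasContinuousSeminorms φ
  exact (by fun_prop : Continuous fun f : E => Complex.exp (φ f * Complex.I)).measurable

theorem integrable_mul_exp_dual {Ω : Type*} [MeasurableSpace Ω] {P : Measure Ω} {H : Ω → ℂ}
    {T : Ω → E} (hH : Integrable H P) (hT : AEMeasurable T P) (φ : Module.Dual ℝ E) :
    Integrable (fun ω => H ω * Complex.exp (φ (T ω) * Complex.I)) P :=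
  hH.mul_bdd (c := 1) ((measurable_exp_dual φ).comp_aemeasurable hT).aestronglyMeasurable
    (Filter.Eventually.of_forall fun _ => (Complex.norm_exp_ofReal_mul_I _).le)

/-- Any presentation computes the transform, so that of a product is obtained on the product of the
variations, where the exponential factorises. -/
theorem IsImage.fourier_eq {Ω : Type*} [MeasurableSpace Ω] {P : Measure Ω} {H : Ω → ℂ}
    {T : Ω → E} {ρ : ComplexMeasure E} (h : IsImage ρ P H T) (φ : Module.Dual ℝ E) :
    fourier ρ φ = ∫ ω, H ω * Complex.exp (φ (T ω) * Complex.I) ∂P := by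
  have hm := measurable_exp_dual (E := E) φ
  have h1 := (isImage_density ρ).integral_eq hm.aestronglyMeasurable
    (integrable_mul_exp_dual (isImage_density ρ).integrable aemeasurable_id φ)
  have h2 := h.integral_eq hm.aestronglyMeasurable
    (integrable_mul_exp_dual h.integrable h.aemeasurable φ)
  exact h1.symm.trans h2

theorem fourier_smul (z : ℂ) (μ : ComplexMeasure E) (φ : Module.Dual ℝ E) :
    fourier (z • μ) φ = z * fourier μ φ := by
  rw [((isImage_density μ).smul z).fourier_eq, fourier, ← integral_const_mul]
  simp only [mul_assoc, id]

theorem fourier_add (μ ν : ComplexMeasure E) (φ : Module.Dual ℝ E) :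
    fourier (μ + ν) φ = fourier μ φ + fourier ν φ := by
  have hm := measurable_exp_dual (E := E) φ
  have hI : ∀ μ : ComplexMeasure E, μ.Integrable fun f => Complex.exp (φ f * Complex.I) := fun μ =>
    (integrable_const (1 : ℂ)).mono hm.aestronglyMeasurable
      (Filter.Eventually.of_forall fun f => by simp [Complex.norm_exp_ofReal_mul_I])
  have hF : ∀ μ : ComplexMeasure E, fourier μ φ =
      μ.integral (fun f => Complex.exp (φ f * Complex.I)) (ContinuousLinearMap.mul ℝ ℂ) := fun μ =>
    ((isImage_density μ).integral_eq hm.aestronglyMeasurable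
      (integrable_mul_exp_dual (isImage_density μ).integrable aemeasurable_id φ)).symm
  rw [hF, hF, hF, VectorMeasure.integral_add_vectorMeasure (hI μ) (hI ν)]

theorem fourier_involution (μ : ComplexMeasure E) (φ : Module.Dual ℝ E) :
    fourier (involution μ) φ = conj (fourier μ φ) := by
  rw [(isImage_density μ).involution.fourier_eq, fourier, ← integral_conj]
  refine integral_congr_ae (Filter.Eventually.of_forall fun f => ?_)
  simp [← Complex.exp_conj]

theorem fourier_twistedConv_zero (h : ∀ f g, |σ f g| ≤ c * ς f * ς g) {μ ν : ComplexMeasure E}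
    (hμ : μ ∈ regularMeasures E) (hν : ν ∈ regularMeasures E) (φ : Module.Dual ℝ E) :
    fourier (twistedConv σ 0 μ ν) φ = fourier μ φ * fourier ν φ := by
  rw [← momentSpace_zero ς] at hμ hν
  have hi := ((isAdmissible_twistKernel h ς 0).isImage (μ := μ) (ν := ν)
    (by exact_mod_cast hμ) (by exact_mod_cast hν)).2
  rw [twistedConv, hi.fourier_eq, fourier, fourier, ← integral_prod_mul]
  refine integral_congr_ae (Filter.Eventually.of_forall fun p => ?_)
  simp only [twistKernel_zero, map_add, Complex.ofReal_add, add_mul, Complex.exp_add]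
  ring

theorem eq_zero_of_fourier_eq_zero {μ : ComplexMeasure E} (hμ : μ ∈ regularMeasures E)
    (h : ∀ φ, fourier μ φ = 0) : μ = 0 := by
  ext Λ hΛ : 1
  rw [(isImage_density μ).apply_eq Λ hΛ]
  exact integral_mul_indicator_eq_zero (mem_regularMeasures_iff.1 hμ)
    (isImage_density μ).integrable h hΛ

theorem fourierBounded_injOn : InjOn (fourierBounded (E := E)) (regularMeasures E) := by
  intro μ hμ ν hν h
  have hφ : ∀ φ, fourier μ φ = fourier ν φ := fun φ =>
    congrFun (congrArg (fun F : lp (fun _ : Module.Dual ℝ E => ℂ) ∞ => (F : Module.Dual ℝ E → ℂ)) h) φ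
  have hmem : μ + (-1 : ℂ) • ν ∈ regularMeasures E :=
    add_mem_regularMeasures hμ (smul_mem_regularMeasures _ hν)
  have h0 := eq_zero_of_fourier_eq_zero hmem fun φ => by
    rw [fourier_add, fourier_smul, hφ]; ring
  ext Λ hΛ : 1
  have h1 := congrArg (fun ρ : ComplexMeasure E => ρ Λ) h0
  simp only [_root_.add_apply, _root_.smul_apply, smul_eq_mul, FunLike.coe_zero,
    Pi.zero_apply] at h1
  linear_combination h1

end Fourier

section PoissonAlgebra

variable {E : Type u} [AddCommGroup E] [Module ℝ E] [MeasurableSpace E]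
  [TopologicalSpace E] [IsTopologicalAddGroup E]
  [HasContinuousSeminorms E] [ContinuousSMul ℝ E] [T2Space E] [BorelSpace E]
  {σ : E →ₗ[ℝ] E →ₗ[ℝ] ℝ} {ς : Seminorm ℝ E} {c : ℝ}

/-- `P` is a linear space of measures with finite moments, closed under the twisted convolutions,
the involution and the Poisson bracket. -/
structure IsMeasureAlgebra (σ : E →ₗ[ℝ] E →ₗ[ℝ] ℝ) (ς : Seminorm ℝ E)
    (P : Set (ComplexMeasure E)) : Prop where
  subset : P ⊆ momentSpace ς ⊤
  zero_mem : (0 : ComplexMeasure E) ∈ P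
  add_mem : ∀ μ ∈ P, ∀ ν ∈ P, μ + ν ∈ P
  smul_mem : ∀ (z : ℂ), ∀ μ ∈ P, z • μ ∈ P
  twistedConv_mem : ∀ ħ : ℝ, ∀ μ ∈ P, ∀ ν ∈ P, twistedConv σ ħ μ ν ∈ P
  involution_mem : ∀ μ ∈ P, involution μ ∈ P
  poissonBracket_mem : ∀ μ ∈ P, ∀ ν ∈ P, poissonBracket σ μ ν ∈ P

/-- All identities hold in `momentSpace ς ⊤` and are inherited by `P`; only the closure properties
depend on `P`. -/
theorem IsMeasureAlgebra.isPoissonAlgebra (hσ : ∀ f g, σ f g = -σ g f) (hc : 0 ≤ c)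
    (h : ∀ f g, |σ f g| ≤ c * ς f * ς g) {P : Set (ComplexMeasure E)}
    (hP : IsMeasureAlgebra σ ς P) :
    IsPoissonAlgebra P (twistedConv σ 0) involution (poissonBracket σ) := by
  have hk := isAdmissible_twistKernel h ς 0
  have hs := isAdmissible_sigma hc h
  have h0 : ∀ {μ}, μ ∈ P → μ ∈ momentSpace ς ((0 : ℕ) : ℕ∞) := fun hμ =>
    mem_momentSpace_natCast (hP.subset hμ) 0
  have h1 : ∀ {μ}, μ ∈ P → μ ∈ momentSpace ς ((1 : ℕ) : ℕ∞) := fun hμ =>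
    mem_momentSpace_natCast (hP.subset hμ) 1
  have ht := @hP.subset
  exact {
    zero_mem := hP.zero_mem
    add_mem := hP.add_mem
    smul_mem := hP.smul_mem
    mul_mem := hP.twistedConv_mem 0
    mul_add_left := fun x hx y hy w hw => hk.kernelProduct_add_left (h0 hx) (h0 hy) (h0 hw)
    mul_smul_left := fun z x hx y hy => hk.kernelProduct_smul_left z (h0 hx) (h0 hy)
    mul_comm := fun x hx y hy => twistedConv_zero_comm h (ht hx) (ht hy)
    mul_assoc := fun x hx y hy w hw => twistedConv_zero_assoc h (ht hx) (ht hy) (ht hw)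
    inv_mem := hP.involution_mem
    inv_inv := fun x _ => involution_involution x
    inv_add := fun x _ y _ => involution_add x y
    inv_smul := fun z x _ => involution_smul z x
    inv_mul := fun x hx y hy => involution_twistedConv_zero h (ht hx) (ht hy)
    br_mem := hP.poissonBracket_mem
    br_add_left := fun x hx y hy w hw => hs.kernelProduct_add_left (h1 hx) (h1 hy) (h1 hw)
    br_add_right := fun x hx y hy w hw => hs.kernelProduct_add_right (h1 hx) (h1 hy) (h1 hw)
    br_smul_left := fun z x hx y hy => hs.kernelProduct_smul_left z (h1 hx) (h1 hy)
    br_smul_right := fun z x hx y hy => hs.kernelProduct_smul_right z (h1 hx) (h1 hy)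
    br_anticomm := fun x hx y hy => poissonBracket_anticomm hσ hc h (ht hx) (ht hy)
    br_real := fun x hx y hy => involution_poissonBracket hc h (ht hx) (ht hy)
    br_jacobi := fun x hx y hy w hw => poissonBracket_jacobi hσ hc h (ht hx) (ht hy) (ht hw)
    br_leibniz := fun x hx y hy w hw => poissonBracket_leibniz hc h (ht hx) (ht hy) (ht hw)
    dense_in_cstar := exists_dense_in_cstar fourierBounded hP.zero_mem hP.add_mem hP.smul_mem
      (hP.twistedConv_mem 0) hP.involution_mem
      (fourierBounded_injOn.mono fun x hx => (ht hx).1)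
      (fun x _ y _ => lp.ext (funext fun φ => fourier_add x y φ))
      (fun z x _ => lp.ext (funext fun φ => fourier_smul z x φ))
      (fun x hx y hy => lp.ext (funext fun φ =>
        fourier_twistedConv_zero h (ht hx).1 (ht hy).1 φ))
      (fun x _ => lp.ext (funext fun φ => fourier_involution x φ)) }

end PoissonAlgebra

end WeylMeasure

namespace WeylMeasure

universe u

/-! ### Algebras defined by moment conditions. -/

section MomentAlgebras

variable {E : Type u} [AddCommGroup E] [Module ℝ E] [MeasurableSpace E]

theorem momentSpace_subset_of_le {κ κ' : Seminorm ℝ E} {C : ℝ} (hC : 0 ≤ C)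
    (h : ∀ f, κ f ≤ C * κ' f) (n : ℕ∞) : momentSpace κ' n ⊆ momentSpace κ n := by
  refine fun μ hμ => ⟨hμ.1, fun m hm => lt_of_le_of_lt ?_
    (ENNReal.mul_lt_top (ENNReal.ofReal_lt_top (r := C ^ m)) (hμ.2 m hm))⟩
  rw [moment, moment, ← lintegral_const_mul' _ _ ENNReal.ofReal_ne_top]
  refine lintegral_mono fun f => ?_
  rw [← ENNReal.ofReal_mul (pow_nonneg hC m), ← mul_pow]
  exact ENNReal.ofReal_le_ofReal (pow_le_pow_left₀ (apply_nonneg κ f) (h f) m)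

theorem mem_momentSpace_zero_seminorm {μ : ComplexMeasure E} (hμ : μ ∈ regularMeasures E)
    (n : ℕ∞) : μ ∈ momentSpace (0 : Seminorm ℝ E) n := by
  refine ⟨hμ, fun m _ => lt_of_le_of_lt (lintegral_mono (g := fun _ => 1) fun f => ?_) ?_⟩
  · rw [_root_.zero_apply, ENNReal.ofReal_le_one]
    exact pow_le_one₀ le_rfl zero_le_one
  · rw [lintegral_one]
    exact measure_lt_top _ _

variable [TopologicalSpace E] [IsTopologicalAddGroup E]
  [HasContinuousSeminorms E] [ContinuousSMul ℝ E] [T2Space E] [BorelSpace E]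
  {σ : E →ₗ[ℝ] E →ₗ[ℝ] ℝ} {ς : Seminorm ℝ E} {c : ℝ}

theorem mem_momentSpace_add_seminorm {κ κ' : Seminorm ℝ E} {n : ℕ∞} {μ : ComplexMeasure E}
    (h : μ ∈ momentSpace κ n) (h' : μ ∈ momentSpace κ' n) : μ ∈ momentSpace (κ + κ') n := by
  refine ⟨h.1, fun m hm => ?_⟩
  have hκ := κ.continuous_of_hasContinuousSeminorms
  have hlt : ENNReal.ofReal (2 ^ (m - 1)) * (moment κ m μ + moment κ' m μ) < ∞ :=
    ENNReal.mul_lt_top ENNReal.ofReal_lt_top (ENNReal.add_lt_top.2 ⟨h.2 m hm, h'.2 m hm⟩)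
  refine lt_of_le_of_lt ?_ hlt
  rw [moment, moment, moment, ← lintegral_add_left (by fun_prop),
    ← lintegral_const_mul' _ _ ENNReal.ofReal_ne_top]
  refine lintegral_mono fun f => ?_
  rw [← ENNReal.ofReal_add (pow_nonneg (apply_nonneg κ f) m) (pow_nonneg (apply_nonneg κ' f) m),
    ← ENNReal.ofReal_mul (by positivity)]
  exact ENNReal.ofReal_le_ofReal (add_pow_le (apply_nonneg κ f) (apply_nonneg κ' f) m)

/-- The seminorm `κ` need not dominate `ς`, so the estimate is applied to `κ + ς`, which dominates
both. -/
theorem poissonBracket_mem_momentSpace_of_mem (hc : 0 ≤ c)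
    (h : ∀ f g, |σ f g| ≤ c * ς f * ς g) {κ : Seminorm ℝ E} {μ ν : ComplexMeasure E}
    (hμ : μ ∈ momentSpace ς ⊤) (hν : ν ∈ momentSpace ς ⊤) (hμ' : μ ∈ momentSpace κ ⊤)
    (hν' : ν ∈ momentSpace κ ⊤) : poissonBracket σ μ ν ∈ momentSpace κ ⊤ := by
  have hle : ∀ f, ς f ≤ (κ + ς) f := fun f => le_add_of_nonneg_left (apply_nonneg κ f)
  have h' : ∀ f g, |σ f g| ≤ c * (κ + ς) f * (κ + ς) g := fun f g =>
    (h f g).trans (mul_le_mul (mul_le_mul_of_nonneg_left (hle f) hc) (hle g) (apply_nonneg ς g)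
      (mul_nonneg hc (apply_nonneg _ f)))
  refine momentSpace_subset_of_le zero_le_one (fun f => ?_) ⊤
    (poissonBracket_mem_momentSpace_top hc h' (mem_momentSpace_add_seminorm hμ' hμ)
      (mem_momentSpace_add_seminorm hν' hν))
  rw [one_mul]
  exact le_add_of_nonneg_right (apply_nonneg ς f)

theorem isMeasureAlgebra_moments (hc : 0 ≤ c) (h : ∀ f g, |σ f g| ≤ c * ς f * ς g)
    {K : Set (Seminorm ℝ E)}
    (hK : ∀ μ ∈ regularMeasures E, (∀ κ ∈ K, μ ∈ momentSpace κ ⊤) → μ ∈ momentSpace ς ⊤) :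
    IsMeasureAlgebra σ ς {μ | μ ∈ regularMeasures E ∧ ∀ κ ∈ K, μ ∈ momentSpace κ ⊤} where
  subset := fun μ hμ => hK μ hμ.1 hμ.2
  zero_mem := ⟨zero_mem_regularMeasures, fun κ _ => zero_mem_momentSpace κ ⊤⟩
  add_mem := fun _ hμ _ hν => ⟨add_mem_regularMeasures hμ.1 hν.1, fun κ hκ =>
    add_mem_momentSpace (hμ.2 κ hκ) (hν.2 κ hκ)⟩
  smul_mem := fun z _ hμ => ⟨smul_mem_regularMeasures z hμ.1, fun κ hκ =>
    smul_mem_momentSpace z (hμ.2 κ hκ)⟩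
  twistedConv_mem := fun ħ μ hμ ν hν =>
    ⟨(twistedConv_mem_momentSpace h ς ħ (hK μ hμ.1 hμ.2) (hK ν hν.1 hν.2)).1, fun κ hκ =>
      twistedConv_mem_momentSpace h κ ħ (hμ.2 κ hκ) (hν.2 κ hκ)⟩
  involution_mem := fun _ hμ => ⟨involution_mem_regularMeasures hμ.1, fun κ hκ =>
    involution_mem_momentSpace (hμ.2 κ hκ)⟩
  poissonBracket_mem := fun μ hμ ν hν =>
    ⟨(poissonBracket_mem_momentSpace_top hc h (hK μ hμ.1 hμ.2) (hK ν hν.1 hν.2)).1, fun κ hκ =>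
      poissonBracket_mem_momentSpace_of_mem hc h (hK μ hμ.1 hμ.2) (hK ν hν.1 hν.2) (hμ.2 κ hκ)
        (hν.2 κ hκ)⟩

theorem isMeasureAlgebra_momentSpace (hc : 0 ≤ c) (h : ∀ f g, |σ f g| ≤ c * ς f * ς g)
    {κ : Seminorm ℝ E} {C : ℝ} (hC : 0 ≤ C) (hκ : ∀ f, ς f ≤ C * κ f) :
    IsMeasureAlgebra σ ς (momentSpace κ ⊤) := by
  have hset : momentSpace κ ⊤ =
      {μ | μ ∈ regularMeasures E ∧ ∀ κ' ∈ ({κ} : Set (Seminorm ℝ E)), μ ∈ momentSpace κ' ⊤} := by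
    ext μ
    simp only [mem_singleton_iff, forall_eq, mem_ofPred_eq]
    exact ⟨fun hμ => ⟨hμ.1, hμ⟩, fun hμ => hμ.2⟩
  rw [hset]
  exact isMeasureAlgebra_moments hc h fun μ _ hμ =>
    momentSpace_subset_of_le hC hκ ⊤ (hμ κ rfl)

theorem mem_momentSpace_of_le_sum {Γ : Finset (Seminorm ℝ E)} {a : Seminorm ℝ E → ℝ}
    (ha : ∀ κ ∈ Γ, 0 < a κ) (hς : ∀ f, ς f ≤ ∑ κ ∈ Γ, a κ * κ f) {μ : ComplexMeasure E}
    (hμ : μ ∈ regularMeasures E) {n : ℕ∞} (hΓ : ∀ κ ∈ Γ, μ ∈ momentSpace κ n) :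
    μ ∈ momentSpace ς n := by
  have hsum : μ ∈ momentSpace (∑ κ ∈ Γ, κ) n :=
    Finset.sum_induction _ (fun κ : Seminorm ℝ E => μ ∈ momentSpace κ n)
      (fun _ _ => mem_momentSpace_add_seminorm) (mem_momentSpace_zero_seminorm hμ n) hΓ
  -- Each coefficient is at most the sum of all, whence `ς ≤ (∑ a κ) (∑ κ)`.
  refine momentSpace_subset_of_le (C := ∑ κ ∈ Γ, a κ)
    (Finset.sum_nonneg fun κ hκ => (ha κ hκ).le) (fun f => (hς f).trans ?_) n hsum
  have happ : ∀ Δ : Finset (Seminorm ℝ E), (∑ κ ∈ Δ, κ) f = ∑ κ ∈ Δ, κ f := by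
    classical
    intro Δ
    induction Δ using Finset.induction_on with
    | empty => rfl
    | insert κ Δ hκ ih => rw [Finset.sum_insert hκ, Finset.sum_insert hκ, _root_.add_apply, ih]
  rw [happ, Finset.mul_sum]
  exact Finset.sum_le_sum fun κ hκ => mul_le_mul_of_nonneg_right
    (Finset.single_le_sum (fun κ hκ => (ha κ hκ).le) hκ) (apply_nonneg κ f)

theorem IsMomentAlgebra.isMeasureAlgebra (hc : 0 ≤ c) (h : ∀ f g, |σ f g| ≤ c * ς f * ς g)
    {Q : Set (ComplexMeasure E)} (hQ : IsMomentAlgebra ς Q) : IsMeasureAlgebra σ ς Q := by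
  cases hQ with
  | single κ C hC hκ => exact isMeasureAlgebra_momentSpace hc h hC hκ
  | collection K Γ hΓ a ha hς =>
    exact isMeasureAlgebra_moments hc h fun μ hμ hK =>
      mem_momentSpace_of_le_sum ha hς hμ fun κ hκ => hK κ (hΓ κ hκ)

end MomentAlgebras

/-! ### Discrete, continuous and absolutely continuous measures. -/

section ConvolutionClasses

variable {E : Type u} [AddCommGroup E] [Module ℝ E] [MeasurableSpace E]
  [TopologicalSpace E] [IsTopologicalAddGroup E]
  [HasContinuousSeminorms E] [ContinuousSMul ℝ E] [T2Space E] [BorelSpace E]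
  {σ : E →ₗ[ℝ] E →ₗ[ℝ] ℝ} {ς : Seminorm ℝ E} {c : ℝ}

/-- A class of measures on `E`, defined in terms of null sets and closed under sums, reflection and
convolution. -/
structure IsConvolutionClass (N : Set (Measure E)) : Prop where
  zero_mem : (0 : Measure E) ∈ N
  mono_ac : ∀ M ∈ N, ∀ M', M' ≪ M → M' ∈ N
  add_mem : ∀ M ∈ N, ∀ M' ∈ N, M + M' ∈ N
  neg_mem : ∀ M ∈ N, (M.map fun f => -f) ∈ N
  conv_mem : ∀ M ∈ N, ∀ M' ∈ N, IsFiniteMeasure M → IsFiniteMeasure M' → IsConcentrated M →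
    IsConcentrated M' → ((M.prod M').map fun p => p.1 + p.2) ∈ N

/-- The variation of each result is absolutely continuous for a sum, reflection or convolution of
variations. The kernel does not matter for this, so both products are covered at once. -/
theorem IsMeasureAlgebra.inter (hc : 0 ≤ c) (h : ∀ f g, |σ f g| ≤ c * ς f * ς g)
    {Q D : Set (ComplexMeasure E)} (hQ : IsMeasureAlgebra σ ς Q) {N : Set (Measure E)}
    (hN : IsConvolutionClass N) (hD : ∀ μ ∈ regularMeasures E, μ ∈ D ↔ μ.variation ∈ N) :
    IsMeasureAlgebra σ ς (Q ∩ D) := by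
  have hreg : ∀ {μ}, μ ∈ Q → μ ∈ regularMeasures E := fun hμ => (hQ.subset hμ).1
  have hmem : ∀ {μ : ComplexMeasure E} {M : Measure E}, μ ∈ Q → M ∈ N → μ.variation ≪ M →
      μ ∈ Q ∩ D := fun hμ hM hμM =>
    ⟨hμ, (hD _ (hreg hμ)).2 (hN.mono_ac _ hM _ hμM)⟩
  have hvar : ∀ {μ : ComplexMeasure E}, μ ∈ Q ∩ D → μ.variation ∈ N := fun hμ =>
    (hD _ (hreg hμ.1)).1 hμ.2
  have hconv : ∀ {μ ν : ComplexMeasure E}, μ ∈ Q ∩ D → ν ∈ Q ∩ D →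
      ((μ.variation.prod ν.variation).map fun p => p.1 + p.2) ∈ N := fun {μ ν} hμ hν =>
    hN.conv_mem _ (hvar hμ) _ (hvar hν) inferInstance inferInstance
      (mem_regularMeasures_iff.1 (hreg hμ.1)) (mem_regularMeasures_iff.1 (hreg hν.1))
  refine ⟨fun μ hμ => hQ.subset hμ.1, ?_, fun μ hμ ν hν => ?_, fun z μ hμ => ?_,
    fun ħ μ hμ ν hν => ?_, fun μ hμ => ?_, fun μ hμ ν hν => ?_⟩
  · exact hmem hQ.zero_mem hN.zero_mem (by rw [VectorMeasure.variation_zero])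
  · exact hmem (hQ.add_mem μ hμ.1 ν hν.1) (hN.add_mem _ (hvar hμ) _ (hvar hν))
      VectorMeasure.variation_add_le.absolutelyContinuous
  · exact hmem (hQ.smul_mem z μ hμ.1) (hvar hμ) (variation_smul_ac z μ)
  · exact hmem (hQ.twistedConv_mem ħ μ hμ.1 ν hν.1) (hconv hμ hν)
      ((isAdmissible_twistKernel h ς ħ).variation_ac
        (mem_momentSpace_natCast (hQ.subset hμ.1) 0) (mem_momentSpace_natCast (hQ.subset hν.1) 0))
  · exact hmem (hQ.involution_mem μ hμ.1) (hN.neg_mem _ (hvar hμ))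
      (variation_involution_le μ).absolutelyContinuous
  · exact hmem (hQ.poissonBracket_mem μ hμ.1 ν hν.1) (hconv hμ hν)
      ((isAdmissible_sigma hc h).variation_ac
        (mem_momentSpace_natCast (hQ.subset hμ.1) 1) (mem_momentSpace_natCast (hQ.subset hν.1) 1))

/-- Fubini for null sets, applied to a measurable version of addition; on almost every slice that
version agrees almost everywhere with `f + g`. -/
theorem map_add_prod_apply_eq_zero {M M' : Measure E} [SFinite M] [SFinite M']
    (h : IsConcentrated M) (h' : IsConcentrated M') {Λ : Set E} (hΛ : MeasurableSet Λ)
    (hnull : ∀ᵐ f ∂M, M' {g | f + g ∈ Λ} = 0) :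
    ((M.prod M').map fun p => p.1 + p.2) Λ = 0 := by
  have hadd : AEMeasurable (fun p : E × E => p.1 + p.2) (M.prod M') :=
    aemeasurable_prod_of_continuous continuous_add h h'
  rw [Measure.map_congr hadd.ae_eq_mk, Measure.map_apply hadd.measurable_mk hΛ,
    Measure.measure_prod_null (hadd.measurable_mk hΛ)]
  filter_upwards [hnull, Measure.ae_ae_of_ae_prod hadd.ae_eq_mk] with f hf hae
  rw [Pi.zero_apply, ← hf]
  refine measure_congr ?_
  filter_upwards [hae] with g hg
  exact propext (by change hadd.mk _ (f, g) ∈ Λ ↔ f + g ∈ Λ; rw [← hg])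

theorem isConvolutionClass_discrete :
    IsConvolutionClass {M : Measure E | ∃ S : Set E, S.Countable ∧ M Sᶜ = 0} where
  zero_mem := ⟨∅, countable_empty, rfl⟩
  mono_ac := fun M ⟨S, hS, hM⟩ M' h => ⟨S, hS, h hM⟩
  add_mem := fun M ⟨S, hS, hM⟩ M' ⟨S', hS', hM'⟩ => ⟨S ∪ S', hS.union hS', by
    rw [Measure.add_apply, compl_union]
    rw [measure_mono_null inter_subset_left hM, measure_mono_null inter_subset_right hM',
      add_zero]⟩
  neg_mem := fun M ⟨S, hS, hM⟩ => ⟨Neg.neg '' S, hS.image _, by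
    rw [Measure.map_apply measurable_neg (hS.image _).measurableSet.compl, image_neg_eq_neg,
      ← hM]
    congr 1
    ext f
    simp⟩
  conv_mem := fun M ⟨S, hS, hM⟩ M' ⟨S', hS', hM'⟩ _ _ h h' =>
    ⟨image2 (· + ·) S S', hS.image2 hS' _, by
      refine map_add_prod_apply_eq_zero h h' (hS.image2 hS' _).measurableSet.compl ?_
      have hae : ∀ᵐ f ∂M, f ∈ S := hM
      filter_upwards [hae] with f hf
      exact measure_mono_null (fun g hg hgS => hg (mem_image2_of_mem hf hgS)) hM'⟩

/-- One atomless factor makes the convolution atomless: the translate of a point is a point. -/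
theorem isConvolutionClass_continuous :
    IsConvolutionClass {M : Measure E | ∀ f : E, M {f} = 0} where
  zero_mem := fun _ => rfl
  mono_ac := fun M hM M' h f => h (hM f)
  add_mem := fun M hM M' hM' f => by rw [Measure.add_apply, hM, hM', add_zero]
  neg_mem := fun M hM f => by
    rw [Measure.map_apply measurable_neg (measurableSet_singleton f), ← hM (-f)]
    congr 1
    ext g
    simp
  conv_mem := fun M _ M' hM' _ _ h h' f =>
    map_add_prod_apply_eq_zero h h' (measurableSet_singleton f)
      (Filter.Eventually.of_forall fun g => by
        rw [← hM' (f - g)]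
        congr 1
        ext k
        simp [eq_sub_iff_add_eq'])

section Haar

variable (V : Submodule ℝ E) [FiniteDimensional ℝ V]

/-- The linear coordinates of a finite dimensional subspace used in `haarOn`. -/
noncomputable def coordMap : (Fin (Module.finrank ℝ V) → ℝ) →ₗ[ℝ] E :=
  V.subtype ∘ₗ ((Module.finBasis ℝ V).equivFun.symm : _ →ₗ[ℝ] V)

theorem haarOn_eq_map_coordMap : haarOn V = Measure.map (coordMap V) volume := by
  rw [haarOn]
  congr 1
  ext x
  simp [coordMap, Module.Basis.equivFun_symm_apply]

theorem measurable_coordMap : Measurable (coordMap V) :=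
  (coordMap V).continuous_of_finiteDimensional.measurable

theorem range_coordMap : range (coordMap V) = V := by
  ext y
  refine ⟨?_, fun hy => ⟨(Module.finBasis ℝ V).equivFun ⟨y, hy⟩, by simp [coordMap]⟩⟩
  rintro ⟨x, rfl⟩
  exact ((Module.finBasis ℝ V).equivFun.symm x).2

theorem haarOn_compl : haarOn V (V : Set E)ᶜ = 0 := by
  rw [haarOn_eq_map_coordMap, Measure.map_apply (measurable_coordMap V)
    (measurableSet_of_finiteDimensional V).compl, ← range_coordMap V]
  convert measure_empty (μ := (volume : Measure (Fin (Module.finrank ℝ V) → ℝ)))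
  ext x
  simp

theorem haarOn_preimage_add {f : E} (hf : f ∈ V) {Λ : Set E} (hΛ : MeasurableSet Λ) :
    haarOn V {g | f + g ∈ Λ} = haarOn V Λ := by
  obtain ⟨x, rfl⟩ : f ∈ range (coordMap V) := by rwa [range_coordMap]
  have hpre : {g | coordMap V x + g ∈ Λ} = (fun g => coordMap V x + g) ⁻¹' Λ := rfl
  rw [hpre, haarOn_eq_map_coordMap, Measure.map_apply (measurable_coordMap V) hΛ,
    Measure.map_apply (measurable_coordMap V) ((measurable_const_add _) hΛ),
    ← measure_preimage_add volume x (coordMap V ⁻¹' Λ)]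
  congr 1
  ext y
  simp

theorem map_neg_haarOn : (haarOn V).map (fun f => -f) = haarOn V := by
  have h : (fun f : E => -f) ∘ coordMap V = coordMap V ∘ Neg.neg := by
    ext x
    simp
  rw [haarOn_eq_map_coordMap, Measure.map_map measurable_neg (measurable_coordMap V), h,
    ← Measure.map_map (measurable_coordMap V) measurable_neg]
  congr 1
  exact Measure.map_neg_eq_self volume

/-- Absolute continuity forces `f ∈ V` for almost all `f`, and Haar measure of `V` is invariant
under translation by such `f`. -/
theorem isConvolutionClass_absolutelyContinuous :
    IsConvolutionClass {M : Measure E | M ≪ haarOn V} where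
  zero_mem := Measure.AbsolutelyContinuous.zero _
  mono_ac := fun M hM M' h => h.trans hM
  add_mem := fun M hM M' hM' Λ hΛ => by rw [Measure.add_apply, hM hΛ, hM' hΛ, add_zero]
  neg_mem := fun M hM => by
    have := Measure.AbsolutelyContinuous.map hM (measurable_neg (G := E))
    rwa [map_neg_haarOn] at this
  conv_mem := fun M hM M' hM' _ _ h h' => Measure.AbsolutelyContinuous.mk fun Λ hΛ hnull => by
    refine map_add_prod_apply_eq_zero h h' hΛ ?_
    have hae : ∀ᵐ f ∂M, f ∈ (V : Set E) := hM (haarOn_compl V)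
    filter_upwards [hae] with f hf
    exact hM' (by rw [haarOn_preimage_add V hf hΛ, hnull])

theorem mem_absContOn_iff (μ : ComplexMeasure E) : μ ∈ absContOn V ↔ μ.variation ≪ haarOn V :=
  ⟨fun h => h.2, fun h => ⟨h (haarOn_compl V), h⟩⟩

end Haar

end ConvolutionClasses

end WeylMeasure

namespace WeylMeasure

universe u

/-! ### Point measures and the list of algebras. -/

section PointMeasures

theorem zero_smul_complexMeasure {X : Type*} [MeasurableSpace X] (ρ : ComplexMeasure X) :
    (0 : ℂ) • ρ = 0 := zero_smul ℂ ρ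

variable {E : Type u} [AddCommGroup E] [Module ℝ E] [MeasurableSpace E]
  [TopologicalSpace E] [IsTopologicalAddGroup E]
  [HasContinuousSeminorms E] [ContinuousSMul ℝ E] [T2Space E] [BorelSpace E]
  {σ : E →ₗ[ℝ] E →ₗ[ℝ] ℝ} {ς : Seminorm ℝ E} {c : ℝ}

theorem dirac_mem_momentSpace (κ : Seminorm ℝ E) (n : ℕ∞) (f : E) :
    (VectorMeasure.dirac f (1 : ℂ)) ∈ momentSpace κ n := by
  refine ⟨mem_regularMeasures_iff.2 ⟨fun _ => Submodule.span ℝ {f}, monotone_const,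
    fun _ => inferInstance, ?_⟩, fun m _ => ?_⟩
  · rw [VectorMeasure.variation_dirac]
    refine Measure.ae_smul_measure ?_ _
    rw [ae_dirac_eq]
    exact ⟨0, Submodule.mem_span_singleton_self f⟩
  · rw [moment, VectorMeasure.variation_dirac, lintegral_smul_measure, lintegral_dirac]
    exact ENNReal.mul_lt_top enorm_lt_top ENNReal.ofReal_lt_top

theorem finiteMeasures_subset (κ : Seminorm ℝ E) (n : ℕ∞) :
    finiteMeasures E ⊆ momentSpace κ n := by
  intro μ hμ
  refine Submodule.span_induction (p := fun μ _ => μ ∈ momentSpace κ n) ?_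
    (zero_mem_momentSpace κ n) (fun _ _ _ _ => add_mem_momentSpace)
    (fun z _ _ => smul_mem_momentSpace z) hμ
  rintro _ ⟨f, rfl⟩
  exact dirac_mem_momentSpace κ n f

theorem IsAdmissible.kernelProduct_dirac {i : ℕ} {k : E → E → ℂ} (hk : IsAdmissible ς i k)
    (f g : E) : kernelProduct k (VectorMeasure.dirac f 1) (VectorMeasure.dirac g 1) =
      k f g • VectorMeasure.dirac (f + g) (1 : ℂ) := by
  ext Λ hΛ : 1
  rw [((hk.isImage (dirac_mem_momentSpace ς i f) (dirac_mem_momentSpace ς i g)).1 Λ hΛ).2.2,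
    kernelIntegral, VectorMeasure.integral_dirac, VectorMeasure.integral_dirac, kernelIntegrand,
    _root_.smul_apply]
  by_cases hfg : f + g ∈ Λ
  · simp [hfg, VectorMeasure.dirac_apply_of_mem hΛ]
  · simp [hfg]

theorem involution_dirac (f : E) :
    involution (VectorMeasure.dirac f (1 : ℂ)) = VectorMeasure.dirac (-f) 1 := by
  ext Λ hΛ : 1
  rw [involution_apply _ hΛ]
  by_cases hf : -f ∈ Λ
  · rw [VectorMeasure.dirac_apply_of_mem hΛ hf,
      VectorMeasure.dirac_apply_of_mem hΛ.neg (mem_neg.2 hf), map_one]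
  · rw [VectorMeasure.dirac_apply_of_notMem hf,
      VectorMeasure.dirac_apply_of_notMem (fun h => hf (mem_neg.1 h)), map_zero]

/-- By bilinearity it suffices to multiply point measures, which gives a multiple of the point
measure at the sum. -/
theorem IsAdmissible.kernelProduct_mem_finiteMeasures {i : ℕ} {k : E → E → ℂ}
    (hk : IsAdmissible ς i k) {μ ν : ComplexMeasure E} (hμ : μ ∈ finiteMeasures E)
    (hν : ν ∈ finiteMeasures E) : kernelProduct k μ ν ∈ finiteMeasures E := by
  let S : Submodule ℂ (ComplexMeasure E) :=
    Submodule.span ℂ (range fun f : E => VectorMeasure.dirac f (1 : ℂ))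
  have hS : ∀ {μ}, μ ∈ S → μ ∈ momentSpace ς i := fun hμ => finiteMeasures_subset ς i hμ
  have h0 := hS S.zero_mem
  refine Submodule.span_induction₂ (p := fun μ ν _ _ => kernelProduct k μ ν ∈ S)
    ?_ ?_ ?_ ?_ ?_ ?_ ?_ hμ hν
  · rintro _ _ ⟨f, rfl⟩ ⟨g, rfl⟩
    rw [hk.kernelProduct_dirac]
    exact S.smul_mem _ (Submodule.subset_span ⟨f + g, rfl⟩)
  · intro ν hν
    have := hk.kernelProduct_smul_left 0 h0 (hS hν)
    rw [zero_smul_complexMeasure, zero_smul_complexMeasure] at this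
    rw [this]
    exact S.zero_mem
  · intro μ hμ
    have := hk.kernelProduct_smul_right 0 (hS hμ) h0
    rw [zero_smul_complexMeasure, zero_smul_complexMeasure] at this
    rw [this]
    exact S.zero_mem
  · intro μ μ' ν hμ hμ' hν h h'
    rw [hk.kernelProduct_add_left (hS hμ) (hS hμ') (hS hν)]
    exact S.add_mem h h'
  · intro μ ν ν' hμ hν hν' h h'
    rw [hk.kernelProduct_add_right (hS hμ) (hS hν) (hS hν')]
    exact S.add_mem h h'
  · intro z μ ν hμ hν h
    rw [hk.kernelProduct_smul_left z (hS hμ) (hS hν)]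
    exact S.smul_mem z h
  · intro z μ ν hμ hν h
    rw [hk.kernelProduct_smul_right z (hS hμ) (hS hν)]
    exact S.smul_mem z h

theorem involution_mem_finiteMeasures {μ : ComplexMeasure E} (hμ : μ ∈ finiteMeasures E) :
    involution μ ∈ finiteMeasures E := by
  let S : Submodule ℂ (ComplexMeasure E) :=
    Submodule.span ℂ (range fun f : E => VectorMeasure.dirac f (1 : ℂ))
  refine Submodule.span_induction (p := fun μ _ => involution μ ∈ S) ?_ ?_ ?_ ?_ hμ
  · rintro _ ⟨f, rfl⟩
    rw [involution_dirac]
    exact Submodule.subset_span ⟨-f, rfl⟩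
  · have := involution_smul (0 : ℂ) (0 : ComplexMeasure E)
    rw [map_zero, zero_smul_complexMeasure, zero_smul_complexMeasure] at this
    rw [this]
    exact S.zero_mem
  · intro μ ν _ _ h h'
    rw [involution_add]
    exact S.add_mem h h'
  · intro z μ _ h
    rw [involution_smul]
    exact S.smul_mem _ h

theorem isMeasureAlgebra_finiteMeasures (hc : 0 ≤ c) (h : ∀ f g, |σ f g| ≤ c * ς f * ς g) :
    IsMeasureAlgebra σ ς (finiteMeasures E) where
  subset := finiteMeasures_subset ς ⊤
  zero_mem := Submodule.zero_mem _
  add_mem := fun _ hμ _ hν => Submodule.add_mem _ hμ hν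
  smul_mem := fun z _ hμ => Submodule.smul_mem _ z hμ
  twistedConv_mem := fun ħ _ hμ _ hν =>
    (isAdmissible_twistKernel h ς ħ).kernelProduct_mem_finiteMeasures hμ hν
  involution_mem := fun _ hμ => involution_mem_finiteMeasures hμ
  poissonBracket_mem := fun _ hμ _ hν =>
    (isAdmissible_sigma hc h).kernelProduct_mem_finiteMeasures hμ hν

/-- Induction on the construction lets intersections with several absolutely continuous classes
accumulate. -/
theorem IsListedAlgebra.isMeasureAlgebra (hc : 0 ≤ c) (h : ∀ f g, |σ f g| ≤ c * ς f * ς g)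
    {P : Set (ComplexMeasure E)} (hP : IsListedAlgebra ς P) : IsMeasureAlgebra σ ς P := by
  induction hP with
  | moment Q hQ => exact hQ.isMeasureAlgebra hc h
  | discrete Q hQ =>
    exact (hQ.isMeasureAlgebra hc h).inter hc h isConvolutionClass_discrete
      fun μ _ => mem_discreteMeasures_iff
  | continuous Q hQ =>
    exact (hQ.isMeasureAlgebra hc h).inter hc h isConvolutionClass_continuous
      fun μ hμ => mem_continuousMeasures_iff.trans
        (and_iff_right (mem_regularMeasures_iff.1 hμ))
  | absolutelyContinuous Q _ V ih =>
    exact ih.inter hc h (isConvolutionClass_absolutelyContinuous V)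
      fun μ _ => mem_absContOn_iff V μ
  | finite => exact isMeasureAlgebra_finiteMeasures hc h

end PointMeasures

end WeylMeasure

/-! ### The main theorem. -/

theorem mainTheorem2 {E : Type*} [AddCommGroup E] [Module ℝ E]
    [tE : TopologicalSpace E] (hE : tE = finestLocallyConvex E)
    [MeasurableSpace E] [BorelSpace E]
    (σ : E →ₗ[ℝ] E →ₗ[ℝ] ℝ) (hσ : ∀ f g, σ f g = -σ g f)
    (ς : Seminorm ℝ E) (c : ℝ) (hc : 0 < c) (hςσ : ∀ f g, |σ f g| ≤ c * ς f * ς g) :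
    -- the deformed products are well defined on `M(E)`
    (∀ ħ : ℝ, ∀ μ ∈ regularMeasures E, ∀ ν ∈ regularMeasures E,
      KernelProductDefined (twistKernel σ ħ) μ ν ∧ twistedConv σ ħ μ ν ∈ regularMeasures E) ∧
    -- `{μ, ν}_0` is a well-defined measure in `M(E)`
    (∀ μ ∈ momentSpace ς 1, ∀ ν ∈ momentSpace ς 1,
      KernelProductDefined (fun f g => (σ f g : ℂ)) μ ν ∧
        poissonBracket σ μ ν ∈ regularMeasures E) ∧
    -- moment estimate
    (∀ n : ℕ, 1 ≤ n → ∀ μ ∈ momentSpace ς n, ∀ ν ∈ momentSpace ς n,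
      poissonBracket σ μ ν ∈ momentSpace ς ((n - 1 : ℕ) : ℕ∞) ∧
      momentNorm ς (n - 1) (poissonBracket σ μ ν) ≤
        ENNReal.ofReal c * (binomConst (n - 1) : ℝ≥0∞) * momentNorm ς n μ * momentNorm ς n ν) ∧
    -- joint continuity of `(ħ, μ, ν) ↦ {μ, ν}_ħ`
    (∀ n : ℕ∞, 1 ≤ n →
      (∀ ħ : ℝ, ∀ μ ∈ momentSpace ς n, ∀ ν ∈ momentSpace ς n,
        bracket σ ħ μ ν ∈ momentSpace ς (n - 1)) ∧
      @ContinuousOn (ℝ × ComplexMeasure E × ComplexMeasure E) (ComplexMeasure E)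
        (@instTopologicalSpaceProd _ _ inferInstance
          (@instTopologicalSpaceProd _ _ (momentTopology ς n) (momentTopology ς n)))
        (momentTopology ς (n - 1))
        (fun p => bracket σ p.1 p.2.1 p.2.2)
        (univ ×ˢ momentSpace ς n ×ˢ momentSpace ς n)) ∧
    -- joint continuity of the Poisson bracket on `M_ς^∞(E)`
    (@ContinuousOn (ComplexMeasure E × ComplexMeasure E) (ComplexMeasure E)
      (@instTopologicalSpaceProd _ _ (momentTopology ς ⊤) (momentTopology ς ⊤))
      (momentTopology ς ⊤)
      (fun p => poissonBracket σ p.1 p.2)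
      (momentSpace ς ⊤ ×ˢ momentSpace ς ⊤)) ∧
    -- the Poisson algebras
    IsPoissonAlgebra (momentSpace ς ⊤) (twistedConv σ 0) involution (poissonBracket σ) ∧
    (∀ P : Set (ComplexMeasure E), IsListedAlgebra ς P →
      P ⊆ momentSpace ς ⊤ ∧
      IsPoissonAlgebra P (twistedConv σ 0) involution (poissonBracket σ) ∧
      ∀ ħ : ℝ, ∀ μ ∈ P, ∀ ν ∈ P, twistedConv σ ħ μ ν ∈ P) := by
  have : IsTopologicalAddGroup E := hE ▸ isTopologicalAddGroup_finestLocallyConvex E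
  have : ContinuousSMul ℝ E := hE ▸ continuousSMul_finestLocallyConvex E
  have : HasContinuousSeminorms E := hE ▸ hasContinuousSeminorms_finestLocallyConvex E
  have : T2Space E := t2Space_of_hasContinuousSeminorms
  have h1 : ∀ {μ}, μ ∈ momentSpace ς 1 → μ ∈ momentSpace ς ((1 : ℕ) : ℕ∞) := fun hμ => by
    rwa [Nat.cast_one]
  have h0 : ∀ {μ}, μ ∈ regularMeasures E → μ ∈ momentSpace ς ((0 : ℕ) : ℕ∞) := fun hμ => by
    rwa [Nat.cast_zero, momentSpace_zero]
  have hk := isAdmissible_sigma hc.le hςσ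
  refine ⟨fun ħ μ hμ ν hν => ?_, fun μ hμ ν hν => ?_, fun n hn μ hμ ν hν => ?_, fun n hn => ?_,
    ?_, ?_, fun P hP => ?_⟩
  · have ht := isAdmissible_twistKernel hςσ ς ħ
    exact ⟨(ht.isImage (h0 hμ) (h0 hν)).1, ht.mem_regularMeasures (h0 hμ) (h0 hν)⟩
  · exact ⟨(hk.isImage (h1 hμ) (h1 hν)).1, hk.mem_regularMeasures (h1 hμ) (h1 hν)⟩
  -- Writing `n = m + 1` makes the truncated subtraction exact; the Poisson kernel is the bracket
  -- kernel at `ħ = 0`.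
  · obtain ⟨m, rfl⟩ := Nat.exists_eq_add_of_le' hn
    have hcont := continuous_bracketKernel_apply hςσ 0
    have hb := bracketKernel_bound hςσ 0
    rw [bracketKernel_zero] at hcont hb
    rw [Nat.add_sub_cancel]
    exact ⟨kernelProduct_mem_momentSpace hcont hc.le hb (by exact_mod_cast hμ)
      (by exact_mod_cast hν),
      momentNorm_kernelProduct_le hcont hc.le hb (momentSpace_mono ς (by exact_mod_cast hn) hμ)
        (momentSpace_mono ς (by exact_mod_cast hn) hν) m⟩
  · exact ⟨fun ħ μ hμ ν hν => bracket_mem_momentSpace hσ hc.le hςσ hn ħ hμ hν,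
      continuousOn_bracket hσ hc.le hςσ hn⟩
  · exact continuousOn_poissonBracket hσ hc.le hςσ
  -- This is the moment algebra with `κ = ς` and `C = 1`.
  · exact (isMeasureAlgebra_momentSpace hc.le hςσ zero_le_one fun f =>
      (one_mul (ς f)).ge).isPoissonAlgebra hσ hc.le hςσ
  · have hA := hP.isMeasureAlgebra hc.le hςσ
    exact ⟨hA.subset, hA.isPoissonAlgebra hσ hc.le hςσ, hA.twistedConv_mem⟩
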